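/- Let $\mathbb{k}$ be a field of characteristic zero. All signs follow the super convention, and formulas stated for homogeneous elements are extended linearly. **Frobenius great pairs.** Let $A=A_{\bar 0}\oplus A_{\bar 1}$ be a locally finite, locally unital $\mathbb{k}$-superalgebra with distinguished set $I\subseteq A_{\bar 0}$ of orthogonal idempotents, so $A=\bigoplus_{i,j\in I}jAi$ with all $jAi$ finite dimensional. Let $A^*=\bigoplus_{i,j}(jAi)^*$ be the local dual, with $(f\cdot\theta\cdot g)(h)=(-1)^{\bar f\bar\theta+\bar f\bar g+\bar f\bar h}\theta(ghf)$. A *Frobenius great pair* $\mathcal A=((A,\mathfrak a)_I,\mathrm{tr},\psi)$ consists of such an $A$, a subalgebra $I\subseteq\mathfrak a\subseteq A_{\bar 0}$, an even linear map $\mathrm{tr}:A\to\mathbb{k}$ and an automorphism $\psi$ of the superalgebra $A$ that fixes $I$ pointwise and satisfies $\psi(\mathfrak a)=\mathfrak a$, such that: (i) $\phi_{\mathrm{tr}}:A\to{}^{\psi}(A^*)$, $f\mapsto(g\mapsto\mathrm{tr}(fg))$, is a parity preserving isomorphism of bimodules (the left action on $A^*$ being twisted by $\psi$); (ii) there is a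 *good basis*, that is, homogeneous bases ${}_j\mathtt B_i$ of all $jAi$ such that ${}_j\mathtt B_i\cap\mathfrak a$ is a basis of $j\mathfrak ai$ and $i\in{}_i\mathtt B_i$; (iii) if $\phi_{\mathrm{tr}}(f)$ vanishes on $A_{\bar 1}+\mathfrak a$, then $f\in\mathfrak a$. Fix a good basis, with a total order on each ${}_j\mathtt B_i$. For $b\in{}_j\mathtt B_i$ let $b^\vee\in iAj$ be the dual basis element, determined by $\mathrm{tr}(b^\vee c)=\delta_{b,c}$. Put $A^{(1)}=A$ and $A^{(z)}=\mathfrak a$ for $z>1$. **The categories.** Diagrams are read from bottom to top. Strands of thickness $0$ (with everything on them) are deleted, diagrams with a strand of negative thickness are zero, and of two coupons at the same height the left one is slightly above the right one. Let $\mathbf{Web}^{\mathrm{aff}}_{\mathcal A}$ be the strict monoidal $\mathbb{k}$-linear supercategory whose objects are the words in the symbols $i^{(x)}$ ($i\in I$, $x\ge 0$) with $i^{(0)}=\mathbb 1$, under concatenation, with generating morphisms splits $i^{(x+y)}\to i^{(x)}i^{(y)}$, merges $i^{(x)}i^{(y)}\to i^{(x+y)}$, crossings $i^{(x)}j^{(y)}\to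 j^{(y)}i^{(x)}$, coupons $f:i^{(z)}\to j^{(z)}$ for $f\in jA^{(z)}i$, and affine dots $i^{(z)}\to i^{(z)}$ for all $z>0$; coupons have the parity of $f$ and all other generators are even. The relations are, for all colors and thicknesses unless stated otherwise: 1. splits are coassociative and merges are associative; 2. for $x+y=z+w$, the merge $i^{(x)}i^{(y)}\to i^{(x+y)}$ followed by the split $i^{(z+w)}\to i^{(z)}i^{(w)}$ equals $\sum_{t\ge0}$ of: split $i^{(x)}\to i^{(x-t)}i^{(t)}$ and $i^{(y)}\to i^{(z+t-x)}i^{(w-t)}$, cross the two middle strands, and merge to $i^{(z)}i^{(w)}$; 3. the split $i^{(x+y)}\to i^{(x)}i^{(y)}$ followed by the merge is $\binom{x+y}{x}\mathrm{id}$; 4. for distinct colors: crossing twice is the identity, the braid relation holds, and a strand of another color can be moved across a split or a merge, on either side; 5. the coupon $i$ on $i^{(x)}$ is the identity; a coupon $\alpha f$ ($\alpha\in\mathbb{k}$) on thickness $x$ is $\alpha^x$ times the coupon $f$; the coupon $f$ followed by the coupon $h$ is the coupon $hf$; the coupon $f+g$ on thickness $x$ is $\sum_{t=0}^{x}$ of: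 split into thicknesses $t,x-t$, put $f$ on the left and $g$ on the right strand, merge; 6. for $f\in jA_{\bar 1}i$: splitting $i^{(2)}$ into two thin strands, putting $f$ on both, and merging gives $0$; 7. a coupon above a split (below the split of the same strand) may be replaced by the same coupon on both legs, likewise for merges, and coupons slide through crossings of any colors: $(f\otimes 1)$ followed by a crossing equals the crossing followed by $(1\otimes f)$, and its mirror image; 8. the coupon $f$ followed by the affine dot equals the affine dot followed by the coupon $\psi^{-1}(f)$; an affine dot on a strand that is split (or that results from a merge) may be replaced by affine dots on both legs; 9. an affine dot on the strand $i^{(x)}$ below its crossing with $j^{(y)}$ equals $\sum_{t\ge0}(-1)^t$ of: split $i^{(x)}\to i^{(t)}i^{(x-t)}$ and $j^{(y)}\to j^{(y-t)}j^{(t)}$, apply the $t$-thick teleporter to the outer strands $i^{(t)},j^{(t)}$, turning them into $j^{(t)},i^{(t)}$, cross the inner strands and put an affine dot on $i^{(x-t)}$ above the crossing, and merge to $j^{(y)}i^{(x)}$. Here the $t$-thick teleporter from a strand $i^{(t)}$ to a strand $j^{(t)}$ on its right is $$\sum_{\mu}\frac{\{\mu\}^!_{\mathfrak a}\,\{\mu^\vee\}^!_{\mathfrak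 a}}{\{\mu\}^!}\;\mu\otimes\cdots\otimes\mu^\vee ,$$ summed over all $\mu:{}_j\mathtt B_i\to\mathbb Z_{\ge0}$ with $\sum_b\mu(b)=t$ and $\mu(b)\le1$ for odd $b$, where $\{\mu\}^!=\prod_b\mu(b)!$, and $\{\mu\}^!_{\mathfrak a}$, $\{\mu^\vee\}^!_{\mathfrak a}$ are the products of the $\mu(b)!$ over the $b$ with $b\in\mathfrak a$, respectively $b^\vee\in\mathfrak a$. The diagram $\mu:i^{(t)}\to j^{(t)}$ splits the strand into strands of thicknesses $\mu(b)$, with $b$ decreasing from left to right, puts $[b]$ on them, and merges; $\mu^\vee:j^{(t)}\to i^{(t)}$ does the same with $[b^\vee]$ and with $b$ increasing from left to right. On a strand of thickness $x$, $[f]$ is the coupon $f$ if $f\in\mathfrak a$ or $x=1$; otherwise it means: split into $x$ thin strands, put $f$ on each of them, merge. Let $\mathbf{Web}^{\mathrm{aff},1}_{\mathcal A}$ be the strict monoidal $\mathbb{k}$-linear supercategory with the same objects, the same splits, merges, crossings and coupons, and affine dots on thin strands $i^{(1)}$ only; its relations are 1.–7., the first relation of 8. for thin strands, and 9. for $x=y=1$.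 **Statement.** There is a unique strict monoidal $\mathbb{k}$-linear superfunctor $\iota:\mathbf{Web}^{\mathrm{aff},1}_{\mathcal A}\to\mathbf{Web}^{\mathrm{aff}}_{\mathcal A}$ that is the identity on objects and sends splits, merges, crossings, coupons and thin affine dots to the same diagrams. There is a unique strict monoidal $\mathbb{k}$-linear superfunctor $\kappa:\mathbf{Web}^{\mathrm{aff}}_{\mathcal A}\to\mathbf{Web}^{\mathrm{aff},1}_{\mathcal A}$ that is the identity on objects, splits, merges, crossings and coupons, and that sends, for all $i\in I$ and $x\ge1$, the affine dot on $i^{(x)}$ to the *white dot*: $\frac1{x!}$ times the diagram that splits $i^{(x)}$ into $x$ thin strands, puts a thin affine dot on each of them, and merges. Moreover $\kappa\circ\iota=\mathrm{id}$ and $\iota\circ\kappa=\mathrm{id}$; in particular $\iota$ is an isomorphism of monoidal categories. -/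

import Mathlib

open CategoryTheory

universe u v w

/-! # Strict monoidal supercategories -/

/-- A strict monoidal `k`-linear supercategory structure on a `k`-linear category `C` whose objects
form a monoid: every space of morphisms is a superspace, and morphisms can be tensored (bilinearly,
compatibly with parities), subject to the super interchange law
`(f ⊗ g) ∘ (h ⊗ l) = (-1)^(|g||h|) (f ∘ h) ⊗ (g ∘ l)` and to strict associativity and unitality. -/
class StrictMonoidalSupercategory (k : Type u) [CommRing k] (C : Type v) [Category.{w} C]
    [Preadditive C] [Linear k C] [Monoid C] where
  /-- the homogeneous morphisms of a given parity -/
  parity : ∀ X Y : C, ZMod 2 → Submodule k (X ⟶ Y)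
  isCompl_parity : ∀ X Y : C, IsCompl (parity X Y 0) (parity X Y 1)
  id_mem : ∀ X : C, 𝟙 X ∈ parity X X 0
  comp_mem : ∀ {X Y Z : C} {p q : ZMod 2} {f : X ⟶ Y} {g : Y ⟶ Z},
    f ∈ parity X Y p → g ∈ parity Y Z q → f ≫ g ∈ parity X Z (p + q)
  /-- the tensor product of morphisms -/
  tensor : ∀ {X Y X' Y' : C}, (X ⟶ Y) → (X' ⟶ Y') → (X * X' ⟶ Y * Y')
  tensor_mem : ∀ {X Y X' Y' : C} {p q : ZMod 2} {f : X ⟶ Y} {g : X' ⟶ Y'},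
    f ∈ parity X Y p → g ∈ parity X' Y' q → tensor f g ∈ parity (X * X') (Y * Y') (p + q)
  add_tensor : ∀ {X Y X' Y' : C} (f f' : X ⟶ Y) (g : X' ⟶ Y'),
    tensor (f + f') g = tensor f g + tensor f' g
  tensor_add : ∀ {X Y X' Y' : C} (f : X ⟶ Y) (g g' : X' ⟶ Y'),
    tensor f (g + g') = tensor f g + tensor f g'
  smul_tensor : ∀ {X Y X' Y' : C} (c : k) (f : X ⟶ Y) (g : X' ⟶ Y'),
    tensor (c • f) g = c • tensor f g
  tensor_smul : ∀ {X Y X' Y' : C} (c : k) (f : X ⟶ Y) (g : X' ⟶ Y'),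
    tensor f (c • g) = c • tensor f g
  id_tensor_id : ∀ X Y : C, tensor (𝟙 X) (𝟙 Y) = 𝟙 (X * Y)
  interchange : ∀ {X Y Z X' Y' Z' : C} {p q : ZMod 2} (h : X ⟶ Y) (f : Y ⟶ Z) (l : X' ⟶ Y')
    (g : Y' ⟶ Z'), g ∈ parity Y' Z' p → h ∈ parity X Y q →
    tensor h l ≫ tensor f g = ((-1 : k) ^ (p.val * q.val)) • tensor (h ≫ f) (l ≫ g)
  tensor_assoc : ∀ {X Y X' Y' X'' Y'' : C} (f : X ⟶ Y) (g : X' ⟶ Y') (h : X'' ⟶ Y''),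
    tensor (tensor f g) h =
      eqToHom (mul_assoc X X' X'') ≫ tensor f (tensor g h) ≫ eqToHom (mul_assoc Y Y' Y'').symm
  one_tensor : ∀ {X Y : C} (f : X ⟶ Y),
    tensor (𝟙 (1 : C)) f = eqToHom (one_mul X) ≫ f ≫ eqToHom (one_mul Y).symm
  tensor_one : ∀ {X Y : C} (f : X ⟶ Y),
    tensor f (𝟙 (1 : C)) = eqToHom (mul_one X) ≫ f ≫ eqToHom (mul_one Y).symm

/-- A (strict) monoidal `k`-linear superfunctor. -/
structure StrictMonoidalSuperfunctor (k : Type u) [CommRing k]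
    (C : Type*) [Category C] [Preadditive C] [Linear k C] [Monoid C]
    [StrictMonoidalSupercategory k C]
    (D : Type*) [Category D] [Preadditive D] [Linear k D] [Monoid D]
    [StrictMonoidalSupercategory k D] extends C ⥤ D where
  map_add : ∀ {X Y : C} (f g : X ⟶ Y), map (f + g) = map f + map g
  map_smul : ∀ {X Y : C} (c : k) (f : X ⟶ Y), map (c • f) = c • map f
  map_parity : ∀ {X Y : C} {p : ZMod 2} {f : X ⟶ Y},
    f ∈ StrictMonoidalSupercategory.parity (k := k) X Y p →
    map f ∈ StrictMonoidalSupercategory.parity (k := k) (obj X) (obj Y) p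
  obj_one : obj 1 = 1
  obj_mul : ∀ X Y : C, obj (X * Y) = obj X * obj Y
  map_tensor : ∀ {X Y X' Y' : C} (f : X ⟶ Y) (g : X' ⟶ Y'),
    map (StrictMonoidalSupercategory.tensor (k := k) f g) =
      eqToHom (obj_mul X X') ≫ StrictMonoidalSupercategory.tensor (k := k) (map f) (map g) ≫
        eqToHom (obj_mul Y Y').symm

/-- `F` sends the morphism `f` to the morphism `g` (in particular it sends the source and target
of `f` to those of `g`). -/
def FunctorSends {C : Type*} [Category C] {D : Type*} [Category D] (F : C ⥤ D)
    {X Y : C} (f : X ⟶ Y) {X' Y' : D} (g : X' ⟶ Y') : Prop :=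
  ∃ (hX : F.obj X = X') (hY : F.obj Y = Y'), F.map f = eqToHom hX ≫ g ≫ eqToHom hY.symm

/-! # Presentations of strict monoidal supercategories by generators and relations -/

/-- Generating morphisms between elements of the monoid `M` of objects, with their parities. -/
structure SuperSignature (M : Type u) where
  Gen : Type v
  src : Gen → M
  tgt : Gen → M
  par : Gen → ZMod 2

/-- Formal expressions: formal `k`-linear combinations of composites and tensor products of
identities and generators.  `comp f g` means "first `f`, then `g`", that is, `g` on top of `f`. -/
inductive WExpr (k : Type w) {M : Type u} [Monoid M] (G : SuperSignature.{u, v} M) :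
    M → M → Type (max u v w)
  | id (X : M) : WExpr k G X X
  | gen (g : G.Gen) : WExpr k G (G.src g) (G.tgt g)
  | comp {X Y Z : M} (f : WExpr k G X Y) (g : WExpr k G Y Z) : WExpr k G X Z
  | tensor {X Y X' Y' : M} (f : WExpr k G X Y) (g : WExpr k G X' Y') :
      WExpr k G (X * X') (Y * Y')
  | zero {X Y : M} : WExpr k G X Y
  | add {X Y : M} (f g : WExpr k G X Y) : WExpr k G X Y
  | smul {X Y : M} (c : k) (f : WExpr k G X Y) : WExpr k G X Y

infixr:80 " ≫ₑ " => WExpr.comp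
infixr:82 " ⊗ₑ " => WExpr.tensor

namespace WExpr

variable {k : Type w} {M : Type u} [Monoid M] {G : SuperSignature.{u, v} M}

/-- The identity, seen as a morphism between two equal objects. -/
def eqE {X Y : M} (h : X = Y) : WExpr k G X Y := h ▸ WExpr.id X

/-- Formal finite sums. -/
def sum {X Y : M} (L : List (WExpr k G X Y)) : WExpr k G X Y := L.foldr WExpr.add WExpr.zero

/-- The expression is visibly homogeneous of parity `p`. -/
inductive HasParity : {X Y : M} → ZMod 2 → WExpr k G X Y → Prop
  | id (X : M) : HasParity 0 (WExpr.id X)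
  | gen (g : G.Gen) : HasParity (G.par g) (WExpr.gen g)
  | comp {X Y Z : M} {p q : ZMod 2} {f : WExpr k G X Y} {g : WExpr k G Y Z} :
      HasParity p f → HasParity q g → HasParity (p + q) (f ≫ₑ g)
  | tensor {X Y X' Y' : M} {p q : ZMod 2} {f : WExpr k G X Y} {g : WExpr k G X' Y'} :
      HasParity p f → HasParity q g → HasParity (p + q) (f ⊗ₑ g)
  | zero {X Y : M} (p : ZMod 2) : HasParity p (WExpr.zero : WExpr k G X Y)
  | add {X Y : M} {p : ZMod 2} {f g : WExpr k G X Y} :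
      HasParity p f → HasParity p g → HasParity p (f.add g)
  | smul {X Y : M} {p : ZMod 2} (c : k) {f : WExpr k G X Y} :
      HasParity p f → HasParity p (f.smul c)

end WExpr

/-- Generators together with homogeneous relations. -/
structure SuperPresentation (k : Type w) {M : Type u} [Monoid M]
    (G : SuperSignature.{u, v} M) where
  rel : ∀ {X Y : M}, WExpr k G X Y → WExpr k G X Y → Prop
  rel_homogeneous : ∀ {X Y : M} {e e' : WExpr k G X Y}, rel e e' →
    ∃ p, e.HasParity p ∧ e'.HasParity p

/-- Equality in the presented category: the smallest congruence containing the relations and the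
axioms of a strict monoidal `k`-linear supercategory. -/
inductive WExpr.Eqv {k : Type w} [CommRing k] {M : Type u} [Monoid M]
    {G : SuperSignature.{u, v} M} (R : SuperPresentation k G) :
    {X Y : M} → WExpr k G X Y → WExpr k G X Y → Prop
  | rel {X Y : M} {e e' : WExpr k G X Y} : R.rel e e' → Eqv R e e'
  | refl {X Y : M} (e : WExpr k G X Y) : Eqv R e e
  | symm {X Y : M} {e e' : WExpr k G X Y} : Eqv R e e' → Eqv R e' e
  | trans {X Y : M} {e e' e'' : WExpr k G X Y} : Eqv R e e' → Eqv R e' e'' → Eqv R e e''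
  | comp_congr {X Y Z : M} {f f' : WExpr k G X Y} {g g' : WExpr k G Y Z} :
      Eqv R f f' → Eqv R g g' → Eqv R (f ≫ₑ g) (f' ≫ₑ g')
  | tensor_congr {X Y X' Y' : M} {f f' : WExpr k G X Y} {g g' : WExpr k G X' Y'} :
      Eqv R f f' → Eqv R g g' → Eqv R (f ⊗ₑ g) (f' ⊗ₑ g')
  | add_congr {X Y : M} {f f' g g' : WExpr k G X Y} :
      Eqv R f f' → Eqv R g g' → Eqv R (f.add g) (f'.add g')
  | smul_congr {X Y : M} (c : k) {f f' : WExpr k G X Y} :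
      Eqv R f f' → Eqv R (f.smul c) (f'.smul c)
  | add_assoc {X Y : M} (f g h : WExpr k G X Y) :
      Eqv R ((f.add g).add h) (f.add (g.add h))
  | add_comm {X Y : M} (f g : WExpr k G X Y) : Eqv R (f.add g) (g.add f)
  | zero_add {X Y : M} (f : WExpr k G X Y) : Eqv R (WExpr.zero.add f) f
  | smul_add {X Y : M} (c : k) (f g : WExpr k G X Y) :
      Eqv R ((f.add g).smul c) ((f.smul c).add (g.smul c))
  | add_smul {X Y : M} (c d : k) (f : WExpr k G X Y) :
      Eqv R (f.smul (c + d)) ((f.smul c).add (f.smul d))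
  | mul_smul {X Y : M} (c d : k) (f : WExpr k G X Y) :
      Eqv R (f.smul (c * d)) ((f.smul d).smul c)
  | one_smul {X Y : M} (f : WExpr k G X Y) : Eqv R (f.smul 1) f
  | zero_smul {X Y : M} (f : WExpr k G X Y) : Eqv R (f.smul 0) WExpr.zero
  | id_comp {X Y : M} (f : WExpr k G X Y) : Eqv R (WExpr.id X ≫ₑ f) f
  | comp_id {X Y : M} (f : WExpr k G X Y) : Eqv R (f ≫ₑ WExpr.id Y) f
  | comp_assoc {X Y Z W : M} (f : WExpr k G X Y) (g : WExpr k G Y Z) (h : WExpr k G Z W) :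
      Eqv R ((f ≫ₑ g) ≫ₑ h) (f ≫ₑ g ≫ₑ h)
  | add_comp {X Y Z : M} (f f' : WExpr k G X Y) (g : WExpr k G Y Z) :
      Eqv R ((f.add f') ≫ₑ g) ((f ≫ₑ g).add (f' ≫ₑ g))
  | comp_add {X Y Z : M} (f : WExpr k G X Y) (g g' : WExpr k G Y Z) :
      Eqv R (f ≫ₑ (g.add g')) ((f ≫ₑ g).add (f ≫ₑ g'))
  | smul_comp {X Y Z : M} (c : k) (f : WExpr k G X Y) (g : WExpr k G Y Z) :
      Eqv R ((f.smul c) ≫ₑ g) ((f ≫ₑ g).smul c)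
  | comp_smul {X Y Z : M} (c : k) (f : WExpr k G X Y) (g : WExpr k G Y Z) :
      Eqv R (f ≫ₑ (g.smul c)) ((f ≫ₑ g).smul c)
  | add_tensor {X Y X' Y' : M} (f f' : WExpr k G X Y) (g : WExpr k G X' Y') :
      Eqv R ((f.add f') ⊗ₑ g) ((f ⊗ₑ g).add (f' ⊗ₑ g))
  | tensor_add {X Y X' Y' : M} (f : WExpr k G X Y) (g g' : WExpr k G X' Y') :
      Eqv R (f ⊗ₑ (g.add g')) ((f ⊗ₑ g).add (f ⊗ₑ g'))
  | smul_tensor {X Y X' Y' : M} (c : k) (f : WExpr k G X Y) (g : WExpr k G X' Y') :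
      Eqv R ((f.smul c) ⊗ₑ g) ((f ⊗ₑ g).smul c)
  | tensor_smul {X Y X' Y' : M} (c : k) (f : WExpr k G X Y) (g : WExpr k G X' Y') :
      Eqv R (f ⊗ₑ (g.smul c)) ((f ⊗ₑ g).smul c)
  | id_tensor_id (X Y : M) : Eqv R (WExpr.id X ⊗ₑ WExpr.id Y) (WExpr.id (X * Y))
  | interchange {X Y Z X' Y' Z' : M} {p q : ZMod 2} (h : WExpr k G X Y) (f : WExpr k G Y Z)
      (l : WExpr k G X' Y') (g : WExpr k G Y' Z') : g.HasParity p → h.HasParity q →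
      Eqv R ((h ⊗ₑ l) ≫ₑ (f ⊗ₑ g)) (((h ≫ₑ f) ⊗ₑ (l ≫ₑ g)).smul ((-1) ^ (p.val * q.val)))
  | tensor_assoc {X Y X' Y' X'' Y'' : M} (f : WExpr k G X Y) (g : WExpr k G X' Y')
      (h : WExpr k G X'' Y'') :
      Eqv R ((f ⊗ₑ g) ⊗ₑ h) (WExpr.eqE (mul_assoc X X' X'') ≫ₑ (f ⊗ₑ (g ⊗ₑ h)) ≫ₑ
        WExpr.eqE (mul_assoc Y Y' Y'').symm)
  | one_tensor {X Y : M} (f : WExpr k G X Y) :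
      Eqv R (WExpr.id 1 ⊗ₑ f)
        (WExpr.eqE (one_mul X) ≫ₑ f ≫ₑ WExpr.eqE (one_mul Y).symm)
  | tensor_one {X Y : M} (f : WExpr k G X Y) :
      Eqv R (f ⊗ₑ WExpr.id 1)
        (WExpr.eqE (mul_one X) ≫ₑ f ≫ₑ WExpr.eqE (mul_one Y).symm)

namespace SuperPresentation

section Presented

variable {k : Type w} {M : Type u} [Monoid M] {G : SuperSignature.{u, v} M}

/-- The objects of the category presented by `R`: the elements of the monoid `M`. -/
def Obj (_R : SuperPresentation k G) : Type u := M

instance (R : SuperPresentation k G) : Monoid R.Obj := inferInstanceAs (Monoid M)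

variable [CommRing k] (R : SuperPresentation k G)

def setoid (X Y : R.Obj) : Setoid (WExpr (M := M) k G X Y) where
  r := WExpr.Eqv R
  iseqv := ⟨.refl, .symm, .trans⟩

/-- The morphisms of the presented category. -/
def Hom (X Y : R.Obj) : Type (max u v w) := Quotient (R.setoid X Y)

/-- The morphism represented by an expression. -/
def cls {X Y : R.Obj} (e : WExpr (M := M) k G X Y) : R.Hom X Y := Quotient.mk (R.setoid X Y) e

variable {R}

theorem cls_eq {X Y : R.Obj} {e e' : WExpr (M := M) k G X Y}
    (h : WExpr.Eqv (M := M) R e e') : R.cls e = R.cls e' :=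
  Quotient.sound (s := R.setoid X Y) h

theorem Hom.ind {X Y : R.Obj} {p : R.Hom X Y → Prop} (h : ∀ e, p (R.cls e)) (f : R.Hom X Y) : p f :=
  Quotient.ind (s := R.setoid X Y) h f

instance (X Y : R.Obj) : Zero (R.Hom X Y) := ⟨R.cls .zero⟩

instance (X Y : R.Obj) : Add (R.Hom X Y) :=
  ⟨Quotient.map₂ WExpr.add fun _ _ h _ _ h' => .add_congr h h'⟩

instance (X Y : R.Obj) : Neg (R.Hom X Y) :=
  ⟨Quotient.map (WExpr.smul (-1)) fun _ _ h => .smul_congr _ h⟩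

instance (X Y : R.Obj) : AddCommGroup (R.Hom X Y) where
  add_assoc := by
    intro f g h
    induction f using Hom.ind; induction g using Hom.ind; induction h using Hom.ind
    exact cls_eq (.add_assoc _ _ _)
  zero_add := by
    intro f
    induction f using Hom.ind
    exact cls_eq (.zero_add _)
  add_zero := by
    intro f
    induction f using Hom.ind
    exact cls_eq (.trans (.add_comm _ _) (.zero_add _))
  add_comm := by
    intro f g
    induction f using Hom.ind; induction g using Hom.ind
    exact cls_eq (.add_comm _ _)
  neg_add_cancel := by
    intro f
    induction f using Hom.ind with
    | h e =>
      refine cls_eq (.trans (.add_congr (.refl _) (.symm (.one_smul e))) ?_)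
      refine .trans (.symm (.add_smul _ _ _)) ?_
      rw [neg_add_cancel]
      exact .zero_smul _
  nsmul := nsmulRec
  zsmul := zsmulRec

instance (X Y : R.Obj) : Module k (R.Hom X Y) where
  smul c := Quotient.map (WExpr.smul c) fun _ _ h => .smul_congr _ h
  one_smul := by
    intro f
    induction f using Hom.ind
    exact cls_eq (.one_smul _)
  mul_smul := by
    intro c d f
    induction f using Hom.ind
    exact cls_eq (.mul_smul _ _ _)
  smul_zero := by
    intro c
    refine cls_eq (.trans (.smul_congr c (.symm (.zero_smul .zero))) ?_)
    refine .trans (.symm (.mul_smul _ _ _)) ?_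
    rw [mul_zero]
    exact .zero_smul _
  smul_add := by
    intro c f g
    induction f using Hom.ind; induction g using Hom.ind
    exact cls_eq (.smul_add _ _ _)
  add_smul := by
    intro c d f
    induction f using Hom.ind
    exact cls_eq (.add_smul _ _ _)
  zero_smul := by
    intro f
    induction f using Hom.ind
    exact cls_eq (.zero_smul _)

instance : Category R.Obj where
  Hom X Y := R.Hom X Y
  id X := R.cls (.id X)
  comp := Quotient.map₂ WExpr.comp fun _ _ h _ _ h' => .comp_congr h h'
  id_comp := by
    intro X Y f
    induction f using Hom.ind
    exact cls_eq (.id_comp _)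
  comp_id := by
    intro X Y f
    induction f using Hom.ind
    exact cls_eq (.comp_id _)
  assoc := by
    intro X Y Z W f g h
    induction f using Hom.ind; induction g using Hom.ind; induction h using Hom.ind
    exact cls_eq (.comp_assoc _ _ _)

instance : Preadditive R.Obj where
  homGroup X Y := inferInstanceAs (AddCommGroup (R.Hom X Y))
  add_comp := by
    intro X Y Z f g h
    induction f using Hom.ind; induction g using Hom.ind; induction h using Hom.ind
    exact cls_eq (.add_comp _ _ _)
  comp_add := by
    intro X Y Z f g h
    induction f using Hom.ind; induction g using Hom.ind; induction h using Hom.ind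
    exact cls_eq (.comp_add _ _ _)

instance : Linear k R.Obj where
  homModule X Y := inferInstanceAs (Module k (R.Hom X Y))
  smul_comp := by
    intro X Y Z c f g
    induction f using Hom.ind; induction g using Hom.ind
    exact cls_eq (.smul_comp _ _ _)
  comp_smul := by
    intro X Y Z f c g
    induction f using Hom.ind; induction g using Hom.ind
    exact cls_eq (.comp_smul _ _ _)

/-- The morphism of the presented category represented by an expression. -/
def homMk (R : SuperPresentation k G) {X Y : M} (e : WExpr k G X Y) :
    (show R.Obj from X) ⟶ (show R.Obj from Y) := R.cls e

theorem homMk_eqE {X Y : R.Obj} (h : X = Y) :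
    R.homMk (WExpr.eqE (k := k) (G := G) (X := X) (Y := Y) h) = eqToHom h := by
  subst h
  rfl

/-- The homogeneous morphisms of parity `p`: those represented by a homogeneous expression. -/
def parity (R : SuperPresentation k G) (X Y : R.Obj) (p : ZMod 2) : Submodule k (R.Hom X Y) where
  carrier := {f | ∃ e : WExpr (M := M) k G X Y, e.HasParity p ∧ R.cls e = f}
  add_mem' := by
    rintro _ _ ⟨e, he, rfl⟩ ⟨e', he', rfl⟩
    exact ⟨e.add e', he.add he', rfl⟩
  zero_mem' := ⟨.zero, .zero p, rfl⟩
  smul_mem' := by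
    rintro c _ ⟨e, he, rfl⟩
    exact ⟨e.smul c, he.smul c, rfl⟩

/-- The parity involution on expressions. -/
def _root_.WExpr.inv : {X Y : M} → WExpr k G X Y → WExpr k G X Y
  | _, _, .id X => .id X
  | _, _, .gen g => (WExpr.gen g).smul ((-1) ^ (G.par g).val)
  | _, _, .comp f g => f.inv ≫ₑ g.inv
  | _, _, .tensor f g => f.inv ⊗ₑ g.inv
  | _, _, .zero => .zero
  | _, _, .add f g => f.inv.add g.inv
  | _, _, .smul c f => f.inv.smul c

theorem _root_.WExpr.inv_eqE {X Y : M} (h : X = Y) :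
    (WExpr.eqE h : WExpr k G X Y).inv = WExpr.eqE h := by
  subst h; rfl

theorem _root_.WExpr.HasParity.inv {X Y : M} {p : ZMod 2} {e : WExpr k G X Y}
    (h : e.HasParity p) : e.inv.HasParity p := by
  induction h with
  | id X => exact .id X
  | gen g => exact .smul _ (.gen g)
  | comp _ _ h h' => exact .comp h h'
  | tensor _ _ h h' => exact .tensor h h'
  | zero p => exact .zero p
  | add _ _ h h' => exact .add h h'
  | smul c _ h => exact .smul c h

theorem zmod_two_cases (p : ZMod 2) : p = 0 ∨ p = 1 := by
  fin_cases p
  · exact Or.inl rfl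
  · exact Or.inr rfl

theorem neg_one_pow_val_add (p q : ZMod 2) :
    ((-1 : k) ^ (p + q).val) = (-1) ^ p.val * (-1) ^ q.val := by
  rcases zmod_two_cases p with rfl | rfl <;> rcases zmod_two_cases q with rfl | rfl
  · simp
  · simp
  · simp
  · rw [show (1 : ZMod 2) + 1 = 0 from rfl, show (1 : ZMod 2).val = 1 from rfl]
    simp

theorem eqv_inv_of_hasParity {X Y : M} {p : ZMod 2} {e : WExpr k G X Y} (h : e.HasParity p) :
    WExpr.Eqv R e.inv (e.smul ((-1) ^ p.val)) := by
  induction h with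
  | id X =>
    rw [ZMod.val_zero, pow_zero]
    exact .symm (.one_smul _)
  | gen g => exact .refl _
  | @comp _ _ _ p q _ _ _ _ h h' =>
    rw [neg_one_pow_val_add, mul_comm]
    refine .trans (.comp_congr h h') (.trans (.smul_comp _ _ _) ?_)
    exact .trans (.smul_congr _ (.comp_smul _ _ _)) (by
      rw [mul_comm]; exact .symm (.mul_smul _ _ _))
  | @tensor _ _ _ _ p q _ _ _ _ h h' =>
    rw [neg_one_pow_val_add]
    refine .trans (.tensor_congr h h') (.trans (.smul_tensor _ _ _) ?_)
    exact .trans (.smul_congr _ (.tensor_smul _ _ _)) (.symm (.mul_smul _ _ _))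
  | zero p =>
    refine .trans (.symm (.zero_smul .zero)) (.trans ?_ (.smul_congr _ (.zero_smul .zero)))
    refine .trans ?_ (.mul_smul _ _ _)
    rw [mul_zero]
    exact .refl _
  | add _ _ h h' => exact .trans (.add_congr h h') (.symm (.smul_add _ _ _))
  | smul c _ h =>
    refine .trans (.smul_congr _ h) (.trans (.symm (.mul_smul _ _ _)) ?_)
    rw [mul_comm]
    exact .mul_smul _ _ _

theorem eqv_inv {X Y : M} {e e' : WExpr k G X Y} (h : WExpr.Eqv R e e') :
    WExpr.Eqv R e.inv e'.inv := by
  induction h with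
  | rel h =>
    obtain ⟨p, hp, hp'⟩ := R.rel_homogeneous h
    exact .trans (eqv_inv_of_hasParity hp)
      (.trans (.smul_congr _ (.rel h)) (.symm (eqv_inv_of_hasParity hp')))
  | refl e => exact .refl _
  | symm _ h => exact .symm h
  | trans _ _ h h' => exact .trans h h'
  | comp_congr _ _ h h' => exact .comp_congr h h'
  | tensor_congr _ _ h h' => exact .tensor_congr h h'
  | add_congr _ _ h h' => exact .add_congr h h'
  | smul_congr c _ h => exact .smul_congr c h
  | add_assoc f g h => exact .add_assoc _ _ _
  | add_comm f g => exact .add_comm _ _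
  | zero_add f => exact .zero_add _
  | smul_add c f g => exact .smul_add _ _ _
  | add_smul c d f => exact .add_smul _ _ _
  | mul_smul c d f => exact .mul_smul _ _ _
  | one_smul f => exact .one_smul _
  | zero_smul f => exact .zero_smul _
  | id_comp f => exact .id_comp _
  | comp_id f => exact .comp_id _
  | comp_assoc f g h => exact .comp_assoc _ _ _
  | add_comp f f' g => exact .add_comp _ _ _
  | comp_add f g g' => exact .comp_add _ _ _
  | smul_comp c f g => exact .smul_comp _ _ _
  | comp_smul c f g => exact .comp_smul _ _ _
  | add_tensor f f' g => exact .add_tensor _ _ _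
  | tensor_add f g g' => exact .tensor_add _ _ _
  | smul_tensor c f g => exact .smul_tensor _ _ _
  | tensor_smul c f g => exact .tensor_smul _ _ _
  | id_tensor_id X Y => exact .id_tensor_id _ _
  | interchange h f l g hg hh => exact .interchange _ _ _ _ hg.inv hh.inv
  | tensor_assoc f g h =>
    simp only [WExpr.inv, WExpr.inv_eqE]
    exact .tensor_assoc _ _ _
  | one_tensor f =>
    simp only [WExpr.inv, WExpr.inv_eqE]
    exact .one_tensor _
  | tensor_one f =>
    simp only [WExpr.inv, WExpr.inv_eqE]
    exact .tensor_one _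

/-- Every expression is the sum of an even and an odd one. -/
theorem exists_even_odd {X Y : M} (e : WExpr k G X Y) :
    ∃ e₀ e₁ : WExpr k G X Y, e₀.HasParity 0 ∧ e₁.HasParity 1 ∧ WExpr.Eqv R e (e₀.add e₁) := by
  have pure : ∀ {X Y : M} (p : ZMod 2) (e : WExpr k G X Y), e.HasParity p →
      ∃ e₀ e₁ : WExpr k G X Y, e₀.HasParity 0 ∧ e₁.HasParity 1 ∧
        WExpr.Eqv R e (e₀.add e₁) := by
    intro X Y p e h
    rcases zmod_two_cases p with rfl | rfl
    · exact ⟨e, .zero, h, .zero _, .symm (.trans (.add_comm _ _) (.zero_add _))⟩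
    · exact ⟨.zero, e, .zero _, h, .symm (.zero_add _)⟩
  have regroup : ∀ {X Y : M} (a b c d : WExpr k G X Y),
      WExpr.Eqv R ((a.add b).add (c.add d)) ((a.add d).add (b.add c)) := by
    intro X Y a b c d
    refine .trans (.add_assoc _ _ _) (.trans (.add_congr (.refl _) ?_) (.symm (.add_assoc _ _ _)))
    exact .trans (.symm (.add_assoc _ _ _)) (.add_comm _ _)
  induction e with
  | id X => exact pure 0 _ (.id X)
  | gen g => exact pure _ _ (.gen g)
  | zero => exact pure 0 _ (.zero 0)
  | comp f g hf hg =>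
    obtain ⟨a, b, ha, hb, h⟩ := hf
    obtain ⟨c, d, hc, hd, h'⟩ := hg
    refine ⟨(a ≫ₑ c).add (b ≫ₑ d), (a ≫ₑ d).add (b ≫ₑ c), ?_, ?_, ?_⟩
    · exact .add (by simpa using ha.comp hc) (by
        have := hb.comp hd
        rwa [show (1 : ZMod 2) + 1 = 0 from rfl] at this)
    · exact .add (by simpa using ha.comp hd) (by simpa using hb.comp hc)
    · refine .trans (.comp_congr h h') (.trans (.add_comp _ _ _) ?_)
      refine .trans (.add_congr (.comp_add _ _ _)
        (.trans (.comp_add _ _ _) (.add_comm _ _))) ?_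
      refine .trans (.add_assoc _ _ _) (.trans (.add_congr (.refl _) ?_)
        (.symm (.add_assoc _ _ _)))
      refine .trans (.symm (.add_assoc _ _ _)) (.trans (.add_congr (.add_comm _ _) (.refl _)) ?_)
      exact .add_assoc _ _ _
  | tensor f g hf hg =>
    obtain ⟨a, b, ha, hb, h⟩ := hf
    obtain ⟨c, d, hc, hd, h'⟩ := hg
    refine ⟨(a ⊗ₑ c).add (b ⊗ₑ d), (a ⊗ₑ d).add (b ⊗ₑ c), ?_, ?_, ?_⟩
    · exact .add (by simpa using ha.tensor hc) (by
        have := hb.tensor hd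
        rwa [show (1 : ZMod 2) + 1 = 0 from rfl] at this)
    · exact .add (by simpa using ha.tensor hd) (by simpa using hb.tensor hc)
    · refine .trans (.tensor_congr h h') (.trans (.add_tensor _ _ _) ?_)
      refine .trans (.add_congr (.tensor_add _ _ _)
        (.trans (.tensor_add _ _ _) (.add_comm _ _))) ?_
      refine .trans (.add_assoc _ _ _) (.trans (.add_congr (.refl _) ?_)
        (.symm (.add_assoc _ _ _)))
      refine .trans (.symm (.add_assoc _ _ _)) (.trans (.add_congr (.add_comm _ _) (.refl _)) ?_)
      exact .add_assoc _ _ _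
  | add f g hf hg =>
    obtain ⟨a, b, ha, hb, h⟩ := hf
    obtain ⟨c, d, hc, hd, h'⟩ := hg
    refine ⟨a.add c, b.add d, .add ha hc, .add hb hd, ?_⟩
    refine .trans (.add_congr h (.trans h' (.add_comm _ _))) (.trans (regroup _ _ _ _) ?_)
    exact .refl _
  | smul c f hf =>
    obtain ⟨a, b, ha, hb, h⟩ := hf
    exact ⟨a.smul c, b.smul c, .smul c ha, .smul c hb,
      .trans (.smul_congr c h) (.smul_add _ _ _)⟩

end Presented

section Instance

variable {k : Type w} [Field k] [CharZero k] {M : Type u} [Monoid M]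
  {G : SuperSignature.{u, v} M} {R : SuperPresentation k G}

theorem isCompl_parity_aux (X Y : R.Obj) :
    IsCompl (R.parity X Y 0) (R.parity X Y 1) := by
  constructor
  · rw [Submodule.disjoint_def]
    rintro f ⟨e, he, rfl⟩ ⟨e', he', h⟩
    have h1 : WExpr.Eqv R e' e := Quotient.exact (s := R.setoid X Y) h
    have h2 : R.cls e.inv = R.cls e := by
      have := eqv_inv_of_hasParity (R := R) he
      simp only [ZMod.val_zero, pow_zero] at this
      exact cls_eq (.trans this (.one_smul _))
    have h3 : R.cls e.inv = (-1 : k) • R.cls e := by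
      have h4 := eqv_inv_of_hasParity (R := R) he'
      rw [show (1 : ZMod 2).val = 1 from rfl, pow_one] at h4
      exact cls_eq (.trans (.symm (eqv_inv h1)) (.trans h4 (.smul_congr _ h1)))
    have h5 : (2 : k) • R.cls e = 0 := by
      have : (2 : k) = 1 + 1 := by norm_num
      rw [this, add_smul, one_smul]
      nth_rewrite 1 [← h2]
      rw [h3, neg_smul, one_smul, neg_add_cancel]
    exact (smul_eq_zero.mp h5).resolve_left two_ne_zero
  · rw [codisjoint_iff, eq_top_iff]
    intro f _
    induction f using Hom.ind with
    | h e =>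
      obtain ⟨a, b, ha, hb, h⟩ := exists_even_odd (R := R) e
      rw [cls_eq h]
      exact Submodule.add_mem_sup (S := R.parity X Y 0) (T := R.parity X Y 1)
        (s := R.cls a) (t := R.cls b) ⟨a, ha, rfl⟩ ⟨b, hb, rfl⟩

/-- The category presented by generators and homogeneous relations is a strict monoidal
supercategory. -/
instance : StrictMonoidalSupercategory k R.Obj where
  parity X Y p := R.parity X Y p
  isCompl_parity := isCompl_parity_aux
  id_mem X := ⟨.id X, .id _, rfl⟩
  comp_mem := by
    rintro X Y Z p q _ _ ⟨e, he, rfl⟩ ⟨e', he', rfl⟩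
    exact ⟨e ≫ₑ e', he.comp he', rfl⟩
  tensor := Quotient.map₂ WExpr.tensor fun _ _ h _ _ h' => .tensor_congr h h'
  tensor_mem := by
    rintro X Y X' Y' p q _ _ ⟨e, he, rfl⟩ ⟨e', he', rfl⟩
    exact ⟨e ⊗ₑ e', he.tensor he', rfl⟩
  add_tensor := by
    intro X Y X' Y' f f' g
    induction f using Hom.ind; induction f' using Hom.ind; induction g using Hom.ind
    exact cls_eq (.add_tensor _ _ _)
  tensor_add := by
    intro X Y X' Y' f f' g
    induction f using Hom.ind; induction f' using Hom.ind; induction g using Hom.ind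
    exact cls_eq (.tensor_add _ _ _)
  smul_tensor := by
    intro X Y X' Y' c f g
    induction f using Hom.ind; induction g using Hom.ind
    exact cls_eq (.smul_tensor _ _ _)
  tensor_smul := by
    intro X Y X' Y' c f g
    induction f using Hom.ind; induction g using Hom.ind
    exact cls_eq (.tensor_smul _ _ _)
  id_tensor_id X Y := cls_eq (.id_tensor_id X Y)
  interchange := by
    rintro X Y Z X' Y' Z' p q _ f l _ ⟨eg, hg, rfl⟩ ⟨eh, hh, rfl⟩
    induction f using Hom.ind; induction l using Hom.ind
    exact cls_eq (.interchange _ _ _ _ hg hh)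
  tensor_assoc := by
    intro X Y X' Y' X'' Y'' f g h
    induction f using Hom.ind; induction g using Hom.ind; induction h using Hom.ind
    rw [← homMk_eqE, ← homMk_eqE]
    exact cls_eq (.tensor_assoc _ _ _)
  one_tensor := by
    intro X Y f
    induction f using Hom.ind
    rw [← homMk_eqE, ← homMk_eqE]
    exact cls_eq (.one_tensor _)
  tensor_one := by
    intro X Y f
    induction f using Hom.ind
    rw [← homMk_eqE, ← homMk_eqE]
    exact cls_eq (.tensor_one _)

end Instance

end SuperPresentation

/-! # Frobenius great pairs -/

/-- The subspace `jAi` of `A`, for idempotents `i` and `j`. -/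
def idemCorner (k : Type u) [Field k] {A : Type v} [NonUnitalRing A] [Module k A]
    [IsScalarTower k A A] [SMulCommClass k A A] (j i : A) : Submodule k A where
  carrier := {f | j * f = f ∧ f * i = f}
  add_mem' := by
    rintro f g ⟨h1, h2⟩ ⟨h3, h4⟩
    exact ⟨by rw [mul_add, h1, h3], by rw [add_mul, h2, h4]⟩
  zero_mem' := ⟨mul_zero _, zero_mul _⟩
  smul_mem' := by
    rintro c f ⟨h1, h2⟩
    exact ⟨by rw [mul_smul_comm, h1], by rw [smul_mul_assoc, h2]⟩

/-- A locally finite, locally unital `k`-superalgebra structure on a (possibly non-unital)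
`k`-algebra `A`, with distinguished set `I` of even orthogonal idempotents, so that
`A = ⨁ jAi` (the sum is automatically direct, since the idempotents are orthogonal). -/
structure LocallyUnitalSuperalgebra (k : Type u) [Field k] (A : Type v) [NonUnitalRing A]
    [Module k A] [IsScalarTower k A A] [SMulCommClass k A A] where
  /-- the homogeneous elements of a given parity -/
  parity : ZMod 2 → Submodule k A
  isCompl_parity : IsCompl (parity 0) (parity 1)
  mul_mem_parity : ∀ {p q : ZMod 2} {f g : A}, f ∈ parity p → g ∈ parity q →
    f * g ∈ parity (p + q)
  /-- the distinguished idempotents -/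
  I : Set A
  idem_even : ∀ i ∈ I, i ∈ parity 0
  idem_mul_self : ∀ i ∈ I, i * i = i
  idem_mul_of_ne : ∀ i ∈ I, ∀ j ∈ I, i ≠ j → i * j = 0
  iSup_corner : ⨆ j ∈ I, ⨆ i ∈ I, idemCorner k j i = ⊤
  locally_finite : ∀ j ∈ I, ∀ i ∈ I, (idemCorner k j i).FG

namespace LocallyUnitalSuperalgebra

variable {k : Type u} [Field k] {A : Type v} [NonUnitalRing A] [Module k A] [IsScalarTower k A A]
  [SMulCommClass k A A]

/-- The subspace `jAi`. -/
def corner (S : LocallyUnitalSuperalgebra k A) (j i : S.I) : Submodule k A :=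
  idemCorner k (j : A) (i : A)

/-- The map `φ_tr : f ↦ (g ↦ tr (f g))`. -/
def phi (tr : A →ₗ[k] k) : A →ₗ[k] Module.Dual k A := (LinearMap.mul k A).compr₂ tr

/-- The local dual `A^* = ⨁ (jAi)^*`: linear functionals on `A` that vanish on all but finitely
many of the `jAi`. -/
def localDual (S : LocallyUnitalSuperalgebra k A) : Set (Module.Dual k A) :=
  {θ | {p : S.I × S.I | ∃ f ∈ S.corner p.1 p.2, θ f ≠ 0}.Finite}

end LocallyUnitalSuperalgebra

/-- A good basis for `(A, 𝔞)_I`: ordered homogeneous bases of all the `jAi`, which restrict to bases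
of the `j𝔞i = 𝔞 ∩ jAi` and contain the distinguished idempotents.  The basis of `jAi` is listed
in decreasing order. -/
structure GoodBasis {k : Type u} [Field k] {A : Type v} [NonUnitalRing A] [Module k A]
    [IsScalarTower k A A] [SMulCommClass k A A] (S : LocallyUnitalSuperalgebra k A)
    (𝔞 : NonUnitalSubalgebra k A) where
  card : S.I → S.I → ℕ
  vec : ∀ j i : S.I, Fin (card j i) → A
  /-- the parity of a basis vector -/
  par : ∀ j i : S.I, Fin (card j i) → ZMod 2
  vec_mem_parity : ∀ j i r, vec j i r ∈ S.parity (par j i r)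
  linearIndependent : ∀ j i, LinearIndependent k (vec j i)
  span_eq : ∀ j i, Submodule.span k (Set.range (vec j i)) = S.corner j i
  span_inter : ∀ j i, Submodule.span k (Set.range (vec j i) ∩ (𝔞 : Set A)) =
    𝔞.toSubmodule ⊓ S.corner j i
  idem_mem : ∀ i : S.I, (i : A) ∈ Set.range (vec i i)

/-- A Frobenius great pair `((A, 𝔞)_I, tr, ψ)`. -/
structure FrobeniusGreatPair (k : Type u) [Field k] (A : Type v) [NonUnitalRing A]
    [Module k A] [IsScalarTower k A A] [SMulCommClass k A A] extends
    LocallyUnitalSuperalgebra k A where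
  /-- the trace map -/
  tr : A →ₗ[k] k
  tr_odd : ∀ f ∈ parity 1, tr f = 0
  /-- the Nakayama automorphism -/
  ψ : A ≃ₗ[k] A
  ψ_mul : ∀ f g, ψ (f * g) = ψ f * ψ g
  ψ_parity : ∀ {p : ZMod 2} {f : A}, f ∈ parity p → ψ f ∈ parity p
  ψ_idem : ∀ i ∈ I, ψ i = i
  /-- `φ_tr` is a bijection from `A` to the local dual `A^*` … -/
  phi_injective : Function.Injective (LocallyUnitalSuperalgebra.phi (k := k) tr)
  range_phi : Set.range (LocallyUnitalSuperalgebra.phi (k := k) tr) =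
    toLocallyUnitalSuperalgebra.localDual
  /-- … and intertwines the left actions, where the left action on `A^*` is twisted by `ψ`:
  `φ_tr (f g) = ψ(f) · φ_tr (g)`, with `(f · θ)(h) = (-1)^(|f||θ| + |f||h|) θ(h f)`.  (It
  intertwines the right actions `(θ · g)(h) = θ(g h)` by associativity, and it is parity
  preserving since `tr` is even.) -/
  phi_mul : ∀ {p q r : ZMod 2} {f g h : A}, f ∈ parity p → g ∈ parity q → h ∈ parity r →
    tr ((f * g) * h) = ((-1 : k) ^ (p.val * q.val + p.val * r.val)) * tr (g * (h * ψ f))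
  /-- the even subalgebra -/
  𝔞 : NonUnitalSubalgebra k A
  idem_mem : ∀ i ∈ I, i ∈ 𝔞
  𝔞_even : ∀ f ∈ 𝔞, f ∈ parity 0
  exists_goodBasis : Nonempty (GoodBasis toLocallyUnitalSuperalgebra 𝔞)
  ψ_𝔞 : ∀ f, ψ f ∈ 𝔞 ↔ f ∈ 𝔞
  /-- the great condition: if `φ_tr (f)` vanishes on `A_1 + 𝔞`, then `f ∈ 𝔞` -/
  great : ∀ f : A, (∀ g ∈ parity 1 ⊔ 𝔞.toSubmodule, tr (f * g) = 0) → f ∈ 𝔞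

namespace FrobeniusGreatPair

variable {k : Type u} [Field k] {A : Type v} [NonUnitalRing A] [Module k A] [IsScalarTower k A A]
  [SMulCommClass k A A]

abbrev GoodBasis (P : FrobeniusGreatPair k A) : Type v :=
  _root_.GoodBasis P.toLocallyUnitalSuperalgebra P.𝔞

abbrev corner (P : FrobeniusGreatPair k A) (j i : P.I) : Submodule k A :=
  P.toLocallyUnitalSuperalgebra.corner j i

variable {P : FrobeniusGreatPair k A}

theorem vec_mem_corner (B : P.GoodBasis) (j i : P.I) (r : Fin (B.card j i)) :
    B.vec j i r ∈ P.corner j i := by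
  change _ ∈ P.toLocallyUnitalSuperalgebra.corner j i
  rw [← B.span_eq]
  exact Submodule.subset_span ⟨r, rfl⟩

theorem tr_mul_eq_zero {p q : ZMod 2} {f g : A} (hf : f ∈ P.parity p) (hg : g ∈ P.parity q)
    (h : p + q = 1) : P.tr (f * g) = 0 :=
  P.tr_odd _ (h ▸ P.mul_mem_parity hf hg)

theorem exists_parity_add (f : A) : ∃ f₀ ∈ P.parity 0, ∃ f₁ ∈ P.parity 1, f₀ + f₁ = f := by
  have h : f ∈ P.parity 0 ⊔ P.parity 1 := by
    rw [P.isCompl_parity.sup_eq_top]; trivial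
  exact Submodule.mem_sup.mp h

theorem exists_dual (B : P.GoodBasis) (j i : P.I) (r : Fin (B.card j i)) :
    ∃ f : A, f ∈ P.corner i j ∧ f ∈ P.parity (B.par j i r) ∧
      ∀ s, P.tr (f * B.vec j i s) = if s = r then 1 else 0 := by
  classical
  -- a functional on `A` that extends the coordinate function of the basis vector
  obtain ⟨l, hl⟩ : ∃ l : A →ₗ[k] k, ∀ s, l (B.vec j i s) = if s = r then 1 else 0 := by
    have hli := B.linearIndependent j i
    obtain ⟨l, hl⟩ := LinearMap.exists_extend
      ((Finsupp.lapply (R := k) r).comp hli.repr)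
    refine ⟨l, fun s => ?_⟩
    have := LinearMap.congr_fun hl ⟨B.vec j i s, Submodule.subset_span ⟨s, rfl⟩⟩
    simp only [LinearMap.comp_apply, Submodule.subtype_apply] at this
    rw [this]
    have h2 : hli.repr ⟨B.vec j i s, Submodule.subset_span ⟨s, rfl⟩⟩ = Finsupp.single s 1 :=
      hli.repr_eq_single s _ rfl
    simp [h2, Finsupp.single_apply]
  have hj := P.idem_mul_self j j.2
  have hi := P.idem_mul_self i i.2
  let θ : Module.Dual k A :=
    l.comp ((LinearMap.mulLeft k (j : A)).comp (LinearMap.mulRight k (i : A)))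
  have hθ : ∀ f, θ f = l (j * (f * i)) := fun f => rfl
  have hloc : θ ∈ P.toLocallyUnitalSuperalgebra.localDual := by
    refine Set.Finite.subset (Set.finite_singleton ((j, i) : P.I × P.I)) ?_
    rintro ⟨j', i'⟩ ⟨f, ⟨h1, h2⟩, h3⟩
    by_contra hne
    apply h3
    have : (j : A) * (f * i) = 0 := by
      by_cases hjj : j = j'
      · have hii : i' ≠ i := fun h => hne (by rw [hjj, h]; rfl)
        have h0 := P.idem_mul_of_ne i' i'.2 i i.2 (fun h => hii (Subtype.ext h))
        dsimp only at h2
        rw [← h2, mul_assoc, h0, mul_zero, mul_zero]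
      · have h0 := P.idem_mul_of_ne j j.2 j' j'.2 (fun h => hjj (Subtype.ext h))
        dsimp only at h1
        rw [← h1, ← mul_assoc, ← mul_assoc, h0, zero_mul, zero_mul]
    rw [hθ, this, map_zero]
  rw [← P.range_phi] at hloc
  obtain ⟨f, hf⟩ := hloc
  have hf' : ∀ g, P.tr (f * g) = l (j * (g * i)) := fun g => LinearMap.congr_fun hf g
  obtain ⟨f₀, h₀, f₁, h₁, rfl⟩ := exists_parity_add (P := P) f
  -- the component of `f` of the right parity
  let F : ZMod 2 → A := fun p => if p = 0 then f₀ else f₁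
  have hF : ∀ p, F p ∈ P.parity p := by
    intro p
    rcases SuperPresentation.zmod_two_cases p with rfl | rfl
    · exact h₀
    · exact h₁
  have hsum : ∀ p, f₀ + f₁ = F p + F (p + 1) := by
    intro p
    rcases SuperPresentation.zmod_two_cases p with rfl | rfl
    · rfl
    · exact add_comm _ _
  set p := B.par j i r with hp
  have hvec := vec_mem_corner B j i
  have key : ∀ s, P.tr (F p * B.vec j i s) = if s = r then 1 else 0 := by
    intro s
    obtain ⟨h1, h2⟩ := hvec s
    by_cases hs : B.par j i s = p
    · have h3 : P.tr (F (p + 1) * B.vec j i s) = 0 := by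
        refine tr_mul_eq_zero (hF (p + 1)) (B.vec_mem_parity j i s) ?_
        rw [hs]
        rcases SuperPresentation.zmod_two_cases p with h | h <;> rw [h] <;> rfl
      have h4 := hf' (B.vec j i s)
      rw [hsum p, add_mul, map_add, h3, add_zero, h2, h1, hl] at h4
      exact h4
    · have hsr : s ≠ r := fun h => hs (by rw [h])
      rw [if_neg hsr]
      refine tr_mul_eq_zero (hF p) (B.vec_mem_parity j i s) ?_
      rcases SuperPresentation.zmod_two_cases p with h | h <;>
        rcases SuperPresentation.zmod_two_cases (B.par j i s) with h' | h' <;>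
        rw [h, h'] at hs <;> rw [h, h'] <;> first | rfl | exact absurd rfl hs
  refine ⟨i * (F p * j), ⟨?_, ?_⟩, ?_, ?_⟩
  · rw [← mul_assoc, hi]
  · rw [mul_assoc, mul_assoc, hj]
  · have := P.mul_mem_parity (P.idem_even i i.2)
      (P.mul_mem_parity (hF p) (P.idem_even j j.2))
    rwa [zero_add, add_zero] at this
  · intro s
    obtain ⟨h1, h2⟩ := hvec s
    have h3 := P.phi_mul (P.idem_even i i.2) (P.mul_mem_parity (hF p) (P.idem_even j j.2))
      (B.vec_mem_parity j i s)
    rw [P.ψ_idem i i.2, h2, mul_assoc (F p), h1, key s] at h3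
    rw [h3]
    simp

/-- The dual basis vector `b^∨ ∈ iAj` of the basis vector `b ∈ jAi`, determined by
`tr (b^∨ c) = δ_{b,c}` for all basis vectors `c`. -/
noncomputable def dualVec (B : P.GoodBasis) (j i : P.I) (r : Fin (B.card j i)) : A :=
  Classical.choose (exists_dual B j i r)

theorem dualVec_spec (B : P.GoodBasis) (j i : P.I) (r : Fin (B.card j i)) :
    dualVec B j i r ∈ P.corner i j ∧ dualVec B j i r ∈ P.parity (B.par j i r) ∧
      ∀ s, P.tr (dualVec B j i r * B.vec j i s) = if s = r then 1 else 0 :=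
  Classical.choose_spec (exists_dual B j i r)

end FrobeniusGreatPair

/-! # Web categories -/

namespace AffineWeb

open FrobeniusGreatPair

variable {k : Type u} [Field k] {A : Type v} [NonUnitalRing A] [Module k A] [IsScalarTower k A A]
  [SMulCommClass k A A]

/-- Reduced `I`-colored compositions, i.e. words in the symbols `i^(x)` with `i ∈ I` and `x > 0`:
the objects of all web categories.  The tensor product of objects is concatenation. -/
abbrev Comps (P : FrobeniusGreatPair k A) : Type v := FreeMonoid (P.I × ℕ+)

/-- The object `i^(x)`; `i^(0)` is the unit object. -/
def strand {P : FrobeniusGreatPair k A} (i : P.I) : ℕ → Comps P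
  | 0 => 1
  | x + 1 => FreeMonoid.of (i, x.succPNat)

/-- `f` is a homogeneous element of `j A^(z) i` of parity `p`, where `A^(1) = A`, and
`A^(z) = 𝔞` (which is even) if `z > 1`. -/
def IsCoupon (P : FrobeniusGreatPair k A) (z : ℕ) (j i : P.I) (p : ZMod 2) (f : A) : Prop :=
  f ∈ P.corner j i ∧ f ∈ P.parity p ∧ (2 ≤ z → p = 0 ∧ f ∈ P.𝔞)

section IsCoupon

variable {P : FrobeniusGreatPair k A} {z : ℕ} {i j l : P.I} {p q : ZMod 2} {f g h : A}

theorem IsCoupon.mono {z' : ℕ} (hf : IsCoupon P z j i p f) (hz : z' ≤ z) :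
    IsCoupon P z' j i p f :=
  ⟨hf.1, hf.2.1, fun h => hf.2.2 (h.trans hz)⟩

theorem IsCoupon.idem (z : ℕ) (i : P.I) : IsCoupon P z i i 0 (i : A) :=
  ⟨⟨P.idem_mul_self i i.2, P.idem_mul_self i i.2⟩, P.idem_even i i.2,
    fun _ => ⟨rfl, P.idem_mem i i.2⟩⟩

theorem IsCoupon.smul (c : k) (hf : IsCoupon P z j i p f) : IsCoupon P z j i p (c • f) :=
  ⟨Submodule.smul_mem _ c hf.1, Submodule.smul_mem _ c hf.2.1,
    fun h => ⟨(hf.2.2 h).1, P.𝔞.smul_mem c (hf.2.2 h).2⟩⟩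

theorem IsCoupon.add (hf : IsCoupon P z j i p f) (hg : IsCoupon P z j i p g) :
    IsCoupon P z j i p (f + g) :=
  ⟨Submodule.add_mem _ hf.1 hg.1, Submodule.add_mem _ hf.2.1 hg.2.1,
    fun h => ⟨(hf.2.2 h).1, P.𝔞.add_mem (hf.2.2 h).2 (hg.2.2 h).2⟩⟩

/-- The product `h f`, for `f ∈ jAi` and `h ∈ lAj`. -/
theorem IsCoupon.mul (hf : IsCoupon P z j i p f) (hh : IsCoupon P z l j q h) :
    IsCoupon P z l i (p + q) (h * f) := by
  refine ⟨⟨?_, ?_⟩, ?_, fun hz => ⟨?_, P.𝔞.mul_mem (hh.2.2 hz).2 (hf.2.2 hz).2⟩⟩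
  · rw [← mul_assoc, hh.1.1]
  · rw [mul_assoc, hf.1.2]
  · rw [add_comm]
    exact P.mul_mem_parity hh.2.1 hf.2.1
  · rw [(hf.2.2 hz).1, (hh.2.2 hz).1, add_zero]

theorem ψ_symm_mem_parity (hf : f ∈ P.parity p) : P.ψ.symm f ∈ P.parity p := by
  obtain ⟨f₀, h₀, f₁, h₁, h⟩ := exists_parity_add (P := P) (P.ψ.symm f)
  have h' : P.ψ f₀ + P.ψ f₁ = f := by rw [← map_add, h, LinearEquiv.apply_symm_apply]
  have hd := Submodule.disjoint_def.mp P.isCompl_parity.disjoint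
  rcases SuperPresentation.zmod_two_cases p with rfl | rfl
  · have : P.ψ f₁ = f - P.ψ f₀ := by rw [← h']; abel
    have h1 : P.ψ f₁ = 0 := hd _
      (this ▸ Submodule.sub_mem _ hf (P.ψ_parity h₀)) (P.ψ_parity h₁)
    have h2 : f₁ = 0 := by simpa using h1
    rw [← h, h2, add_zero]
    exact h₀
  · have : P.ψ f₀ = f - P.ψ f₁ := by rw [← h']; abel
    have h1 : P.ψ f₀ = 0 := hd _ (P.ψ_parity h₀)
      (this ▸ Submodule.sub_mem _ hf (P.ψ_parity h₁))
    have h2 : f₀ = 0 := by simpa using h1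
    rw [← h, h2, zero_add]
    exact h₁

theorem IsCoupon.ψ_symm (hf : IsCoupon P z j i p f) :
    IsCoupon P z j i p (P.ψ.symm f) := by
  refine ⟨⟨?_, ?_⟩, ψ_symm_mem_parity hf.2.1, fun hz => ⟨(hf.2.2 hz).1, ?_⟩⟩
  · apply P.ψ.injective
    rw [P.ψ_mul, P.ψ_idem j j.2, LinearEquiv.apply_symm_apply, hf.1.1]
  · apply P.ψ.injective
    rw [P.ψ_mul, P.ψ_idem i i.2, LinearEquiv.apply_symm_apply, hf.1.2]
  · rw [← P.ψ_𝔞, LinearEquiv.apply_symm_apply]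
    exact (hf.2.2 hz).2

end IsCoupon

/-- The generating morphisms: splits `i^(x+y) → i^(x) i^(y)`, merges `i^(x) i^(y) → i^(x+y)`,
crossings `i^(x) j^(y) → j^(y) i^(x)`, coupons `i^(z) → j^(z)`, and affine dots `i^(z) → i^(z)`
of the thicknesses `z` that satisfy `D`.  (Strands of thickness zero are deleted, so all
thicknesses are positive here.) -/
inductive WebGen (P : FrobeniusGreatPair k A) (D : ℕ → Prop) : Type v
  | split (i : P.I) (x y : ℕ+)
  | merge (i : P.I) (x y : ℕ+)
  | cross (i j : P.I) (x y : ℕ+)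
  | coupon (z : ℕ+) (j i : P.I) (p : ZMod 2) (f : A) (hf : IsCoupon P z j i p f)
  | dot (i : P.I) (z : ℕ+) (hz : D z)

/-- The sources, targets and parities of the generators. -/
def webSig (P : FrobeniusGreatPair k A) (D : ℕ → Prop) : SuperSignature.{v, v} (Comps P) where
  Gen := WebGen P D
  src
    | .split i x y => strand i (x + y)
    | .merge i x y => strand i x * strand i y
    | .cross i j x y => strand i x * strand j y
    | .coupon z _ i _ _ _ => strand i z
    | .dot i z _ => strand i z
  tgt
    | .split i x y => strand i x * strand i y
    | .merge i x y => strand i (x + y)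
    | .cross i j x y => strand j y * strand i x
    | .coupon z j _ _ _ _ => strand j z
    | .dot i z _ => strand i z
  par
    | .coupon _ _ _ p _ _ => p
    | _ => 0

/-- Formal linear combinations of web diagrams. -/
abbrev Dia (P : FrobeniusGreatPair k A) (D : ℕ → Prop) (X Y : Comps P) : Type (max v u) :=
  WExpr k (webSig P D) X Y

section Diagrams

variable {P : FrobeniusGreatPair k A} {D : ℕ → Prop}

/-! The generating diagrams for arbitrary thicknesses `≥ 0`, where strands of thickness zero (and
any decorations on them) are deleted. -/

/-- split `i^(x+y) → i^(x) i^(y)` -/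
def split (i : P.I) (x y : ℕ) : Dia P D (strand i (x + y)) (strand i x * strand i y) :=
  if hx : 0 < x then
    if hy : 0 < y then WExpr.gen (G := webSig P D) (.split i ⟨x, hx⟩ ⟨y, hy⟩)
    else WExpr.eqE (by obtain rfl : y = 0 := by omega
                       exact (mul_one _).symm)
  else WExpr.eqE (by obtain rfl : x = 0 := by omega
                     rw [Nat.zero_add]
                     exact (one_mul _).symm)

/-- merge `i^(x) i^(y) → i^(x+y)` -/
def merge (i : P.I) (x y : ℕ) : Dia P D (strand i x * strand i y) (strand i (x + y)) :=
  if hx : 0 < x then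
    if hy : 0 < y then WExpr.gen (G := webSig P D) (.merge i ⟨x, hx⟩ ⟨y, hy⟩)
    else WExpr.eqE (by obtain rfl : y = 0 := by omega
                       exact mul_one _)
  else WExpr.eqE (by obtain rfl : x = 0 := by omega
                     rw [Nat.zero_add]
                     exact one_mul _)

/-- crossing `i^(x) j^(y) → j^(y) i^(x)` -/
def cross (i : P.I) (x : ℕ) (j : P.I) (y : ℕ) :
    Dia P D (strand i x * strand j y) (strand j y * strand i x) :=
  if hx : 0 < x then
    if hy : 0 < y then WExpr.gen (G := webSig P D) (.cross i j ⟨x, hx⟩ ⟨y, hy⟩)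
    else WExpr.eqE (by obtain rfl : y = 0 := by omega
                       exact (mul_one _).trans (one_mul _).symm)
  else WExpr.eqE (by obtain rfl : x = 0 := by omega
                     exact (one_mul _).trans (mul_one _).symm)

/-- coupon `f : i^(z) → j^(z)` -/
def coupon (z : ℕ) (j i : P.I) (p : ZMod 2) (f : A) (hf : IsCoupon P z j i p f) :
    Dia P D (strand i z) (strand j z) :=
  if hz : 0 < z then WExpr.gen (G := webSig P D) (.coupon ⟨z, hz⟩ j i p f hf)
  else WExpr.eqE (by obtain rfl : z = 0 := by omega
                     rfl)

/-- affine dot on `i^(z)` -/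
def dot (i : P.I) (z : ℕ) (hD : D z) : Dia P D (strand i z) (strand i z) :=
  if hz : 0 < z then WExpr.gen (G := webSig P D) (.dot i ⟨z, hz⟩ hD)
  else WExpr.id _

/-- the identity of `i^(x)` -/
def str (i : P.I) (x : ℕ) : Dia P D (strand i x) (strand i x) := WExpr.id _

/-- split `i^(n) → i^(x) i^(y)`, where `n = x + y` -/
def splitN (i : P.I) (x y n : ℕ) (h : x + y = n) :
    Dia P D (strand i n) (strand i x * strand i y) :=
  WExpr.eqE (by rw [h]) ≫ₑ split i x y

/-- merge `i^(x) i^(y) → i^(n)`, where `n = x + y` -/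
def mergeN (i : P.I) (x y n : ℕ) (h : x + y = n) :
    Dia P D (strand i x * strand i y) (strand i n) :=
  merge i x y ≫ₑ WExpr.eqE (by rw [h])

/-- Split `i^(x)` into `x` thin strands, put `f` on each of them, and merge. -/
def blow {i j : P.I} (f : Dia P D (strand i 1) (strand j 1)) :
    (x : ℕ) → Dia P D (strand i x) (strand j x)
  | 0 => WExpr.id 1
  | x + 1 => split i x 1 ≫ₑ (blow f x ⊗ₑ f) ≫ₑ merge j x 1

/-- Split `i^(x)` into strands of thicknesses `c r`, with `r` running through the list `l` from
left to right, put `f r` on the corresponding strand, and merge. -/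
def knot {i j : P.I} {n : ℕ} (c : Fin n → ℕ)
    (f : ∀ r, Dia P D (strand i (c r)) (strand j (c r))) :
    (l : List (Fin n)) → Dia P D (strand i (l.map c).sum) (strand j (l.map c).sum)
  | [] => WExpr.id 1
  | r :: l => split i (c r) (l.map c).sum ≫ₑ (f r ⊗ₑ knot c f l) ≫ₑ
      merge j (c r) (l.map c).sum

/-- `knot`, as a diagram from `i^(t)` to `j^(t)` (only used if the thicknesses add up to `t`). -/
def knotTo {i j : P.I} {n : ℕ} (c : Fin n → ℕ)
    (f : ∀ r, Dia P D (strand i (c r)) (strand j (c r))) (l : List (Fin n)) (t : ℕ) :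
    Dia P D (strand i t) (strand j t) :=
  if h : (l.map c).sum = t then
    WExpr.eqE (by rw [h]) ≫ₑ knot c f l ≫ₑ WExpr.eqE (by rw [h])
  else WExpr.zero

open Classical in
/-- The shorthand coupon `[f]` on a strand of thickness `z`: the coupon `f` if `f ∈ 𝔞`, and thin
coupons `f` on all strands of the explosion of the strand otherwise. -/
noncomputable def bracket (j i : P.I) (p : ZMod 2) (f : A) (hc : f ∈ P.corner j i)
    (hp : f ∈ P.parity p) (z : ℕ) : Dia P D (strand i z) (strand j z) :=
  if h : f ∈ P.𝔞 then coupon z j i 0 f ⟨hc, P.𝔞_even f h, fun _ => ⟨rfl, h⟩⟩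
  else blow (coupon 1 j i p f ⟨hc, hp, fun h => absurd h (by omega)⟩) z

/-! Teleporters. -/

/-- The restricted compositions of `t` on the basis of `jAi`: multiplicity functions of sum `t`
which are at most one on odd basis vectors. -/
def restrictedComps (B : P.GoodBasis) (j i : P.I) (t : ℕ) : List (Fin (B.card j i) → ℕ) :=
  (List.Nat.antidiagonalTuple (B.card j i) t).filter
    fun μ => decide (∀ r, B.par j i r = 1 → μ r ≤ 1)

/-- The diagram `μ : i^(t) → j^(t)`. -/
noncomputable def muDia (B : P.GoodBasis) (j i : P.I) (t : ℕ) (μ : Fin (B.card j i) → ℕ) :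
    Dia P D (strand i t) (strand j t) :=
  knotTo μ (fun r => bracket j i (B.par j i r) (B.vec j i r) (vec_mem_corner B j i r)
    (B.vec_mem_parity j i r) (μ r)) (List.finRange _) t

/-- The diagram `μ^∨ : j^(t) → i^(t)`, with the strands in the reverse order. -/
noncomputable def muDualDia (B : P.GoodBasis) (j i : P.I) (t : ℕ) (μ : Fin (B.card j i) → ℕ) :
    Dia P D (strand j t) (strand i t) :=
  knotTo μ (fun r => bracket i j (B.par j i r) (dualVec B j i r) (dualVec_spec B j i r).1
    (dualVec_spec B j i r).2.1 (μ r)) (List.finRange _).reverse t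

open Classical in
/-- The coefficient `{μ}!_𝔞 {μ^∨}!_𝔞 / {μ}!`. -/
noncomputable def muCoeff (B : P.GoodBasis) (j i : P.I) (μ : Fin (B.card j i) → ℕ) : k :=
  ((∏ r, if B.vec j i r ∈ P.𝔞 then ((μ r).factorial : k) else 1) *
    (∏ r, if dualVec B j i r ∈ P.𝔞 then ((μ r).factorial : k) else 1)) /
      (∏ r, ((μ r).factorial : k))

/-- The `t`-thick teleporter `i^(t) Z j^(t) → j^(t) Z i^(t)` across the identity of `Z`. -/
noncomputable def teleporter (B : P.GoodBasis) (i j : P.I) (t : ℕ) (Z : Comps P) :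
    Dia P D (strand i t * (Z * strand j t)) (strand j t * (Z * strand i t)) :=
  WExpr.sum ((restrictedComps B j i t).map fun μ =>
    (muDia B j i t μ ⊗ₑ WExpr.id Z ⊗ₑ muDualDia B j i t μ).smul (muCoeff B j i μ))

/-! Right hand sides of relations. -/

theorem assoc4 (a b c d : Comps P) : (a * b) * (c * d) = a * ((b * c) * d) := by
  simp only [mul_assoc]

/-- A summand of the merge-split relation; it is zero if a thickness is negative. -/
def msTerm (i : P.I) (x y z w t : ℕ) :
    Dia P D (strand i x * strand i y) (strand i z * strand i w) :=
  if h : t ≤ x ∧ t ≤ w ∧ x ≤ z + t ∧ x + y = z + w then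
    (splitN i (x - t) t x (by omega) ⊗ₑ splitN i (z + t - x) (w - t) y (by omega)) ≫ₑ
    WExpr.eqE (assoc4 _ _ _ _) ≫ₑ
    (str i (x - t) ⊗ₑ cross i t i (z + t - x) ⊗ₑ str i (w - t)) ≫ₑ
    WExpr.eqE (assoc4 _ _ _ _).symm ≫ₑ
    (mergeN i (x - t) (z + t - x) z (by omega) ⊗ₑ mergeN i t (w - t) w (by omega))
  else WExpr.zero

/-- A summand of the dot-crossing relation (without its sign): `i^(t)` and `j^(t)` are
teleported, `i^(x-t)` and `j^(y-t)` are crossed, and there is an affine dot on `i^(x-t)` after the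
crossing.  It is zero if a thickness is negative. -/
noncomputable def dotCrossTerm (B : P.GoodBasis) (hD : ∀ z, D z) (i : P.I) (x : ℕ) (j : P.I)
    (y t : ℕ) : Dia P D (strand i x * strand j y) (strand j y * strand i x) :=
  if h : t ≤ x ∧ t ≤ y then
    (splitN i t (x - t) x (by omega) ⊗ₑ splitN j (y - t) t y (by omega)) ≫ₑ
    WExpr.eqE (assoc4 _ _ _ _) ≫ₑ
    teleporter B i j t (strand i (x - t) * strand j (y - t)) ≫ₑ
    (str j t ⊗ₑ
      (cross i (x - t) j (y - t) ≫ₑ (str j (y - t) ⊗ₑ dot i (x - t) (hD _))) ⊗ₑ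
      str i t) ≫ₑ
    WExpr.eqE (assoc4 _ _ _ _).symm ≫ₑ
    (mergeN j t (y - t) y (by omega) ⊗ₑ mergeN i (x - t) t x (by omega))
  else WExpr.zero

/-- The associativity isomorphisms (identities) between objects. -/
def asc (X Y Z : Comps P) : Dia P D ((X * Y) * Z) (X * (Y * Z)) := WExpr.eqE (mul_assoc X Y Z)

def asc' (X Y Z : Comps P) : Dia P D (X * (Y * Z)) ((X * Y) * Z) :=
  WExpr.eqE (mul_assoc X Y Z).symm

end Diagrams

/-! # Relations -/

/-- The relations between splits, merges, crossings and coupons. -/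
inductive FinRel (P : FrobeniusGreatPair k A) (D : ℕ → Prop) :
    {X Y : Comps P} → Dia P D X Y → Dia P D X Y → Prop
  -- web-associativity
  | split_assoc (i : P.I) (x y z : ℕ) : FinRel P D
      (split i (x + y) z ≫ₑ (split i x y ⊗ₑ str i z))
      (WExpr.eqE (by rw [Nat.add_assoc]) ≫ₑ split i x (y + z) ≫ₑ (str i x ⊗ₑ split i y z) ≫ₑ
        asc' _ _ _)
  | merge_assoc (i : P.I) (x y z : ℕ) : FinRel P D
      ((merge i x y ⊗ₑ str i z) ≫ₑ merge i (x + y) z)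
      (asc _ _ _ ≫ₑ (str i x ⊗ₑ merge i y z) ≫ₑ merge i x (y + z) ≫ₑ
        WExpr.eqE (by rw [Nat.add_assoc]))
  -- merge-split relation
  | merge_split (i : P.I) (x y z w : ℕ) (h : x + y = z + w) : FinRel P D
      (merge i x y ≫ₑ splitN i z w (x + y) h.symm)
      (WExpr.sum ((List.range (x + 1)).map fun t => msTerm i x y z w t))
  -- knothole relation
  | knothole (i : P.I) (x y : ℕ) : FinRel P D
      (split i x y ≫ₑ merge i x y) ((str i (x + y)).smul ((x + y).choose x : k))
  -- Coxeter relations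
  | cross_cross (i j : P.I) (x y : ℕ) (hij : i ≠ j) : FinRel P D
      (cross i x j y ≫ₑ cross j y i x) (str i x ⊗ₑ str j y)
  | braid (i j l : P.I) (x y z : ℕ) (hij : i ≠ j) (hil : i ≠ l) (hjl : j ≠ l) : FinRel P D
      ((cross i x j y ⊗ₑ str l z) ≫ₑ asc _ _ _ ≫ₑ (str j y ⊗ₑ cross i x l z) ≫ₑ asc' _ _ _ ≫ₑ
        (cross j y l z ⊗ₑ str i x) ≫ₑ asc _ _ _)
      (asc _ _ _ ≫ₑ (str i x ⊗ₑ cross j y l z) ≫ₑ asc' _ _ _ ≫ₑ (cross i x l z ⊗ₑ str j y) ≫ₑ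
        asc _ _ _ ≫ₑ (str l z ⊗ₑ cross i x j y))
  -- split-intertwining relations
  | split_cross_right (i j : P.I) (x y z : ℕ) (hij : i ≠ j) : FinRel P D
      ((split i x y ⊗ₑ str j z) ≫ₑ asc _ _ _ ≫ₑ (str i x ⊗ₑ cross i y j z) ≫ₑ asc' _ _ _ ≫ₑ
        (cross i x j z ⊗ₑ str i y) ≫ₑ asc _ _ _)
      (cross i (x + y) j z ≫ₑ (str j z ⊗ₑ split i x y))
  | split_cross_left (i j : P.I) (x y z : ℕ) (hij : i ≠ j) : FinRel P D
      ((str j z ⊗ₑ split i x y) ≫ₑ asc' _ _ _ ≫ₑ (cross j z i x ⊗ₑ str i y) ≫ₑ asc _ _ _ ≫ₑ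
        (str i x ⊗ₑ cross j z i y) ≫ₑ asc' _ _ _)
      (cross j z i (x + y) ≫ₑ (split i x y ⊗ₑ str j z))
  -- merge-intertwining relations
  | merge_cross_left (i j : P.I) (x y z : ℕ) (hij : i ≠ j) : FinRel P D
      (asc' _ _ _ ≫ₑ (cross j z i x ⊗ₑ str i y) ≫ₑ asc _ _ _ ≫ₑ (str i x ⊗ₑ cross j z i y) ≫ₑ
        asc' _ _ _ ≫ₑ (merge i x y ⊗ₑ str j z))
      ((str j z ⊗ₑ merge i x y) ≫ₑ cross j z i (x + y))
  | merge_cross_right (i j : P.I) (x y z : ℕ) (hij : i ≠ j) : FinRel P D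
      (asc _ _ _ ≫ₑ (str i x ⊗ₑ cross i y j z) ≫ₑ asc' _ _ _ ≫ₑ (cross i x j z ⊗ₑ str i y) ≫ₑ
        asc _ _ _ ≫ₑ (str j z ⊗ₑ merge i x y))
      ((merge i x y ⊗ₑ str j z) ≫ₑ cross i (x + y) j z)
  -- coupon relations
  | coupon_id (i : P.I) (x : ℕ) : FinRel P D
      (coupon x i i 0 (i : A) (IsCoupon.idem x i)) (str i x)
  | coupon_smul (i j : P.I) (x : ℕ) (p : ZMod 2) (c : k) (f : A) (hf : IsCoupon P x j i p f) :
      FinRel P D (coupon x j i p (c • f) (hf.smul c)) ((coupon x j i p f hf).smul (c ^ x))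
  | coupon_comp (i j l : P.I) (x : ℕ) (p q : ZMod 2) (f h : A) (hf : IsCoupon P x j i p f)
      (hh : IsCoupon P x l j q h) :
      FinRel P D (coupon x j i p f hf ≫ₑ coupon x l j q h hh)
        (coupon x l i (p + q) (h * f) (hf.mul hh))
  | coupon_add (i j : P.I) (x : ℕ) (p : ZMod 2) (f g : A) (hf : IsCoupon P x j i p f)
      (hg : IsCoupon P x j i p g) :
      FinRel P D (coupon x j i p (f + g) (hf.add hg))
        (WExpr.sum ((List.finRange (x + 1)).map fun t : Fin (x + 1) =>
          splitN i t (x - t) x (by have := t.isLt; omega) ≫ₑ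
          (coupon t j i p f (hf.mono (by have := t.isLt; omega)) ⊗ₑ
            coupon (x - t) j i p g (hg.mono (by have := t.isLt; omega))) ≫ₑ
          mergeN j t (x - t) x (by have := t.isLt; omega)))
  -- odd knothole annihilation
  | odd_knothole (i j : P.I) (f : A) (hf : IsCoupon P 1 j i 1 f) : FinRel P D
      (split i 1 1 ≫ₑ (coupon 1 j i 1 f hf ⊗ₑ coupon 1 j i 1 f hf) ≫ₑ merge j 1 1) WExpr.zero
  -- coupons and splits or merges
  | coupon_split (i j : P.I) (x y : ℕ) (p : ZMod 2) (f : A) (hf : IsCoupon P (x + y) j i p f) :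
      FinRel P D (coupon (x + y) j i p f hf ≫ₑ split j x y)
        (split i x y ≫ₑ (coupon x j i p f (hf.mono (by omega)) ⊗ₑ
          coupon y j i p f (hf.mono (by omega))))
  | merge_coupon (i j : P.I) (x y : ℕ) (p : ZMod 2) (f : A) (hf : IsCoupon P (x + y) j i p f) :
      FinRel P D (merge i x y ≫ₑ coupon (x + y) j i p f hf)
        ((coupon x j i p f (hf.mono (by omega)) ⊗ₑ
          coupon y j i p f (hf.mono (by omega))) ≫ₑ merge j x y)
  -- coupons and crossings
  | coupon_cross_left (i j l : P.I) (x y : ℕ) (p : ZMod 2) (f : A) (hf : IsCoupon P x j i p f) :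
      FinRel P D ((coupon x j i p f hf ⊗ₑ str l y) ≫ₑ cross j x l y)
        (cross i x l y ≫ₑ (str l y ⊗ₑ coupon x j i p f hf))
  | coupon_cross_right (i j l : P.I) (x y : ℕ) (p : ZMod 2) (f : A) (hf : IsCoupon P x j i p f) :
      FinRel P D ((str l y ⊗ₑ coupon x j i p f hf) ≫ₑ cross l y j x)
        (cross l y i x ≫ₑ (coupon x j i p f hf ⊗ₑ str l y))

/-- Affine dots are allowed on strands of any thickness. -/
def allDots : ℕ → Prop := fun _ => True

/-- Affine dots are only allowed on strands of thickness one. -/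
def thinDots : ℕ → Prop := fun z => z = 1

/-- The affine dot on `i^(z)`, for arbitrary `z`. -/
def affDot {P : FrobeniusGreatPair k A} (i : P.I) (z : ℕ) :
    Dia P allDots (strand i z) (strand i z) := dot i z trivial

/-- The thin affine dot on `i^(1)`. -/
def thinDot {P : FrobeniusGreatPair k A} (i : P.I) :
    Dia P thinDots (strand i 1) (strand i 1) := dot i 1 rfl

/-- The relations of the affine web category. -/
inductive AffRel (P : FrobeniusGreatPair k A) (B : P.GoodBasis) :
    {X Y : Comps P} → Dia P allDots X Y → Dia P allDots X Y → Prop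
  | fin {X Y : Comps P} {e e' : Dia P allDots X Y} : FinRel P allDots e e' → AffRel P B e e'
  | coupon_dot (i j : P.I) (x : ℕ) (p : ZMod 2) (f : A) (hf : IsCoupon P x j i p f) : AffRel P B
      (coupon x j i p f hf ≫ₑ affDot j x)
      (affDot i x ≫ₑ coupon x j i p (P.ψ.symm f) hf.ψ_symm)
  | dot_split (i : P.I) (x y : ℕ) : AffRel P B
      (affDot i (x + y) ≫ₑ split i x y) (split i x y ≫ₑ (affDot i x ⊗ₑ affDot i y))
  | merge_dot (i : P.I) (x y : ℕ) : AffRel P B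
      (merge i x y ≫ₑ affDot i (x + y)) ((affDot i x ⊗ₑ affDot i y) ≫ₑ merge i x y)
  | dot_cross (i j : P.I) (x y : ℕ) : AffRel P B
      ((affDot i x ⊗ₑ str j y) ≫ₑ cross i x j y)
      (WExpr.sum ((List.range (x + 1)).map fun t =>
        (dotCrossTerm B (fun _ => trivial) i x j y t).smul ((-1) ^ t)))

/-- The relations of the thin dot web category. -/
inductive ThinRel (P : FrobeniusGreatPair k A) (B : P.GoodBasis) :
    {X Y : Comps P} → Dia P thinDots X Y → Dia P thinDots X Y → Prop
  | fin {X Y : Comps P} {e e' : Dia P thinDots X Y} : FinRel P thinDots e e' → ThinRel P B e e'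
  | coupon_dot (i j : P.I) (p : ZMod 2) (f : A) (hf : IsCoupon P 1 j i p f) : ThinRel P B
      (coupon 1 j i p f hf ≫ₑ thinDot j)
      (thinDot i ≫ₑ coupon 1 j i p (P.ψ.symm f) hf.ψ_symm)
  | dot_cross (i j : P.I) : ThinRel P B
      ((thinDot i ⊗ₑ str j 1) ≫ₑ cross i 1 j 1)
      ((cross i 1 j 1 ≫ₑ (str j 1 ⊗ₑ thinDot i)).add
        ((WExpr.eqE (by rw [one_mul]) ≫ₑ teleporter B i j 1 1 ≫ₑ
          WExpr.eqE (by rw [one_mul])).smul (-1)))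

/-! # Homogeneity of the relations -/

section Homogeneity

variable {P : FrobeniusGreatPair k A} {D : ℕ → Prop} {X Y Z X' Y' : Comps P} {p : ZMod 2}

theorem hasParity_eqE (h : X = Y) : (WExpr.eqE h : Dia P D X Y).HasParity 0 := by
  subst h
  exact .id _

theorem hasParity_dite {c : Prop} [Decidable c] {a : c → Dia P D X Y} {b : ¬ c → Dia P D X Y}
    (ha : ∀ h, (a h).HasParity p) (hb : ∀ h, (b h).HasParity p) : (dite c a b).HasParity p := by
  split_ifs with h
  · exact ha h
  · exact hb h

theorem comp_hasParity {f : Dia P D X Y} {g : Dia P D Y Z} (hf : f.HasParity p)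
    (hg : g.HasParity 0) : (f ≫ₑ g).HasParity p := by
  simpa using hf.comp hg

theorem hasParity_comp {f : Dia P D X Y} {g : Dia P D Y Z} (hf : f.HasParity 0)
    (hg : g.HasParity p) : (f ≫ₑ g).HasParity p := by
  simpa using hf.comp hg

theorem tensor_hasParity {f : Dia P D X Y} {g : Dia P D X' Y'} (hf : f.HasParity p)
    (hg : g.HasParity 0) : (f ⊗ₑ g).HasParity p := by
  simpa using hf.tensor hg

theorem hasParity_tensor {f : Dia P D X Y} {g : Dia P D X' Y'} (hf : f.HasParity 0)
    (hg : g.HasParity p) : (f ⊗ₑ g).HasParity p := by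
  simpa using hf.tensor hg

theorem hasParity_str (i : P.I) (x : ℕ) : (str i x : Dia P D _ _).HasParity 0 := .id _

theorem hasParity_asc (X Y Z : Comps P) : (asc X Y Z : Dia P D _ _).HasParity 0 :=
  hasParity_eqE _

theorem hasParity_asc' (X Y Z : Comps P) : (asc' X Y Z : Dia P D _ _).HasParity 0 :=
  hasParity_eqE _

theorem hasParity_split (i : P.I) (x y : ℕ) : (split i x y : Dia P D _ _).HasParity 0 := by
  unfold split
  exact hasParity_dite (fun hx => hasParity_dite
    (fun hy => .gen (G := webSig P D) (.split i ⟨x, hx⟩ ⟨y, hy⟩)) fun _ => hasParity_eqE _)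
    fun _ => hasParity_eqE _

theorem hasParity_merge (i : P.I) (x y : ℕ) : (merge i x y : Dia P D _ _).HasParity 0 := by
  unfold merge
  exact hasParity_dite (fun hx => hasParity_dite
    (fun hy => .gen (G := webSig P D) (.merge i ⟨x, hx⟩ ⟨y, hy⟩)) fun _ => hasParity_eqE _)
    fun _ => hasParity_eqE _

theorem hasParity_cross (i j : P.I) (x y : ℕ) : (cross i x j y : Dia P D _ _).HasParity 0 := by
  unfold cross
  exact hasParity_dite (fun hx => hasParity_dite
    (fun hy => .gen (G := webSig P D) (.cross i j ⟨x, hx⟩ ⟨y, hy⟩)) fun _ => hasParity_eqE _)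
    fun _ => hasParity_eqE _

theorem hasParity_dot (i : P.I) (z : ℕ) (hD : D z) : (dot i z hD : Dia P D _ _).HasParity 0 := by
  unfold dot
  exact hasParity_dite (fun hz => .gen (G := webSig P D) (.dot i ⟨z, hz⟩ hD)) fun _ => .id _

theorem hasParity_splitN (i : P.I) (x y n : ℕ) (h : x + y = n) :
    (splitN i x y n h : Dia P D _ _).HasParity 0 :=
  comp_hasParity (hasParity_eqE _) (hasParity_split _ _ _)

theorem hasParity_mergeN (i : P.I) (x y n : ℕ) (h : x + y = n) :
    (mergeN i x y n h : Dia P D _ _).HasParity 0 :=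
  comp_hasParity (hasParity_merge _ _ _) (hasParity_eqE _)

theorem hasParity_coupon_zero (i j : P.I) (q : ZMod 2) (f : A) (hf : IsCoupon P 0 j i q f) :
    (coupon 0 j i q f hf : Dia P D _ _).HasParity 0 := by
  unfold coupon
  exact hasParity_dite (fun hz => absurd hz (lt_irrefl 0)) fun _ => hasParity_eqE _

theorem hasParity_coupon_pos {i j : P.I} {z : ℕ} (hz : 0 < z) (q : ZMod 2) (f : A)
    (hf : IsCoupon P z j i q f) : (coupon z j i q f hf : Dia P D _ _).HasParity q := by
  unfold coupon
  exact hasParity_dite (fun hz => .gen (G := webSig P D) (.coupon ⟨z, hz⟩ j i q f hf))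
    fun h => absurd hz h

/-- the parity of a coupon -/
theorem hasParity_coupon {i j : P.I} {z : ℕ} (q : ZMod 2) (f : A) (hf : IsCoupon P z j i q f) :
    (coupon z j i q f hf : Dia P D _ _).HasParity (z • q) := by
  rcases Nat.lt_trichotomy z 1 with h | rfl | h
  · obtain rfl : z = 0 := by omega
    rw [zero_smul]
    exact hasParity_coupon_zero _ _ _ _ _
  · rw [one_smul]
    exact hasParity_coupon_pos Nat.one_pos _ _ _
  · have := hasParity_coupon_pos (D := D) (by omega) q f hf
    obtain rfl := (hf.2.2 h).1
    rwa [smul_zero]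

theorem hasParity_sum {L : List (Dia P D X Y)} (h : ∀ e ∈ L, e.HasParity p) :
    (WExpr.sum L).HasParity p := by
  induction L with
  | nil => exact .zero p
  | cons e L ih =>
    exact .add (h e (by simp)) (ih fun e he => h e (by simp [he]))

theorem hasParity_blow {i j : P.I} {f : Dia P D (strand i 1) (strand j 1)} (hf : f.HasParity p)
    (x : ℕ) : (blow f x).HasParity (x • p) := by
  induction x with
  | zero =>
    rw [zero_smul]
    exact .id _
  | succ x ih =>
    rw [add_smul, one_smul]
    exact hasParity_comp (hasParity_split _ _ _)
      (comp_hasParity (ih.tensor hf) (hasParity_merge _ _ _))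

theorem hasParity_bracket {i j : P.I} {f : A} (hf : f ≠ 0) (hc : f ∈ P.corner j i)
    (hp : f ∈ P.parity p) (z : ℕ) :
    (bracket j i p f hc hp z : Dia P D _ _).HasParity (z • p) := by
  unfold bracket
  split_ifs with h
  · have h0 : p = 0 := by
      rcases SuperPresentation.zmod_two_cases p with rfl | rfl
      · rfl
      · exact absurd (Submodule.disjoint_def.mp P.isCompl_parity.disjoint _ (P.𝔞_even f h) hp) hf
    rw [h0]
    exact hasParity_coupon _ _ _
  · exact hasParity_blow (hasParity_coupon_pos Nat.one_pos _ _ _) z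

theorem vec_ne_zero (B : P.GoodBasis) (j i : P.I) (r : Fin (B.card j i)) : B.vec j i r ≠ 0 :=
  (B.linearIndependent j i).ne_zero r

theorem dualVec_ne_zero (B : P.GoodBasis) (j i : P.I) (r : Fin (B.card j i)) :
    dualVec B j i r ≠ 0 := by
  intro h
  have := (dualVec_spec B j i r).2.2 r
  rw [h, zero_mul, map_zero, if_pos rfl] at this
  exact zero_ne_one this

theorem hasParity_knotTo {i j : P.I} {n : ℕ} {c : Fin n → ℕ}
    {f : ∀ r, Dia P D (strand i (c r)) (strand j (c r))} {q : Fin n → ZMod 2}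
    (hf : ∀ r, (f r).HasParity (q r)) (l : List (Fin n)) (t : ℕ) :
    (knotTo c f l t).HasParity (l.map q).sum := by
  have hk : (knot c f l).HasParity (l.map q).sum := by
    induction l with
    | nil => exact .id _
    | cons r l ih =>
      have h : (List.map q (r :: l)).sum = q r + (l.map q).sum := by
        rw [List.map_cons, List.sum_cons]
      refine h.symm ▸ ?_
      exact hasParity_comp (hasParity_split _ _ _)
        (comp_hasParity ((hf r).tensor ih) (hasParity_merge _ _ _))
  unfold knotTo
  split_ifs
  · exact hasParity_comp (hasParity_eqE _) (comp_hasParity hk (hasParity_eqE _))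
  · exact .zero _

theorem hasParity_teleporter (B : P.GoodBasis) (i j : P.I) (t : ℕ) (Z : Comps P) :
    (teleporter B i j t Z : Dia P D _ _).HasParity 0 := by
  refine hasParity_sum fun e he => ?_
  obtain ⟨μ, -, rfl⟩ := List.mem_map.mp he
  refine .smul _ ?_
  have h1 : (muDia B j i t μ : Dia P D _ _).HasParity _ :=
    hasParity_knotTo (fun r => hasParity_bracket (vec_ne_zero B j i r) _ _ _) _ _
  have h2 : (muDualDia B j i t μ : Dia P D _ _).HasParity _ :=
    hasParity_knotTo (fun r => hasParity_bracket (dualVec_ne_zero B j i r) _ _ _) _ _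
  rw [List.map_reverse, List.sum_reverse] at h2
  have h3 := h1.tensor (hasParity_tensor (.id Z) h2)
  rwa [CharTwo.add_self_eq_zero] at h3

theorem hasParity_msTerm (i : P.I) (x y z w t : ℕ) :
    (msTerm i x y z w t : Dia P D _ _).HasParity 0 := by
  unfold msTerm
  split_ifs
  · exact comp_hasParity (tensor_hasParity (hasParity_splitN ..) (hasParity_splitN ..))
      (comp_hasParity (hasParity_eqE _) (comp_hasParity
        (tensor_hasParity (hasParity_str ..) (tensor_hasParity (hasParity_cross ..)
          (hasParity_str ..))) (comp_hasParity (hasParity_eqE _)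
            (tensor_hasParity (hasParity_mergeN ..) (hasParity_mergeN ..)))))
  · exact .zero _

theorem hasParity_dotCrossTerm (B : P.GoodBasis) (hD : ∀ z, D z) (i j : P.I) (x y t : ℕ) :
    (dotCrossTerm B hD i x j y t : Dia P D _ _).HasParity 0 := by
  unfold dotCrossTerm
  split_ifs
  · exact comp_hasParity (tensor_hasParity (hasParity_splitN ..) (hasParity_splitN ..))
      (comp_hasParity (hasParity_eqE _) (comp_hasParity (hasParity_teleporter ..)
        (comp_hasParity (tensor_hasParity (hasParity_str ..) (tensor_hasParity
          (comp_hasParity (hasParity_cross ..) (tensor_hasParity (hasParity_str ..)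
            (hasParity_dot ..))) (hasParity_str ..))) (comp_hasParity (hasParity_eqE _)
              (tensor_hasParity (hasParity_mergeN ..) (hasParity_mergeN ..))))))
  · exact .zero _

set_option maxHeartbeats 2000000 in
theorem FinRel.homogeneous {e e' : Dia P D X Y} (h : FinRel P D e e') :
    ∃ p, e.HasParity p ∧ e'.HasParity p := by
  induction h with
  | split_assoc i x y z =>
    exact ⟨0, comp_hasParity (hasParity_split ..) (tensor_hasParity (hasParity_split ..)
      (hasParity_str ..)), comp_hasParity (hasParity_eqE _) (comp_hasParity (hasParity_split ..)
        (comp_hasParity (tensor_hasParity (hasParity_str ..) (hasParity_split ..))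
          (hasParity_asc' ..)))⟩
  | merge_assoc i x y z =>
    exact ⟨0, comp_hasParity (tensor_hasParity (hasParity_merge ..) (hasParity_str ..))
      (hasParity_merge ..), comp_hasParity (hasParity_asc ..) (comp_hasParity
        (tensor_hasParity (hasParity_str ..) (hasParity_merge ..))
          (comp_hasParity (hasParity_merge ..) (hasParity_eqE _)))⟩
  | merge_split i x y z w h =>
    refine ⟨0, comp_hasParity (hasParity_merge ..) (hasParity_splitN ..),
      hasParity_sum fun e he => ?_⟩
    obtain ⟨t, -, rfl⟩ := List.mem_map.mp he
    exact hasParity_msTerm ..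
  | knothole i x y =>
    exact ⟨0, comp_hasParity (hasParity_split ..) (hasParity_merge ..),
      .smul _ (hasParity_str ..)⟩
  | cross_cross i j x y =>
    exact ⟨0, comp_hasParity (hasParity_cross ..) (hasParity_cross ..),
      tensor_hasParity (hasParity_str ..) (hasParity_str ..)⟩
  | braid i j l x y z =>
    exact ⟨0, comp_hasParity (tensor_hasParity (hasParity_cross ..) (hasParity_str ..))
      (comp_hasParity (hasParity_asc ..) (comp_hasParity (tensor_hasParity (hasParity_str ..)
      (hasParity_cross ..)) (comp_hasParity (hasParity_asc' ..) (comp_hasParity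
      (tensor_hasParity (hasParity_cross ..) (hasParity_str ..)) (hasParity_asc ..))))),
      comp_hasParity (hasParity_asc ..) (comp_hasParity (tensor_hasParity (hasParity_str ..)
      (hasParity_cross ..)) (comp_hasParity (hasParity_asc' ..) (comp_hasParity
      (tensor_hasParity (hasParity_cross ..) (hasParity_str ..)) (comp_hasParity
      (hasParity_asc ..) (tensor_hasParity (hasParity_str ..) (hasParity_cross ..))))))⟩
  | split_cross_right i j x y z =>
    exact ⟨0, comp_hasParity (tensor_hasParity (hasParity_split ..) (hasParity_str ..))
      (comp_hasParity (hasParity_asc ..) (comp_hasParity (tensor_hasParity (hasParity_str ..)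
      (hasParity_cross ..)) (comp_hasParity (hasParity_asc' ..) (comp_hasParity
      (tensor_hasParity (hasParity_cross ..) (hasParity_str ..)) (hasParity_asc ..))))),
      comp_hasParity (hasParity_cross ..) (tensor_hasParity (hasParity_str ..)
      (hasParity_split ..))⟩
  | split_cross_left i j x y z =>
    exact ⟨0, comp_hasParity (tensor_hasParity (hasParity_str ..) (hasParity_split ..))
      (comp_hasParity (hasParity_asc' ..) (comp_hasParity (tensor_hasParity (hasParity_cross
      ..) (hasParity_str ..)) (comp_hasParity (hasParity_asc ..) (comp_hasParity
      (tensor_hasParity (hasParity_str ..) (hasParity_cross ..)) (hasParity_asc' ..))))),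
      comp_hasParity (hasParity_cross ..) (tensor_hasParity (hasParity_split ..)
      (hasParity_str ..))⟩
  | merge_cross_left i j x y z =>
    exact ⟨0, comp_hasParity (hasParity_asc' ..) (comp_hasParity (tensor_hasParity
      (hasParity_cross ..) (hasParity_str ..)) (comp_hasParity (hasParity_asc ..)
      (comp_hasParity (tensor_hasParity (hasParity_str ..) (hasParity_cross ..))
      (comp_hasParity (hasParity_asc' ..) (tensor_hasParity (hasParity_merge ..)
      (hasParity_str ..)))))), comp_hasParity (tensor_hasParity (hasParity_str ..)
      (hasParity_merge ..)) (hasParity_cross ..)⟩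
  | merge_cross_right i j x y z =>
    exact ⟨0, comp_hasParity (hasParity_asc ..) (comp_hasParity (tensor_hasParity
      (hasParity_str ..) (hasParity_cross ..)) (comp_hasParity (hasParity_asc' ..)
      (comp_hasParity (tensor_hasParity (hasParity_cross ..) (hasParity_str ..))
      (comp_hasParity (hasParity_asc ..) (tensor_hasParity (hasParity_str ..) (hasParity_merge
      ..)))))), comp_hasParity (tensor_hasParity (hasParity_merge ..) (hasParity_str ..))
      (hasParity_cross ..)⟩
  | coupon_id i x => exact ⟨x • 0, hasParity_coupon _ _ _, by
    rw [smul_zero]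
    exact hasParity_str ..⟩
  | coupon_smul i j x p c f hf =>
    exact ⟨x • p, hasParity_coupon _ _ _, .smul _ (hasParity_coupon _ _ _)⟩
  | coupon_comp i j l x p q f h hf hh =>
    refine ⟨x • p + x • q, (hasParity_coupon _ _ _).comp (hasParity_coupon _ _ _), ?_⟩
    rw [← smul_add]
    exact hasParity_coupon _ _ _
  | coupon_add i j x p f g hf hg =>
    refine ⟨x • p, hasParity_coupon _ _ _, hasParity_sum fun e he => ?_⟩
    obtain ⟨t, -, rfl⟩ := List.mem_map.mp he
    refine hasParity_comp (hasParity_splitN ..) (comp_hasParity ?_ (hasParity_mergeN ..))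
    have h := (hasParity_coupon (D := D) p f (hf.mono (z' := t) (by have := t.isLt; omega))).tensor
      (hasParity_coupon (D := D) p g (hg.mono (z' := x - t) (by omega)))
    rwa [← add_smul, show (t : ℕ) + (x - t) = x by have := t.isLt; omega] at h
  | odd_knothole i j f hf =>
    have h := hasParity_coupon_pos (D := D) Nat.one_pos 1 f hf
    exact ⟨1 + 1, hasParity_comp (hasParity_split ..)
      (comp_hasParity (h.tensor h) (hasParity_merge ..)), .zero _⟩
  | coupon_split i j x y p f hf =>
    refine ⟨(x + y) • p, comp_hasParity (hasParity_coupon _ _ _) (hasParity_split ..), ?_⟩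
    rw [add_smul]
    exact hasParity_comp (hasParity_split ..)
      ((hasParity_coupon _ _ _).tensor (hasParity_coupon _ _ _))
  | merge_coupon i j x y p f hf =>
    refine ⟨(x + y) • p, hasParity_comp (hasParity_merge ..) (hasParity_coupon _ _ _), ?_⟩
    rw [add_smul]
    exact comp_hasParity ((hasParity_coupon _ _ _).tensor (hasParity_coupon _ _ _))
      (hasParity_merge ..)
  | coupon_cross_left i j l x y p f hf =>
    exact ⟨x • p, comp_hasParity (tensor_hasParity (hasParity_coupon _ _ _) (hasParity_str ..))
      (hasParity_cross ..), hasParity_comp (hasParity_cross ..)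
        (hasParity_tensor (hasParity_str ..) (hasParity_coupon _ _ _))⟩
  | coupon_cross_right i j l x y p f hf =>
    exact ⟨x • p, comp_hasParity (hasParity_tensor (hasParity_str ..) (hasParity_coupon _ _ _))
      (hasParity_cross ..), hasParity_comp (hasParity_cross ..)
        (tensor_hasParity (hasParity_coupon _ _ _) (hasParity_str ..))⟩

theorem AffRel.homogeneous {B : P.GoodBasis} {e e' : Dia P allDots X Y} (h : AffRel P B e e') :
    ∃ p, e.HasParity p ∧ e'.HasParity p := by
  have hdot : ∀ (i : P.I) (z : ℕ), (affDot i z).HasParity 0 := fun i z => hasParity_dot _ _ _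
  induction h with
  | fin h => exact h.homogeneous
  | coupon_dot i j x p f hf =>
    exact ⟨x • p, comp_hasParity (hasParity_coupon _ _ _) (hdot _ _),
      hasParity_comp (hdot _ _) (hasParity_coupon _ _ _)⟩
  | dot_split i x y =>
    exact ⟨0, comp_hasParity (hdot _ _) (hasParity_split ..),
      comp_hasParity (hasParity_split ..) (tensor_hasParity (hdot _ _) (hdot _ _))⟩
  | merge_dot i x y =>
    exact ⟨0, comp_hasParity (hasParity_merge ..) (hdot _ _),
      comp_hasParity (tensor_hasParity (hdot _ _) (hdot _ _)) (hasParity_merge ..)⟩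
  | dot_cross i j x y =>
    refine ⟨0, comp_hasParity (tensor_hasParity (hdot _ _) (hasParity_str ..))
      (hasParity_cross ..), hasParity_sum fun e he => ?_⟩
    obtain ⟨t, -, rfl⟩ := List.mem_map.mp he
    exact .smul _ (hasParity_dotCrossTerm ..)

theorem ThinRel.homogeneous {B : P.GoodBasis} {e e' : Dia P thinDots X Y}
    (h : ThinRel P B e e') : ∃ p, e.HasParity p ∧ e'.HasParity p := by
  have hdot : ∀ (i : P.I), (thinDot i).HasParity 0 := fun i => hasParity_dot _ _ _
  induction h with
  | fin h => exact h.homogeneous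
  | coupon_dot i j p f hf =>
    exact ⟨1 • p, comp_hasParity (hasParity_coupon _ _ _) (hdot _),
      hasParity_comp (hdot _) (hasParity_coupon _ _ _)⟩
  | dot_cross i j =>
    exact ⟨0, comp_hasParity (tensor_hasParity (hdot _) (hasParity_str ..))
      (hasParity_cross ..), .add (comp_hasParity (hasParity_cross ..)
        (tensor_hasParity (hasParity_str ..) (hdot _)))
          (.smul _ (comp_hasParity (hasParity_eqE _)
            (comp_hasParity (hasParity_teleporter ..) (hasParity_eqE _))))⟩

end Homogeneity

/-! # The affine web category and the thin dot web category -/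

/-- The presentation of the affine web category. -/
def affPresentation (P : FrobeniusGreatPair k A) (B : P.GoodBasis) :
    SuperPresentation k (webSig P allDots) where
  rel := AffRel P B
  rel_homogeneous h := h.homogeneous

/-- The presentation of the thin dot web category. -/
def thinPresentation (P : FrobeniusGreatPair k A) (B : P.GoodBasis) :
    SuperPresentation k (webSig P thinDots) where
  rel := ThinRel P B
  rel_homogeneous h := h.homogeneous

/-- The affine web category. -/
abbrev WebAff (P : FrobeniusGreatPair k A) (B : P.GoodBasis) : Type v :=
  (affPresentation P B).Obj

/-- The thin dot affine web category. -/
abbrev WebThin (P : FrobeniusGreatPair k A) (B : P.GoodBasis) : Type v :=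
  (thinPresentation P B).Obj

/-- The morphism of the affine web category represented by a diagram. -/
def affMk {P : FrobeniusGreatPair k A} (B : P.GoodBasis) {X Y : Comps P}
    (e : Dia P allDots X Y) :
    (show WebAff P B from X) ⟶ (show WebAff P B from Y) := (affPresentation P B).homMk e

/-- The morphism of the thin dot web category represented by a diagram. -/
def thinMk {P : FrobeniusGreatPair k A} (B : P.GoodBasis) {X Y : Comps P}
    (e : Dia P thinDots X Y) :
    (show WebThin P B from X) ⟶ (show WebThin P B from Y) := (thinPresentation P B).homMk e

/-- The white dot of thickness `x`: split `i^(x)` into thin strands, put a thin affine dot on each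
of them, merge, and divide by `x!`. -/
def whiteDot {P : FrobeniusGreatPair k A} (i : P.I) (x : ℕ) :
    Dia P thinDots (strand i x) (strand i x) :=
  (blow (thinDot i) x).smul ((x.factorial : k)⁻¹)

/-- `ι` sends each object, and each generating diagram, of the thin dot web category to its mate in
the affine web category. -/
structure IsMateFunctor [CharZero k] {P : FrobeniusGreatPair k A} (B : P.GoodBasis)
    (ι : StrictMonoidalSuperfunctor k (WebThin P B) (WebAff P B)) : Prop where
  obj (X : Comps P) : ι.obj (show WebThin P B from X) = (show WebAff P B from X)
  split (i : P.I) (x y : ℕ) :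
    FunctorSends ι.toFunctor (thinMk B (split i x y)) (affMk B (split i x y))
  merge (i : P.I) (x y : ℕ) :
    FunctorSends ι.toFunctor (thinMk B (merge i x y)) (affMk B (merge i x y))
  cross (i j : P.I) (x y : ℕ) :
    FunctorSends ι.toFunctor (thinMk B (cross i x j y)) (affMk B (cross i x j y))
  coupon (i j : P.I) (x : ℕ) (p : ZMod 2) (f : A) (hf : IsCoupon P x j i p f) :
    FunctorSends ι.toFunctor (thinMk B (coupon x j i p f hf)) (affMk B (coupon x j i p f hf))
  dot (i : P.I) : FunctorSends ι.toFunctor (thinMk B (thinDot i)) (affMk B (affDot i 1))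

/-- `κ` is the identity on objects, splits, merges, crossings and coupons, and sends affine dots
of any thickness to white dots. -/
structure IsWhiteDotFunctor [CharZero k] {P : FrobeniusGreatPair k A} (B : P.GoodBasis)
    (κ : StrictMonoidalSuperfunctor k (WebAff P B) (WebThin P B)) : Prop where
  obj (X : Comps P) : κ.obj (show WebAff P B from X) = (show WebThin P B from X)
  split (i : P.I) (x y : ℕ) :
    FunctorSends κ.toFunctor (affMk B (split i x y)) (thinMk B (split i x y))
  merge (i : P.I) (x y : ℕ) :
    FunctorSends κ.toFunctor (affMk B (merge i x y)) (thinMk B (merge i x y))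
  cross (i j : P.I) (x y : ℕ) :
    FunctorSends κ.toFunctor (affMk B (cross i x j y)) (thinMk B (cross i x j y))
  coupon (i j : P.I) (x : ℕ) (p : ZMod 2) (f : A) (hf : IsCoupon P x j i p f) :
    FunctorSends κ.toFunctor (affMk B (coupon x j i p f hf)) (thinMk B (coupon x j i p f hf))
  dot (i : P.I) (x : ℕ) :
    FunctorSends κ.toFunctor (affMk B (affDot i x)) (thinMk B (whiteDot i x))

end AffineWeb

/-! Both functors are defined by substitution on generators, so the theorem amounts to three facts:
affine dots of thickness one satisfy the thin relations, white dots satisfy all affine relations,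
and the two substitutions undo each other on generators. The first is the case of thickness one of
the affine relations. For the third, an affine dot passes through the splits of an explosion, so
thin dots on all strands of an exploded strand give `x!` times the thick dot (`layE_blow_affDot`).
The work lies in the second.

Characteristic zero enters through `merge_cancel` and `split_cancel`: a split followed by a merge is
a nonzero binomial multiple of the identity, so an identity of diagrams may be tested after a merge
or a split. This permits thin strands to be peeled off and reduces statements about thick strands to
thin ones by induction. Crossings of a single color have no Coxeter or intertwining relations among
the axioms; these are derived from the merge-split relation (`merge_cross_left_one_self`), so that
thereafter all colors can be treated alike.

After all coupons are exploded, a thick teleporter is a sum of pairs of words in a basis and its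
dual, with coefficient the inverse of the product of the factorials of the multiplicities
(`lay_teleporter`). The signs of the two words cancel, so that only multiplicities matter
(`wordPair_perm`). As for divided powers, this gives a recursion in the thickness
(`lay_teleporter_succ`) and a rule for a merge below a teleporter (`merge_teleporter`).

White dots split and merge because the product of two thin dots commutes with the crossing of their
strands (`dot_dot_cross`). Each dot produces a teleporter when it passes the crossing; the two
teleporters cancel since the Casimir element is invariant under the flip up to the inverse Nakayama
automorphism on one factor (`sum_coupon_ψ_symm`).

The dot-crossing relation for white dots is proved first against a thin strand, by induction on the
dotted strand (`whiteDot_cross_thin`), and then by induction on the other strand (`whiteDot_cross`).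
In the second induction both sides become the same alternating sums of two families of diagrams, in
which a thin strand either crosses or joins the strand split off for the teleporter. -/

namespace SuperPresentation

/-! ### Morphisms as operators in a single algebra -/

section DiagramAlgebra

variable {k : Type w} [CommRing k] {M : Type u} [Monoid M] {G : SuperSignature.{u, v} M}

/-- The algebra in which the morphisms of the presented category act by composition. -/
abbrev DiagAlg (R : SuperPresentation k G) : Type (max u v w) :=
  Module.End k (∀ X Y : R.Obj, X ⟶ Y)

open Classical in
/-- The operator of composition with a morphism. -/
noncomputable def opHom (R : SuperPresentation k G) {X Y : R.Obj} (f : X ⟶ Y) : R.DiagAlg where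
  toFun a Z W := if h : Z = X then eqToHom h ≫ f ≫ a Y W else 0
  map_add' a b := by
    funext Z W
    by_cases h : Z = X <;> simp [h]
  map_smul' c a := by
    funext Z W
    by_cases h : Z = X <;> simp [h]

/-- The operator of composition with the morphism represented by an expression. -/
noncomputable def op (R : SuperPresentation k G) {X Y : M} (e : WExpr k G X Y) : R.DiagAlg :=
  R.opHom (R.homMk e)

variable {R : SuperPresentation k G}

theorem opHom_apply_self {X Y : R.Obj} (f : X ⟶ Y) (a : ∀ X Y : R.Obj, X ⟶ Y) (W : R.Obj) :
    R.opHom f a X W = f ≫ a Y W := by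
  simp [opHom]

theorem opHom_apply_ne {X Y : R.Obj} (f : X ⟶ Y) (a : ∀ X Y : R.Obj, X ⟶ Y) {Z : R.Obj} (h : Z ≠ X)
    (W : R.Obj) : R.opHom f a Z W = 0 := by
  simp [opHom, h]

theorem opHom_ext {X : R.Obj} {s : R.DiagAlg} {Y : R.Obj} {f : X ⟶ Y}
    (h1 : ∀ a W, s a X W = f ≫ a Y W) (h2 : ∀ a Z W, Z ≠ X → s a Z W = 0) : R.opHom f = s := by
  refine LinearMap.ext fun a => funext fun Z => funext fun W => ?_
  by_cases h : Z = X
  · subst h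
    rw [opHom_apply_self, h1]
  · rw [opHom_apply_ne _ _ h, h2 _ _ _ h]

/-- Products in the algebra, read from left to right, are diagrams read from bottom to top. -/
theorem opHom_comp {X Y Z : R.Obj} (f : X ⟶ Y) (g : Y ⟶ Z) :
    R.opHom (f ≫ g) = R.opHom f * R.opHom g := by
  refine opHom_ext (fun a W => ?_) fun a Z W h => ?_
  · rw [Module.End.mul_apply, opHom_apply_self, opHom_apply_self, Category.assoc]
  · rw [Module.End.mul_apply, opHom_apply_ne _ _ h]

theorem opHom_add {X Y : R.Obj} (f g : X ⟶ Y) : R.opHom (f + g) = R.opHom f + R.opHom g := by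
  refine opHom_ext (fun a W => ?_) fun a Z W h => ?_
  · simp [opHom_apply_self]
  · simp [opHom_apply_ne _ _ h]

theorem opHom_smul {X Y : R.Obj} (c : k) (f : X ⟶ Y) : R.opHom (c • f) = c • R.opHom f := by
  refine opHom_ext (fun a W => ?_) fun a Z W h => ?_
  · simp [opHom_apply_self]
  · simp [opHom_apply_ne _ _ h]

/-- The operator, applied to the family with identities on the diagonal and zero elsewhere, returns
the morphism as one of its components. -/
theorem opHom_injective {X Y : R.Obj} {f g : X ⟶ Y} (h : R.opHom f = R.opHom g) : f = g := by
  classical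
  have := congrFun (congrFun (LinearMap.congr_fun h
    (fun Z W => if h : Z = W then eqToHom h else 0)) X) Y
  rw [opHom_apply_self, opHom_apply_self] at this
  simpa using this

theorem eqv_iff_homMk {X Y : M} {e e' : WExpr k G X Y} :
    WExpr.Eqv R e e' ↔ R.homMk e = R.homMk e' :=
  ⟨cls_eq, fun h => Quotient.exact (s := R.setoid X Y) h⟩

theorem op_congr {X Y : M} {e e' : WExpr k G X Y} (h : WExpr.Eqv R e e') : R.op e = R.op e' :=
  congrArg R.opHom (eqv_iff_homMk.1 h)

theorem eqv_of_op {X Y : M} {e e' : WExpr k G X Y} (h : R.op e = R.op e') : WExpr.Eqv R e e' :=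
  eqv_iff_homMk.2 (opHom_injective h)

theorem op_comp {X Y Z : M} (e : WExpr k G X Y) (e' : WExpr k G Y Z) :
    R.op (e ≫ₑ e') = R.op e * R.op e' :=
  opHom_comp (R.homMk e) (R.homMk e')

theorem op_add {X Y : M} (e e' : WExpr k G X Y) : R.op (e.add e') = R.op e + R.op e' :=
  opHom_add (R.homMk e) (R.homMk e')

theorem op_smul {X Y : M} (c : k) (e : WExpr k G X Y) : R.op (e.smul c) = c • R.op e :=
  opHom_smul c (R.homMk e)

/-- The idempotent of an object. -/
noncomputable def idn (R : SuperPresentation k G) (X : M) : R.DiagAlg := R.op (.id X)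

theorem idn_mul_op {X Y : M} (e : WExpr k G X Y) : R.idn X * R.op e = R.op e := by
  rw [idn, ← op_comp]
  exact op_congr (.id_comp _)

theorem op_mul_idn {X Y : M} (e : WExpr k G X Y) : R.op e * R.idn Y = R.op e := by
  rw [idn, ← op_comp]
  exact op_congr (.comp_id _)

/-- The reason for working with operators: all of them live in one type, so the identities that
mediate between equal objects simply disappear. -/
theorem op_eqE_comp {X Y Z : M} (h : X = Y) (e : WExpr k G Y Z) :
    R.op (WExpr.eqE h ≫ₑ e) = R.op e := by
  subst h
  exact op_congr (.id_comp _)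

theorem op_comp_eqE {X Y Z : M} (e : WExpr k G X Y) (h : Y = Z) :
    R.op (e ≫ₑ WExpr.eqE h) = R.op e := by
  subst h
  exact op_congr (.comp_id _)

theorem op_tensor_assoc {X Y X' Y' X'' Y'' : M} (f : WExpr k G X Y) (g : WExpr k G X' Y')
    (h : WExpr k G X'' Y'') : R.op ((f ⊗ₑ g) ⊗ₑ h) = R.op (f ⊗ₑ (g ⊗ₑ h)) := by
  rw [op_congr (.tensor_assoc f g h), op_eqE_comp, op_comp_eqE]

theorem op_one_tensor {X Y : M} (f : WExpr k G X Y) : R.op (.id 1 ⊗ₑ f) = R.op f := by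
  rw [op_congr (.one_tensor f), op_eqE_comp, op_comp_eqE]

theorem op_tensor_one {X Y : M} (f : WExpr k G X Y) : R.op (f ⊗ₑ .id 1) = R.op f := by
  rw [op_congr (.tensor_one f), op_eqE_comp, op_comp_eqE]

/-- Allows replacements whose sources and targets are equal without being definitionally so, which
`Eqv` cannot even state. -/
theorem op_tensor_congr {X Y X' Y' A B A' B' : M} {f : WExpr k G X Y} {f' : WExpr k G X' Y'}
    {g : WExpr k G A B} {g' : WExpr k G A' B'} (hX : X = X') (hY : Y = Y') (hA : A = A')
    (hB : B = B') (hf : R.op f = R.op f') (hg : R.op g = R.op g') :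
    R.op (f ⊗ₑ g) = R.op (f' ⊗ₑ g') := by
  subst hX; subst hY; subst hA; subst hB
  exact op_congr (.tensor_congr (eqv_of_op hf) (eqv_of_op hg))

/-- Interchange when the lower left morphism is even. -/
theorem op_interchange_left {X Y Z X' Y' Z' : M} {h : WExpr k G X Y} (f : WExpr k G Y Z)
    (l : WExpr k G X' Y') (g : WExpr k G Y' Z') (hh : h.HasParity 0) :
    R.op (h ⊗ₑ l) * R.op (f ⊗ₑ g) = R.op ((h ≫ₑ f) ⊗ₑ (l ≫ₑ g)) := by
  have key : ∀ p (g : WExpr k G Y' Z'), g.HasParity p →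
      R.op (h ⊗ₑ l) * R.op (f ⊗ₑ g) = R.op ((h ≫ₑ f) ⊗ₑ (l ≫ₑ g)) := by
    intro p g hg
    rw [← op_comp, op_congr (.interchange h f l g hg hh), op_smul]
    simp
  -- The interchange axiom needs both expressions homogeneous; only one is known to be even, so the
  -- other is cut into its even and odd parts.
  obtain ⟨g₀, g₁, h₀, h₁, hg⟩ := exists_even_odd (R := R) g
  rw [op_congr (.tensor_congr (.refl f) hg), op_congr (.tensor_add _ _ _), op_add, mul_add,
    key _ _ h₀, key _ _ h₁, ← op_add, ← op_congr (.tensor_add _ _ _)]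
  exact op_congr (.tensor_congr (.refl _) (.trans (.symm (.comp_add _ _ _))
    (.comp_congr (.refl _) (.symm hg))))

/-- Interchange when the upper right morphism is even. -/
theorem op_interchange_right {X Y Z X' Y' Z' : M} (h : WExpr k G X Y) (f : WExpr k G Y Z)
    (l : WExpr k G X' Y') {g : WExpr k G Y' Z'} (hg : g.HasParity 0) :
    R.op (h ⊗ₑ l) * R.op (f ⊗ₑ g) = R.op ((h ≫ₑ f) ⊗ₑ (l ≫ₑ g)) := by
  have key : ∀ p (h : WExpr k G X Y), h.HasParity p →
      R.op (h ⊗ₑ l) * R.op (f ⊗ₑ g) = R.op ((h ≫ₑ f) ⊗ₑ (l ≫ₑ g)) := by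
    intro p h hh
    rw [← op_comp, op_congr (.interchange h f l g hg hh), op_smul]
    simp
  obtain ⟨h₀, h₁, hh₀, hh₁, hg⟩ := exists_even_odd (R := R) h
  rw [op_congr (.tensor_congr hg (.refl l)), op_congr (.add_tensor _ _ _), op_add, add_mul,
    key _ _ hh₀, key _ _ hh₁, ← op_add, ← op_congr (.add_tensor _ _ _)]
  exact op_congr (.tensor_congr (.trans (.symm (.add_comp _ _ _))
    (.comp_congr (.symm hg) (.refl _))) (.refl _))

end DiagramAlgebra

/-! ### Diagrams between identity strands -/

section Tiles

variable {k : Type w} [CommRing k] {M : Type u} [Monoid M] {G : SuperSignature.{u, v} M}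

/-- An expression together with its source and target. -/
structure _root_.Tile (k : Type w) {M : Type u} [Monoid M] (G : SuperSignature.{u, v} M) where
  src : M
  tgt : M
  expr : WExpr k G src tgt

/-- The expression of a tile is visibly even. -/
class _root_.Tile.IsEven (a : Tile k G) : Prop where
  even : a.expr.HasParity 0

/-- A tile between identity strands. -/
noncomputable def lay (R : SuperPresentation k G) (L : M) (a : Tile k G) (N : M) : R.DiagAlg :=
  R.op ((.id L ⊗ₑ a.expr) ⊗ₑ .id N)

/-- An expression between identity strands. -/
noncomputable def layE (R : SuperPresentation k G) (L : M) {X Y : M} (e : WExpr k G X Y) (N : M) :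
    R.DiagAlg := R.lay L ⟨X, Y, e⟩ N

variable {R : SuperPresentation k G}

theorem layE_def (L : M) {X Y : M} (e : WExpr k G X Y) (N : M) :
    R.layE L e N = R.op ((.id L ⊗ₑ e) ⊗ₑ .id N) := rfl

theorem layE_congr {X Y : M} {e e' : WExpr k G X Y} (h : WExpr.Eqv R e e') (L N : M) :
    R.layE L e N = R.layE L e' N :=
  op_congr (.tensor_congr (.tensor_congr (.refl _) h) (.refl _))

theorem layE_one {X Y : M} (e : WExpr k G X Y) : R.layE 1 e 1 = R.op e := by
  rw [layE_def, op_tensor_one, op_one_tensor]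

theorem eqv_of_layE {X Y : M} {e e' : WExpr k G X Y} (h : R.layE 1 e 1 = R.layE 1 e' 1) :
    WExpr.Eqv R e e' := by
  rw [layE_one, layE_one] at h
  exact eqv_of_op h

theorem layE_id (L X N : M) : R.layE L (.id X) N = R.idn (L * (X * N)) := by
  rw [layE_def, op_congr (.tensor_congr (.id_tensor_id _ _) (.refl _)),
    op_congr (.id_tensor_id _ _), ← mul_assoc]
  rfl

theorem layE_eqE (L N : M) {X Y : M} (h : X = Y) :
    R.layE L (WExpr.eqE h) N = R.idn (L * (X * N)) := by
  subst h
  exact layE_id _ _ _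

theorem layE_comp (L N : M) {X Y Z : M} (e : WExpr k G X Y) (e' : WExpr k G Y Z) :
    R.layE L (e ≫ₑ e') N = R.layE L e N * R.layE L e' N := by
  rw [layE_def, layE_def, layE_def, op_interchange_right _ _ _ (.id N)]
  refine op_congr (.tensor_congr ?_ (.symm (.id_comp _)))
  refine eqv_of_op ?_
  rw [op_comp, op_interchange_left _ _ _ (.id L)]
  exact op_congr (.tensor_congr (.symm (.id_comp _)) (.refl _))

/-- The left factor is put above the right one, in agreement with the height convention; in this
order the interchange law gives no sign. -/
theorem layE_tensor (L N : M) {X Y X' Y' : M} (f : WExpr k G X Y) (g : WExpr k G X' Y') :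
    R.layE L (f ⊗ₑ g) N = R.layE (L * X) g N * R.layE L f (Y' * N) := by
  have h : WExpr.Eqv R (f ⊗ₑ g) ((.id X ⊗ₑ g) ≫ₑ (f ⊗ₑ .id Y')) := by
    refine eqv_of_op ?_
    rw [op_comp, op_interchange_left _ _ _ (.id X)]
    exact op_congr (.tensor_congr (.symm (.id_comp _)) (.symm (.comp_id _)))
  rw [layE_congr h, layE_comp]
  congr 1
  · rw [layE_def, layE_def]
    refine op_tensor_congr (by simp only [mul_assoc]) (by simp only [mul_assoc]) rfl rfl ?_ rfl
    rw [← op_tensor_assoc]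
    exact op_congr (.tensor_congr (.id_tensor_id _ _) (.refl _))
  · rw [layE_def, layE_def, op_tensor_assoc, op_tensor_assoc]
    refine op_tensor_congr rfl rfl (by simp only [mul_assoc]) (by simp only [mul_assoc]) rfl ?_
    rw [op_tensor_assoc]
    exact op_congr (.tensor_congr (.refl _) (.id_tensor_id _ _))

theorem layE_add (L N : M) {X Y : M} (e e' : WExpr k G X Y) :
    R.layE L (e.add e') N = R.layE L e N + R.layE L e' N := by
  rw [layE_def, layE_def, layE_def, ← op_add]
  exact op_congr (.trans (.tensor_congr (.tensor_add _ _ _) (.refl _)) (.add_tensor _ _ _))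

theorem layE_smul (L N : M) {X Y : M} (c : k) (e : WExpr k G X Y) :
    R.layE L (e.smul c) N = c • R.layE L e N := by
  rw [layE_def, layE_def, ← op_smul]
  exact op_congr (.trans (.tensor_congr (.tensor_smul _ _ _) (.refl _)) (.smul_tensor _ _ _))

theorem layE_zero (L N : M) {X Y : M} : R.layE L (.zero : WExpr k G X Y) N = 0 := by
  rw [layE_congr (.symm (.zero_smul .zero)), layE_smul, zero_smul]

theorem layE_sum (L N : M) {X Y : M} (l : List (WExpr k G X Y)) :
    R.layE L (WExpr.sum l) N = (l.map fun e => R.layE L e N).sum := by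
  induction l with
  | nil => exact layE_zero _ _
  | cons e l ih =>
    rw [List.map_cons, List.sum_cons, ← ih, ← layE_add]
    rfl

theorem idn_mul_idn (X : M) : R.idn X * R.idn X = R.idn X := idn_mul_op _

theorem idn_mul_lay (a : Tile k G) {L N Z : M} (h : Z = L * (a.src * N)) :
    R.idn Z * R.lay L a N = R.lay L a N := by
  rw [h, ← mul_assoc]
  exact idn_mul_op _

theorem lay_mul_idn (a : Tile k G) {L N Z : M} (h : Z = L * (a.tgt * N)) :
    R.lay L a N * R.idn Z = R.lay L a N := by
  rw [h, ← mul_assoc]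
  exact op_mul_idn _

/-- Both orders compute the tensor product with `Z` in the middle. Evenness of one factor is needed
only for the order opposite to that of `layE_tensor`. -/
theorem layE_tensor_of_even (L N Z : M) {X Y X' Y' : M} (f : WExpr k G X Y) (g : WExpr k G X' Y')
    (h : f.HasParity 0 ∨ g.HasParity 0) :
    R.layE L f (Z * (X' * N)) * R.layE (L * (Y * Z)) g N =
      R.layE (L * (X * Z)) g N * R.layE L f (Z * (Y' * N)) := by
  have h1 : WExpr.Eqv R ((f ⊗ₑ .id Z) ⊗ₑ g) (((f ⊗ₑ .id Z) ⊗ₑ .id X') ≫ₑ (.id (Y * Z) ⊗ₑ g)) := by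
    refine eqv_of_op ?_
    have h2 : R.op ((f ⊗ₑ .id Z) ⊗ₑ .id X') * R.op (.id (Y * Z) ⊗ₑ g) =
        R.op (((f ⊗ₑ .id Z) ≫ₑ .id _) ⊗ₑ (.id X' ≫ₑ g)) := by
      rcases h with h | h
      · exact op_interchange_left _ _ _ (by simpa using h.tensor (.id Z))
      · exact op_interchange_right _ _ _ h
    rw [op_comp, h2]
    exact op_congr (.tensor_congr (.symm (.comp_id _)) (.symm (.id_comp _)))
  have hl : R.layE (L * (X * Z)) (.id X') N * R.layE L f (Z * (X' * N)) =
      R.layE L f (Z * (X' * N)) := by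
    rw [layE_id]
    exact idn_mul_lay ⟨_, _, f⟩ (by simp only [mul_assoc])
  have hm : R.layE L (.id (Y * Z)) (Y' * N) = R.idn (L * (Y * (Z * (Y' * N)))) := by
    rw [layE_id, mul_assoc]
  have hr : R.layE (L * (Y * Z)) g N * R.idn (L * (Y * (Z * (Y' * N)))) =
      R.layE (L * (Y * Z)) g N :=
    lay_mul_idn ⟨_, _, g⟩ (by simp only [mul_assoc])
  have ht : ∀ {U : M}, R.layE (L * X) (.id Z) (U * N) * R.layE L f (Z * (U * N)) =
      R.layE L f (Z * (U * N)) := by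
    intro U
    rw [layE_id]
    exact idn_mul_lay ⟨_, _, f⟩ (by simp only [mul_assoc])
  have key := layE_congr h1 L N
  rw [layE_comp, layE_tensor, layE_tensor, ht, layE_tensor,
    layE_tensor L (X' * N) f (.id Z), ht, hl,
    layE_tensor L N (.id (Y * Z)) g, hm, hr] at key
  exact key.symm

theorem lay_comm (a b : Tile k G) (L Z N : M) (h : a.IsEven ∨ b.IsEven) :
    R.lay L a (Z * (b.src * N)) * R.lay (L * (a.tgt * Z)) b N =
      R.lay (L * (a.src * Z)) b N * R.lay L a (Z * (b.tgt * N)) :=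
  layE_tensor_of_even L N Z a.expr b.expr (h.imp (·.1) (·.1))

theorem layE_eq_lay (L : M) {X Y : M} (e : WExpr k G X Y) (N : M) :
    R.layE L e N = R.lay L ⟨X, Y, e⟩ N := rfl

attribute [irreducible] lay layE idn

end Tiles

end SuperPresentation

namespace SuperPresentation

/-! ### Substitution for generators -/

section Bind

variable {k : Type w} {M : Type u} [Monoid M] {G G' : SuperSignature.{u, v} M}

/-- Substitution of expressions for the generators. -/
def _root_.WExpr.bind (φ : ∀ g : G.Gen, WExpr k G' (G.src g) (G.tgt g)) :
    {X Y : M} → WExpr k G X Y → WExpr k G' X Y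
  | _, _, .id X => .id X
  | _, _, .gen g => φ g
  | _, _, .comp f g => f.bind φ ≫ₑ g.bind φ
  | _, _, .tensor f g => f.bind φ ⊗ₑ g.bind φ
  | _, _, .zero => .zero
  | _, _, .add f g => (f.bind φ).add (g.bind φ)
  | _, _, .smul c f => (f.bind φ).smul c

variable {φ : ∀ g : G.Gen, WExpr k G' (G.src g) (G.tgt g)}

theorem bind_eqE {X Y : M} (h : X = Y) :
    (WExpr.eqE h : WExpr k G X Y).bind φ = WExpr.eqE h := by
  subst h; rfl

theorem bind_sum {X Y : M} (l : List (WExpr k G X Y)) :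
    (WExpr.sum l).bind φ = WExpr.sum (l.map fun e => e.bind φ) := by
  induction l with
  | nil => rfl
  | cons e l ih =>
    rw [List.map_cons]
    exact congrArg ((e.bind φ).add ·) ih

theorem _root_.WExpr.HasParity.bind (hφ : ∀ g, (φ g).HasParity (G.par g)) {X Y : M} {p : ZMod 2}
    {e : WExpr k G X Y} (h : e.HasParity p) : (e.bind φ).HasParity p := by
  induction h with
  | id X => exact .id X
  | gen g => exact hφ g
  | comp _ _ h h' => exact .comp h h'
  | tensor _ _ h h' => exact .tensor h h'
  | zero p => exact .zero p
  | add _ _ h h' => exact .add h h'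
  | smul c _ h => exact .smul c h

variable [CommRing k] {R : SuperPresentation k G} {R' : SuperPresentation k G'}

/-- `Eqv` is the smallest congruence with the given relations, so only these need to be checked.
Preservation of parities is what keeps the sign in the interchange law. -/
theorem eqv_bind (hφ : ∀ g, (φ g).HasParity (G.par g))
    (hR : ∀ {X Y : M} {e e' : WExpr k G X Y}, R.rel e e' → WExpr.Eqv R' (e.bind φ) (e'.bind φ))
    {X Y : M} {e e' : WExpr k G X Y} (h : WExpr.Eqv R e e') :
    WExpr.Eqv R' (e.bind φ) (e'.bind φ) := by
  induction h with
  | rel h => exact hR h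
  | refl e => exact .refl _
  | symm _ h => exact .symm h
  | trans _ _ h h' => exact .trans h h'
  | comp_congr _ _ h h' => exact .comp_congr h h'
  | tensor_congr _ _ h h' => exact .tensor_congr h h'
  | add_congr _ _ h h' => exact .add_congr h h'
  | smul_congr c _ h => exact .smul_congr c h
  | add_assoc f g h => exact .add_assoc _ _ _
  | add_comm f g => exact .add_comm _ _
  | zero_add f => exact .zero_add _
  | smul_add c f g => exact .smul_add _ _ _
  | add_smul c d f => exact .add_smul _ _ _
  | mul_smul c d f => exact .mul_smul _ _ _
  | one_smul f => exact .one_smul _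
  | zero_smul f => exact .zero_smul _
  | id_comp f => exact .id_comp _
  | comp_id f => exact .comp_id _
  | comp_assoc f g h => exact .comp_assoc _ _ _
  | add_comp f f' g => exact .add_comp _ _ _
  | comp_add f g g' => exact .comp_add _ _ _
  | smul_comp c f g => exact .smul_comp _ _ _
  | comp_smul c f g => exact .comp_smul _ _ _
  | add_tensor f f' g => exact .add_tensor _ _ _
  | tensor_add f g g' => exact .tensor_add _ _ _
  | smul_tensor c f g => exact .smul_tensor _ _ _
  | tensor_smul c f g => exact .tensor_smul _ _ _
  | id_tensor_id X Y => exact .id_tensor_id _ _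
  | interchange h f l g hg hh => exact .interchange _ _ _ _ (hg.bind hφ) (hh.bind hφ)
  | tensor_assoc f g h =>
    simp only [WExpr.bind, bind_eqE]
    exact .tensor_assoc _ _ _
  | one_tensor f =>
    simp only [WExpr.bind, bind_eqE]
    exact .one_tensor _
  | tensor_one f =>
    simp only [WExpr.bind, bind_eqE]
    exact .tensor_one _

theorem eqv_bind_bind {φ' : ∀ g : G'.Gen, WExpr k G (G'.src g) (G'.tgt g)}
    (h : ∀ g, WExpr.Eqv R ((φ g).bind φ') (.gen g)) {X Y : M} (e : WExpr k G X Y) :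
    WExpr.Eqv R ((e.bind φ).bind φ') e := by
  induction e with
  | id X => exact .refl _
  | gen g => exact h g
  | comp _ _ h h' => exact .comp_congr h h'
  | tensor _ _ h h' => exact .tensor_congr h h'
  | zero => exact .refl _
  | add _ _ h h' => exact .add_congr h h'
  | smul c _ h => exact .smul_congr c h

end Bind

/-! ### Compatibility of strict superfunctors with the operations on morphisms -/

section FunctorSends

variable {C : Type*} [Category C] {D : Type*} [Category D]

theorem eq_eqToHom_comp {X Y : C} (f : X ⟶ Y) (hX : X = X) (hY : Y = Y) :
    f = eqToHom hX ≫ f ≫ eqToHom hY := by simp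

theorem functorSends_id (F : C ⥤ D) {X : C} {X' : D} (h : F.obj X = X') :
    FunctorSends F (𝟙 X) (𝟙 X') :=
  ⟨h, h, by simp⟩

theorem functorSends_comp {F : C ⥤ D} {X Y Z : C} {X' Y' Z' : D} {f : X ⟶ Y} {g : Y ⟶ Z}
    {f' : X' ⟶ Y'} {g' : Y' ⟶ Z'} (hf : FunctorSends F f f') (hg : FunctorSends F g g') :
    FunctorSends F (f ≫ g) (f' ≫ g') := by
  obtain ⟨hX, hY, hf⟩ := hf
  obtain ⟨hY', hZ, hg⟩ := hg
  exact ⟨hX, hZ, by simp [hf, hg]⟩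

variable {k : Type w} [CommRing k] [Preadditive C] [Linear k C] [Monoid C]
  [StrictMonoidalSupercategory k C] [Preadditive D] [Linear k D] [Monoid D]
  [StrictMonoidalSupercategory k D]

theorem functorSends_tensor {F : StrictMonoidalSuperfunctor k C D} {X Y Z W : C} {X' Y' Z' W' : D}
    {f : X ⟶ Y} {g : Z ⟶ W} {f' : X' ⟶ Y'} {g' : Z' ⟶ W'}
    (hf : FunctorSends F.toFunctor f f') (hg : FunctorSends F.toFunctor g g') :
    FunctorSends F.toFunctor (StrictMonoidalSupercategory.tensor (k := k) f g)
      (StrictMonoidalSupercategory.tensor (k := k) f' g') := by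
  obtain ⟨hX, hY, hf⟩ := hf
  obtain ⟨hZ, hW, hg⟩ := hg
  subst hX; subst hY; subst hZ; subst hW
  refine ⟨F.obj_mul _ _, F.obj_mul _ _, ?_⟩
  rw [F.map_tensor, hf, hg]
  simp

theorem functorSends_add {F : StrictMonoidalSuperfunctor k C D} {X Y : C} {X' Y' : D}
    {f g : X ⟶ Y} {f' g' : X' ⟶ Y'} (hf : FunctorSends F.toFunctor f f')
    (hg : FunctorSends F.toFunctor g g') : FunctorSends F.toFunctor (f + g) (f' + g') := by
  obtain ⟨hX, hY, hf⟩ := hf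
  obtain ⟨_, _, hg⟩ := hg
  exact ⟨hX, hY, by rw [F.map_add, hf, hg, Preadditive.add_comp, Preadditive.comp_add]⟩

theorem functorSends_smul {F : StrictMonoidalSuperfunctor k C D} {X Y : C} {X' Y' : D} (c : k)
    {f : X ⟶ Y} {f' : X' ⟶ Y'} (hf : FunctorSends F.toFunctor f f') :
    FunctorSends F.toFunctor (c • f) (c • f') := by
  obtain ⟨hX, hY, hf⟩ := hf
  exact ⟨hX, hY, by rw [F.map_smul, hf, Linear.smul_comp, Linear.comp_smul]⟩

theorem functorSends_zero {F : StrictMonoidalSuperfunctor k C D} {X Y : C} {X' Y' : D}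
    (hX : F.obj X = X') (hY : F.obj Y = Y') :
    FunctorSends F.toFunctor (0 : X ⟶ Y) (0 : X' ⟶ Y') := by
  refine ⟨hX, hY, ?_⟩
  rw [← zero_smul k (0 : X ⟶ Y), F.map_smul, zero_smul, Limits.zero_comp, Limits.comp_zero]

end FunctorSends

/-! ### The functor given by a substitution, and its uniqueness -/

section Functor

variable {k : Type w} [Field k] [CharZero k] {M : Type u} [Monoid M]
  {G G' : SuperSignature.{u, v} M} {φ : ∀ g : G.Gen, WExpr k G' (G.src g) (G.tgt g)}
  {R : SuperPresentation k G} {R' : SuperPresentation k G'}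

/-- The functor between presented categories given by the images of the generators. -/
def bindFunctor (hφ : ∀ g, (φ g).HasParity (G.par g))
    (hR : ∀ {X Y : M} {e e' : WExpr k G X Y}, R.rel e e' → WExpr.Eqv R' (e.bind φ) (e'.bind φ)) :
    StrictMonoidalSuperfunctor k R.Obj R'.Obj where
  obj X := (show M from X)
  map {X Y} := Quotient.map (sa := R.setoid X Y) (sb := R'.setoid X Y) (WExpr.bind φ)
    fun _ _ h => eqv_bind hφ hR h
  map_id _ := rfl
  map_comp := by
    intro X Y Z f g
    induction f using Hom.ind; induction g using Hom.ind
    rfl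
  map_add := by
    intro X Y f g
    induction f using Hom.ind; induction g using Hom.ind
    rfl
  map_smul := by
    intro X Y c f
    induction f using Hom.ind
    rfl
  map_parity := by
    rintro X Y p _ ⟨e, he, rfl⟩
    exact ⟨e.bind φ, he.bind hφ, rfl⟩
  obj_one := rfl
  obj_mul _ _ := rfl
  map_tensor := by
    intro X Y X' Y' f g
    induction f using Hom.ind; induction g using Hom.ind
    exact eq_eqToHom_comp (C := R'.Obj) _ rfl rfl

/-- Every morphism is represented by an expression, and a strict monoidal superfunctor respects each
constructor of expressions; so its values on generators determine it. -/
theorem eq_bindFunctor (hφ : ∀ g, (φ g).HasParity (G.par g))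
    (hR : ∀ {X Y : M} {e e' : WExpr k G X Y}, R.rel e e' → WExpr.Eqv R' (e.bind φ) (e'.bind φ))
    (F : StrictMonoidalSuperfunctor k R.Obj R'.Obj)
    (hobj : ∀ X : M, F.obj (show R.Obj from X) = (show R'.Obj from X))
    (hgen : ∀ g, FunctorSends F.toFunctor (R.homMk (.gen g)) (R'.homMk (φ g))) :
    F = bindFunctor hφ hR := by
  have key : ∀ {X Y : M} (e : WExpr k G X Y),
      FunctorSends F.toFunctor (R.homMk e) (R'.homMk (e.bind φ)) := by
    intro X Y e
    induction e with
    | id X => exact functorSends_id F.toFunctor (hobj X)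
    | gen g => exact hgen g
    | comp f g hf hg => exact functorSends_comp hf hg
    | tensor f g hf hg => exact functorSends_tensor hf hg
    | zero => exact functorSends_zero (k := k) (hobj _) (hobj _)
    | add f g hf hg => exact functorSends_add hf hg
    | smul c f hf => exact functorSends_smul c hf
  have hF : F.toFunctor = (bindFunctor hφ hR).toFunctor := by
    refine CategoryTheory.Functor.ext hobj fun X Y f => ?_
    induction f using Hom.ind with
    | h e => exact (key e).2.2
  cases F
  cases hF
  rfl

theorem bindFunctor_comp_eq_id {φ' : ∀ g : G'.Gen, WExpr k G (G'.src g) (G'.tgt g)}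
    (hφ : ∀ g, (φ g).HasParity (G.par g))
    (hR : ∀ {X Y : M} {e e' : WExpr k G X Y}, R.rel e e' → WExpr.Eqv R' (e.bind φ) (e'.bind φ))
    (hφ' : ∀ g, (φ' g).HasParity (G'.par g))
    (hR' : ∀ {X Y : M} {e e' : WExpr k G' X Y}, R'.rel e e' →
      WExpr.Eqv R (e.bind φ') (e'.bind φ'))
    (h : ∀ g, WExpr.Eqv R ((φ g).bind φ') (.gen g)) :
    (bindFunctor (R := R) hφ hR).toFunctor ⋙ (bindFunctor (R := R') hφ' hR').toFunctor =
      𝟭 R.Obj := by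
  refine CategoryTheory.Functor.ext (fun _ => rfl) fun X Y f => ?_
  have key : ((bindFunctor (R := R) hφ hR).toFunctor ⋙
      (bindFunctor (R := R') hφ' hR').toFunctor).map f = f := by
    induction f using Hom.ind with
    | h e => exact cls_eq (R := R) (eqv_bind_bind (φ := φ) (φ' := φ') h e)
  exact key.trans (eq_eqToHom_comp (C := R.Obj) f rfl rfl)

end Functor

end SuperPresentation

set_option linter.unusedSimpArgs false

/-! ### Normal forms of left and right contexts -/

namespace SuperPresentation

variable {k : Type w} [CommRing k] {M : Type u} [Monoid M] {G : SuperSignature.{u, v} M}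
  {R : SuperPresentation k G}

/-- Left contexts grow on the right; `L ◂ X` is `L * X`, kept apart from the products that occur
in right contexts. -/
def snoc (L X : M) : M := L * X

infixl:70 " ◂ " => snoc

theorem snoc_mul (L X Y : M) : L ◂ (X * Y) = L ◂ X ◂ Y := (mul_assoc _ _ _).symm

theorem snoc_one (L : M) : L ◂ 1 = L := mul_one _

theorem snoc_mul_eq (L X N : M) : (L ◂ X) * N = L * (X * N) := mul_assoc _ _ _

theorem layE_tensor_snoc (L N : M) {X Y X' Y' : M} (f : WExpr k G X Y) (g : WExpr k G X' Y') :
    R.layE L (f ⊗ₑ g) N = R.layE (L ◂ X) g N * R.layE L f (Y' * N) := layE_tensor _ _ _ _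

theorem lay_far (a b : Tile k G) (L Z N : M) [h : a.IsEven] :
    R.lay L a (Z * (b.src * N)) * R.lay (L ◂ (a.tgt * Z)) b N =
      R.lay (L ◂ (a.src * Z)) b N * R.lay L a (Z * (b.tgt * N)) :=
  lay_comm a b L Z N (.inl h)

theorem lay_far' (a b : Tile k G) (L Z N : M) [h : b.IsEven] :
    R.lay L a (Z * (b.src * N)) * R.lay (L ◂ (a.tgt * Z)) b N =
      R.lay (L ◂ (a.src * Z)) b N * R.lay L a (Z * (b.tgt * N)) :=
  lay_comm a b L Z N (.inr h)

theorem idn_mul_lay_mul (a : Tile k G) {L N Z : M} (h : Z = L * (a.src * N)) (s : R.DiagAlg) :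
    R.idn Z * (R.lay L a N * s) = R.lay L a N * s := by
  rw [← mul_assoc, idn_mul_lay a h]

theorem lay_mul_idn_mul (a : Tile k G) {L N Z : M} (h : Z = L * (a.tgt * N)) (s : R.DiagAlg) :
    R.lay L a N * (R.idn Z * s) = R.lay L a N * s := by
  rw [← mul_assoc, lay_mul_idn a h]

theorem idn_mul_idn_mul (X : M) (s : R.DiagAlg) : R.idn X * (R.idn X * s) = R.idn X * s := by
  rw [← mul_assoc, idn_mul_idn]

theorem reassoc {a b c : R.DiagAlg} (h : a * b = c) (s : R.DiagAlg) :
    a * (b * s) = c * s := by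
  rw [← mul_assoc, h]

end SuperPresentation

namespace AffineWeb

open FrobeniusGreatPair SuperPresentation

variable {k : Type u} [Field k] {A : Type v} [NonUnitalRing A] [Module k A] [IsScalarTower k A A]
  [SMulCommClass k A A] {P : FrobeniusGreatPair k A} {D : ℕ → Prop}

/-! ### Generating diagrams, and their degeneration at thickness zero -/

section Tiles

/-- the split -/
abbrev Sp (i : P.I) (x y : ℕ) : Tile k (webSig P D) := ⟨_, _, split i x y⟩

/-- the merge -/
abbrev Mg (i : P.I) (x y : ℕ) : Tile k (webSig P D) := ⟨_, _, merge i x y⟩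

/-- the crossing -/
abbrev Cr (i : P.I) (x : ℕ) (j : P.I) (y : ℕ) : Tile k (webSig P D) := ⟨_, _, cross i x j y⟩

/-- the coupon -/
abbrev Cp (z : ℕ) (j i : P.I) (p : ZMod 2) (f : A) (hf : IsCoupon P z j i p f) :
    Tile k (webSig P D) := ⟨_, _, coupon z j i p f hf⟩

instance (i : P.I) (x y : ℕ) : (Sp i x y : Tile k (webSig P D)).IsEven := ⟨hasParity_split ..⟩

instance (i : P.I) (x y : ℕ) : (Mg i x y : Tile k (webSig P D)).IsEven := ⟨hasParity_merge ..⟩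

instance (i : P.I) (x : ℕ) (j : P.I) (y : ℕ) : (Cr i x j y : Tile k (webSig P D)).IsEven :=
  ⟨hasParity_cross ..⟩

theorem strand_zero (i : P.I) : strand i 0 = 1 := rfl

variable (R : SuperPresentation k (webSig P D)) (L N : Comps P)

theorem layE_split (i : P.I) (x y : ℕ) : R.layE L (split i x y) N = R.lay L (Sp i x y) N :=
  layE_eq_lay _ _ _

theorem layE_merge (i : P.I) (x y : ℕ) : R.layE L (merge i x y) N = R.lay L (Mg i x y) N :=
  layE_eq_lay _ _ _

theorem layE_cross (i : P.I) (x : ℕ) (j : P.I) (y : ℕ) :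
    R.layE L (cross i x j y) N = R.lay L (Cr i x j y) N :=
  layE_eq_lay _ _ _

theorem layE_coupon (z : ℕ) (j i : P.I) (p : ZMod 2) (f : A) (hf : IsCoupon P z j i p f) :
    R.layE L (coupon z j i p f hf) N = R.lay L (Cp z j i p f hf) N :=
  layE_eq_lay _ _ _

theorem layE_str (i : P.I) (x : ℕ) : R.layE L (str i x) N = R.idn (L * (strand i x * N)) :=
  layE_id _ _ _

theorem layE_asc (X Y Z : Comps P) :
    R.layE L (asc X Y Z) N = R.idn (L * (X * (Y * (Z * N)))) := by
  rw [asc, layE_eqE]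
  simp only [mul_assoc]

theorem layE_asc' (X Y Z : Comps P) :
    R.layE L (asc' X Y Z) N = R.idn (L * (X * (Y * (Z * N)))) := by
  rw [asc', layE_eqE]
  simp only [mul_assoc]

theorem layE_splitN (i : P.I) (x y n : ℕ) (h : x + y = n) :
    R.layE L (splitN i x y n h) N = R.lay L (Sp i x y) N := by
  subst h
  rw [splitN, layE_comp, layE_eqE, layE_split, idn_mul_lay (Sp i x y) rfl]

theorem layE_mergeN (i : P.I) (x y n : ℕ) (h : x + y = n) :
    R.layE L (mergeN i x y n h) N = R.lay L (Mg i x y) N := by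
  subst h
  rw [mergeN, layE_comp, layE_eqE, layE_merge, lay_mul_idn (Mg i x y) rfl]

theorem lay_Sp_zero_left (i : P.I) (y : ℕ) :
    R.lay L (Sp i 0 y) N = R.idn (L * (strand i y * N)) := by
  rw [← layE_split, split, dif_neg (lt_irrefl 0), layE_eqE, Nat.zero_add]

theorem lay_Sp_zero_right (i : P.I) (x : ℕ) :
    R.lay L (Sp i x 0) N = R.idn (L * (strand i x * N)) := by
  rcases Nat.eq_zero_or_pos x with rfl | h
  · exact lay_Sp_zero_left _ _ _ _ _
  · have e : (split i x 0 : Dia P D _ _) = WExpr.eqE (by simp [strand_zero]) :=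
      (dif_pos h).trans (dif_neg (lt_irrefl 0))
    rw [← layE_split, e, layE_eqE, Nat.add_zero]

theorem lay_Mg_zero_left (i : P.I) (y : ℕ) :
    R.lay L (Mg i 0 y) N = R.idn (L * (strand i y * N)) := by
  rw [← layE_merge, merge, dif_neg (lt_irrefl 0), layE_eqE, strand_zero, one_mul]

theorem lay_Mg_zero_right (i : P.I) (x : ℕ) :
    R.lay L (Mg i x 0) N = R.idn (L * (strand i x * N)) := by
  rcases Nat.eq_zero_or_pos x with rfl | h
  · exact lay_Mg_zero_left _ _ _ _ _
  · have e : (merge i x 0 : Dia P D _ _) = WExpr.eqE (by simp [strand_zero]) :=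
      (dif_pos h).trans (dif_neg (lt_irrefl 0))
    rw [← layE_merge, e, layE_eqE, strand_zero, mul_one]

theorem lay_Cr_zero_left (i j : P.I) (y : ℕ) :
    R.lay L (Cr i 0 j y) N = R.idn (L * (strand j y * N)) := by
  rw [← layE_cross, cross, dif_neg (lt_irrefl 0), layE_eqE, strand_zero, one_mul]

theorem lay_Cr_zero_right (i j : P.I) (x : ℕ) :
    R.lay L (Cr i x j 0) N = R.idn (L * (strand i x * N)) := by
  rcases Nat.eq_zero_or_pos x with rfl | h
  · exact lay_Cr_zero_left _ _ _ _ _ _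
  · have e : (cross i x j 0 : Dia P D _ _) = WExpr.eqE (by simp [strand_zero]) :=
      (dif_pos h).trans (dif_neg (lt_irrefl 0))
    rw [← layE_cross, e, layE_eqE, strand_zero, mul_one]

theorem lay_Cp_zero (j i : P.I) (p : ZMod 2) (f : A) (hf : IsCoupon P 0 j i p f) :
    R.lay L (Cp 0 j i p f hf) N = R.idn (L * N) := by
  have e : (coupon 0 j i p f hf : Dia P D _ _) =
      WExpr.eqE (X := strand i 0) (Y := strand j 0) rfl :=
    dif_neg (lt_irrefl 0)
  rw [← layE_coupon, e]
  exact layE_eqE (R := R) L N (X := strand i 0) (Y := strand j 0) rfl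

end Tiles

/-- The relations between splits, merges, crossings and coupons hold in the category presented by
`R`. -/
class HasFinRel (R : SuperPresentation k (webSig P D)) : Prop where
  eqv : ∀ {X Y : Comps P} {e e' : Dia P D X Y}, FinRel P D e e' → WExpr.Eqv R e e'

/-! ### The relations without dots, as identities of operators -/

section Relations

variable (R : SuperPresentation k (webSig P D)) [HasFinRel R] (L N : Comps P) (i j l : P.I)
  (x y z w : ℕ)

theorem split_assoc :
    R.lay L (Sp i (x + y) z) N * R.lay L (Sp i x y) (strand i z * N) =
      R.lay L (Sp i x (y + z)) N * R.lay (L ◂ strand i x) (Sp i y z) N := by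
  have h := layE_congr (HasFinRel.eqv (R := R) (.split_assoc i x y z)) L N
  simpa only [layE_comp, layE_tensor_snoc, layE_eqE, layE_str, layE_asc', layE_split, mul_assoc,
    snoc_mul_eq, idn_mul_lay, lay_mul_idn, idn_mul_lay_mul, lay_mul_idn_mul, Nat.add_assoc] using h

theorem merge_assoc :
    R.lay L (Mg i x y) (strand i z * N) * R.lay L (Mg i (x + y) z) N =
      R.lay (L ◂ strand i x) (Mg i y z) N * R.lay L (Mg i x (y + z)) N := by
  have h := layE_congr (HasFinRel.eqv (R := R) (.merge_assoc i x y z)) L N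
  simpa only [layE_comp, layE_tensor_snoc, layE_eqE, layE_str, layE_asc, layE_merge, mul_assoc,
    snoc_mul_eq, idn_mul_lay, lay_mul_idn, idn_mul_lay_mul, lay_mul_idn_mul, Nat.add_assoc] using h

theorem knothole :
    R.lay L (Sp i x y) N * R.lay L (Mg i x y) N =
      ((x + y).choose x : k) • R.idn (L * (strand i (x + y) * N)) := by
  have h := layE_congr (HasFinRel.eqv (R := R) (.knothole i x y)) L N
  simpa only [layE_comp, layE_smul, layE_str, layE_merge, layE_split] using h

/-- A summand of the merge-split relation. -/
noncomputable def mergeSplitTerm (t : ℕ) : R.DiagAlg :=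
  R.lay (L ◂ strand i x) (Sp i (z + t - x) (w - t)) N *
    (R.lay L (Sp i (x - t) t) (strand i (z + t - x) * (strand i (w - t) * N)) *
      (R.lay (L ◂ strand i (x - t)) (Cr i t i (z + t - x)) (strand i (w - t) * N) *
        (R.lay (L ◂ strand i (x - t) ◂ strand i (z + t - x)) (Mg i t (w - t)) N *
          R.lay L (Mg i (x - t) (z + t - x)) (strand i w * N))))

-- The guard excludes those terms in which truncated subtraction would conceal a negative thickness;
-- `t ≤ x` already follows from the range of summation.
open Classical in
theorem merge_split (h : x + y = z + w) :
    R.lay L (Mg i x y) N * R.lay L (Sp i z w) N = ∑ t ∈ Finset.range (x + 1),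
      if t ≤ w ∧ x ≤ z + t then mergeSplitTerm R L N i x z w t else 0 := by
  have h := layE_congr (HasFinRel.eqv (R := R) (.merge_split i x y z w h)) L N
  rw [layE_comp, layE_splitN, layE_merge, layE_sum, List.map_map] at h
  rw [h, Finset.sum_range, ← List.sum_ofFn, List.ofFn_eq_map, ← List.map_coe_finRange_eq_range,
    List.map_map]
  refine congrArg List.sum (List.map_congr_left fun t _ => ?_)
  have ht : (t : ℕ) ≤ x := Nat.lt_succ_iff.mp t.2
  simp only [Function.comp_apply, msTerm]
  by_cases hc : (t : ℕ) ≤ w ∧ x ≤ z + t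
  · rw [if_pos hc, dif_pos ⟨ht, hc.1, hc.2, ‹_›⟩, mergeSplitTerm]
    have e1 : (x - t) + (t : ℕ) = x := by omega
    have e2 : (x - t) + (z + t - x) = z := by omega
    have e3 : (z + t - x) + (w - t) = y := by omega
    have e4 : (t : ℕ) + (w - t) = w := by omega
    simp only [layE_comp, layE_tensor_snoc, layE_eqE, layE_str, layE_splitN, layE_mergeN,
      layE_cross, mul_assoc, snoc_mul_eq, snoc_mul, idn_mul_lay, lay_mul_idn, idn_mul_lay_mul,
      lay_mul_idn_mul, e1, e2, e3, e4]
  · rw [if_neg hc, dif_neg fun h => hc ⟨h.2.1, h.2.2.1⟩, layE_zero]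

variable {i j l}

theorem split_cross_right_of_ne (hij : i ≠ j) :
    R.lay L (Cr i (x + y) j z) N * R.lay (L ◂ strand j z) (Sp i x y) N =
      R.lay L (Sp i x y) (strand j z * N) * (R.lay (L ◂ strand i x) (Cr i y j z) N *
        R.lay L (Cr i x j z) (strand i y * N)) := by
  have h := layE_congr (HasFinRel.eqv (R := R) (.split_cross_right i j x y z hij)) L N
  simpa only [layE_comp, layE_tensor_snoc, layE_eqE, layE_str, layE_asc, layE_asc', layE_split,
    layE_cross, mul_assoc, snoc_mul_eq, snoc_mul, idn_mul_lay, lay_mul_idn, idn_mul_lay_mul,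
    lay_mul_idn_mul] using h.symm

theorem merge_cross_right_of_ne (hij : i ≠ j) :
    R.lay L (Mg i x y) (strand j z * N) * R.lay L (Cr i (x + y) j z) N =
      R.lay (L ◂ strand i x) (Cr i y j z) N * (R.lay L (Cr i x j z) (strand i y * N) *
        R.lay (L ◂ strand j z) (Mg i x y) N) := by
  have h := layE_congr (HasFinRel.eqv (R := R) (.merge_cross_right i j x y z hij)) L N
  simpa only [layE_comp, layE_tensor_snoc, layE_eqE, layE_str, layE_asc, layE_asc', layE_merge,
    layE_cross, mul_assoc, snoc_mul_eq, snoc_mul, idn_mul_lay, lay_mul_idn, idn_mul_lay_mul,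
    lay_mul_idn_mul] using h.symm

theorem merge_cross_left_of_ne (hij : i ≠ j) :
    R.lay (L ◂ strand j z) (Mg i x y) N * R.lay L (Cr j z i (x + y)) N =
      R.lay L (Cr j z i x) (strand i y * N) * (R.lay (L ◂ strand i x) (Cr j z i y) N *
        R.lay L (Mg i x y) (strand j z * N)) := by
  have h := layE_congr (HasFinRel.eqv (R := R) (.merge_cross_left i j x y z hij)) L N
  simpa only [layE_comp, layE_tensor_snoc, layE_eqE, layE_str, layE_asc, layE_asc', layE_merge,
    layE_cross, mul_assoc, snoc_mul_eq, snoc_mul, idn_mul_lay, lay_mul_idn, idn_mul_lay_mul,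
    lay_mul_idn_mul] using h.symm

variable {p q : ZMod 2} {f g : A}

theorem coupon_smul (c : k) (hf : IsCoupon P x j i p f) :
    R.lay L (Cp x j i p (c • f) (hf.smul c)) N = c ^ x • R.lay L (Cp x j i p f hf) N := by
  have h := layE_congr (HasFinRel.eqv (R := R) (.coupon_smul i j x p c f hf)) L N
  simpa only [layE_coupon, layE_smul] using h

/-- A thin strand splits only as `0 + 1` and `1 + 0`, so the addition rule for coupons is plain
additivity. -/
theorem coupon_add_one (hf : IsCoupon P 1 j i p f) (hg : IsCoupon P 1 j i p g) :
    R.lay L (Cp 1 j i p (f + g) (hf.add hg)) N =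
      R.lay L (Cp 1 j i p f hf) N + R.lay L (Cp 1 j i p g hg) N := by
  have h := layE_congr (HasFinRel.eqv (R := R) (.coupon_add i j 1 p f g hf hg)) L N
  rw [layE_coupon, layE_sum, List.finRange_succ, List.finRange_succ, List.finRange_zero] at h
  simp only [List.map_cons, List.map_nil, List.sum_cons, List.sum_nil, layE_comp,
    layE_tensor_snoc, layE_splitN, layE_mergeN, layE_coupon] at h
  simp only [Fin.val_zero, Fin.val_succ,
    lay_Sp_zero_left, lay_Sp_zero_right, lay_Mg_zero_left, lay_Mg_zero_right, lay_Cp_zero,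
    Nat.sub_zero, Nat.sub_self, zero_add, strand_zero, snoc_one, one_mul, add_zero,
    snoc_mul_eq, idn_mul_lay, lay_mul_idn, idn_mul_lay_mul, lay_mul_idn_mul, mul_assoc] at h
  rw [h, add_comm]

theorem odd_knothole (hf : IsCoupon P 1 j i 1 f) :
    R.lay L (Sp i 1 1) N * (R.lay (L ◂ strand i 1) (Cp 1 j i 1 f hf) N *
      (R.lay L (Cp 1 j i 1 f hf) (strand j 1 * N) * R.lay L (Mg j 1 1) N)) = 0 := by
  have h := layE_congr (HasFinRel.eqv (R := R) (.odd_knothole i j f hf)) L N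
  simpa only [layE_comp, layE_tensor_snoc, layE_split, layE_merge, layE_coupon, layE_zero,
    mul_assoc] using h

theorem coupon_split (hf : IsCoupon P (x + y) j i p f) :
    R.lay L (Cp (x + y) j i p f hf) N * R.lay L (Sp j x y) N =
      R.lay L (Sp i x y) N * (R.lay (L ◂ strand i x) (Cp y j i p f (hf.mono (by omega))) N *
        R.lay L (Cp x j i p f (hf.mono (by omega))) (strand j y * N)) := by
  have h := layE_congr (HasFinRel.eqv (R := R) (.coupon_split i j x y p f hf)) L N
  simpa only [layE_comp, layE_tensor_snoc, layE_split, layE_coupon] using h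

variable (l)

theorem coupon_cross_left (hf : IsCoupon P x j i p f) :
    R.lay L (Cp x j i p f hf) (strand l y * N) * R.lay L (Cr j x l y) N =
      R.lay L (Cr i x l y) N * R.lay (L ◂ strand l y) (Cp x j i p f hf) N := by
  have h := layE_congr (HasFinRel.eqv (R := R) (.coupon_cross_left i j l x y p f hf)) L N
  simpa only [layE_comp, layE_tensor_snoc, layE_str, layE_cross, layE_coupon, snoc_mul_eq,
    idn_mul_lay, lay_mul_idn, idn_mul_lay_mul, lay_mul_idn_mul, mul_assoc] using h

theorem coupon_cross_right (hf : IsCoupon P x j i p f) :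
    R.lay (L ◂ strand l y) (Cp x j i p f hf) N * R.lay L (Cr l y j x) N =
      R.lay L (Cr l y i x) N * R.lay L (Cp x j i p f hf) (strand l y * N) := by
  have h := layE_congr (HasFinRel.eqv (R := R) (.coupon_cross_right i j l x y p f hf)) L N
  simpa only [layE_comp, layE_tensor_snoc, layE_str, layE_cross, layE_coupon, snoc_mul_eq,
    idn_mul_lay, lay_mul_idn, idn_mul_lay_mul, lay_mul_idn_mul, mul_assoc] using h

end Relations

end AffineWeb

namespace AffineWeb

open FrobeniusGreatPair SuperPresentation

variable {k : Type u} [Field k] {A : Type v} [NonUnitalRing A] [Module k A] [IsScalarTower k A A]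
  [SMulCommClass k A A] {P : FrobeniusGreatPair k A} {D : ℕ → Prop}

/-! ### Rewriting the first factors of a right-nested product -/

section Reassoc

variable {𝔸 : Type*} [Semigroup 𝔸] {a b c d e f : 𝔸}

theorem reassoc₂ (h : a * b = c * d) (s : 𝔸) : a * (b * s) = c * (d * s) := by
  rw [← mul_assoc, h, mul_assoc]

theorem reassoc₂₃ (h : a * b = c * (d * e)) (s : 𝔸) : a * (b * s) = c * (d * (e * s)) := by
  rw [← mul_assoc, h, mul_assoc, mul_assoc]

theorem reassoc₃ (h : a * (b * c) = d * (e * f)) (s : 𝔸) :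
    a * (b * (c * s)) = d * (e * (f * s)) := by
  rw [← mul_assoc b, ← mul_assoc, h, mul_assoc, mul_assoc]

end Reassoc

/-! ### One color: crossings with a thin strand, from merge-split -/

section SameColor

variable (R : SuperPresentation k (webSig P D)) [HasFinRel R] (L N : Comps P) (i : P.I)
  (x y z w : ℕ)

/-- The thin strand must end in one of the two legs, so two summands of the merge-split relation
survive: `t = w`, where it stays on the right, and `t = w + 1`, where it is crossed over to the
left. -/
theorem merge_split_one_right :
    R.lay L (Mg i (z + w + 1) 1) N * R.lay L (Sp i (z + 1) (w + 1)) N =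
      R.lay L (Sp i (z + 1) w) (strand i 1 * N) * R.lay (L ◂ strand i (z + 1)) (Mg i w 1) N +
      R.lay L (Sp i z (w + 1)) (strand i 1 * N) * (R.lay (L ◂ strand i z) (Cr i (w + 1) i 1) N *
        R.lay L (Mg i z 1) (strand i (w + 1) * N)) := by
  rw [merge_split R L N i _ _ _ _ (by omega), Finset.sum_eq_add w (w + 1) (by omega)]
  · rw [if_pos (by omega), if_pos (by omega), mergeSplitTerm, mergeSplitTerm,
      show z + 1 + w - (z + w + 1) = 0 by omega, show w + 1 - w = 1 by omega,
      show z + w + 1 - w = z + 1 by omega, show z + 1 + (w + 1) - (z + w + 1) = 1 by omega,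
      show w + 1 - (w + 1) = 0 by omega, show z + w + 1 - (w + 1) = z by omega]
    simp only [lay_Sp_zero_left, lay_Sp_zero_right, lay_Mg_zero_left, lay_Mg_zero_right,
      lay_Cr_zero_right, strand_zero, snoc_one, one_mul, snoc_mul_eq, idn_mul_lay, lay_mul_idn,
      idn_mul_lay_mul, lay_mul_idn_mul, mul_assoc, snoc_mul]
    rw [idn_mul_lay_mul _ (by simp only [show z + 1 + w = z + w + 1 by omega]),
      idn_mul_lay_mul _ (by simp only [show z + (w + 1) = z + w + 1 by omega])]
  · intro t ht h
    rw [if_neg (by omega)]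
  · intro h
    exact absurd (Finset.mem_range.mpr (by omega)) h
  · intro h
    exact absurd (Finset.mem_range.mpr (by omega)) h

theorem merge_split_one_left :
    R.lay L (Mg i 1 (z + w + 1)) N * R.lay L (Sp i (z + 1) (w + 1)) N =
      R.lay (L ◂ strand i 1) (Sp i z (w + 1)) N * R.lay L (Mg i 1 z) (strand i (w + 1) * N) +
      R.lay (L ◂ strand i 1) (Sp i (z + 1) w) N * (R.lay L (Cr i 1 i (z + 1)) (strand i w * N) *
        R.lay (L ◂ strand i (z + 1)) (Mg i 1 w) N) := by
  rw [merge_split R L N i _ _ _ _ (by omega), Finset.sum_range_succ, Finset.sum_range_one,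
    if_pos (by omega), if_pos (by omega), mergeSplitTerm, mergeSplitTerm,
    show z + 1 + 0 - 1 = z by omega, show z + 1 + 1 - 1 = z + 1 by omega]
  simp only [lay_Sp_zero_left, lay_Sp_zero_right, lay_Mg_zero_left, lay_Mg_zero_right,
    lay_Cr_zero_left, strand_zero, snoc_one, one_mul, snoc_mul_eq, idn_mul_lay, lay_mul_idn,
    idn_mul_lay_mul, lay_mul_idn_mul, mul_assoc, snoc_mul, Nat.sub_zero, Nat.sub_self,
    Nat.add_sub_cancel]
  rw [lay_mul_idn _ (by simp only [snoc_mul_eq, show 1 + w = w + 1 by omega])]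

theorem merge_split_thin_right :
    R.lay L (Mg i (x + 1) 1) N * R.lay L (Sp i (x + 1) 1) N =
      R.idn (L * (strand i (x + 1) * (strand i 1 * N))) +
      R.lay L (Sp i x 1) (strand i 1 * N) * (R.lay (L ◂ strand i x) (Cr i 1 i 1) N *
        R.lay L (Mg i x 1) (strand i 1 * N)) := by
  have h := merge_split_one_right R L N i x 0
  simpa only [lay_Sp_zero_right, lay_Mg_zero_left, snoc_mul_eq, idn_mul_idn, zero_add,
    add_zero] using h

theorem merge_split_thin_left :
    R.lay L (Mg i 1 (x + 1)) N * R.lay L (Sp i 1 (x + 1)) N =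
      R.idn (L * (strand i 1 * (strand i (x + 1) * N))) +
      R.lay (L ◂ strand i 1) (Sp i 1 x) N * (R.lay L (Cr i 1 i 1) (strand i x * N) *
        R.lay (L ◂ strand i 1) (Mg i 1 x) N) := by
  have h := merge_split_one_left R L N i 0 x
  simpa only [lay_Sp_zero_left, lay_Mg_zero_right, snoc_mul_eq, idn_mul_idn, zero_add,
    add_zero] using h

/-- This can be solved for the crossing, so a crossing of one color with a thin strand can be traded
for splits and merges. -/
theorem merge_split_cross_right :
    R.lay L (Mg i (x + 1) 1) N * R.lay L (Sp i 1 (x + 1)) N =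
      R.lay L (Sp i 1 x) (strand i 1 * N) * R.lay (L ◂ strand i 1) (Mg i x 1) N +
        R.lay L (Cr i (x + 1) i 1) N := by
  have h := merge_split_one_right R L N i 0 x
  simpa only [lay_Sp_zero_left, lay_Mg_zero_left, snoc_mul_eq, strand_zero, snoc_one, idn_mul_lay,
    lay_mul_idn, idn_mul_lay_mul, lay_mul_idn_mul, zero_add, one_mul, mul_assoc] using h

theorem merge_split_one_one :
    R.lay L (Mg i 1 1) N * R.lay L (Sp i 1 1) N =
      R.idn (L * (strand i 1 * (strand i 1 * N))) + R.lay L (Cr i 1 i 1) N := by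
  have h := merge_split_cross_right R L N i 0
  simpa only [lay_Sp_zero_right, lay_Mg_zero_left, snoc_mul_eq, idn_mul_idn, zero_add] using h

/-- The crossing is the merge-split diagram minus the identity; against the merge, the first gives
the factor 2 of a knothole, and 2 - 1 = 1. -/
theorem cross_merge_one_one :
    R.lay L (Cr i 1 i 1) N * R.lay L (Mg i 1 1) N = R.lay L (Mg i 1 1) N := by
  have h : R.lay L (Cr i 1 i 1) N = R.lay L (Mg i 1 1) N * R.lay L (Sp i 1 1) N -
      R.idn (L * (strand i 1 * (strand i 1 * N))) := by
    rw [merge_split_one_one]; abel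
  rw [h, sub_mul, mul_assoc, knothole, mul_smul_comm, lay_mul_idn _ rfl,
    idn_mul_lay _ (by simp only [mul_assoc])]
  norm_num [two_smul]

theorem split_cross_one_one :
    R.lay L (Sp i 1 1) N * R.lay L (Cr i 1 i 1) N = R.lay L (Sp i 1 1) N := by
  have h : R.lay L (Cr i 1 i 1) N = R.lay L (Mg i 1 1) N * R.lay L (Sp i 1 1) N -
      R.idn (L * (strand i 1 * (strand i 1 * N))) := by
    rw [merge_split_one_one]; abel
  rw [h, mul_sub, ← mul_assoc, knothole, smul_mul_assoc, idn_mul_lay (Sp i 1 1) rfl,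
    lay_mul_idn _ (by simp only [mul_assoc])]
  norm_num [two_smul]

theorem cross_cross_one_one_self :
    R.lay L (Cr i 1 i 1) N * R.lay L (Cr i 1 i 1) N =
      R.idn (L * (strand i 1 * (strand i 1 * N))) := by
  have h : R.lay L (Cr i 1 i 1) N = R.lay L (Mg i 1 1) N * R.lay L (Sp i 1 1) N -
      R.idn (L * (strand i 1 * (strand i 1 * N))) := by
    rw [merge_split_one_one]; abel
  nth_rewrite 2 [h]
  rw [mul_sub, ← mul_assoc, cross_merge_one_one, merge_split_one_one,
    lay_mul_idn _ (by simp only [mul_assoc]), add_sub_cancel_right]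

/-- Once the thick crossings have been traded for splits and merges, coassociativity and the thin
cases of merge-split match all terms. -/
theorem split_cross_right_thin :
    R.lay L (Cr i (x + 1) i 1) N * R.lay (L ◂ strand i 1) (Sp i x 1) N =
      R.lay L (Sp i x 1) (strand i 1 * N) * (R.lay (L ◂ strand i x) (Cr i 1 i 1) N *
        R.lay L (Cr i x i 1) (strand i 1 * N)) := by
  cases x with
  | zero =>
    simp only [lay_Sp_zero_left, lay_Cr_zero_left, strand_zero, snoc_one, one_mul, snoc_mul_eq,
      lay_mul_idn, idn_mul_lay, mul_assoc, zero_add]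
  | succ x =>
    have hC : ∀ x L N, R.lay L (Cr i (x + 1) i 1) N =
        R.lay L (Mg i (x + 1) 1) N * R.lay L (Sp i 1 (x + 1)) N -
          R.lay L (Sp i 1 x) (strand i 1 * N) * R.lay (L ◂ strand i 1) (Mg i x 1) N := by
      intro x L N
      rw [merge_split_cross_right, add_sub_cancel_left]
    have a1 := split_assoc R L N i 1 (x + 1) 1
    have a2 := split_assoc R L (strand i 1 * N) i 1 x 1
    rw [show 1 + (x + 1) = x + 1 + 1 by omega] at a1
    rw [show 1 + x = x + 1 by omega] at a2
    have f1 := lay_far (Sp i 1 x) (Cr i 1 i 1) L 1 N (R := R)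
    simp only [snoc_mul, mul_assoc, mul_one, one_mul, show 1 + x = x + 1 by omega] at f1
    rw [hC (x + 1) L N, sub_mul, mul_assoc, ← a1, reassoc (merge_split_thin_right ..), mul_assoc,
      merge_split_thin_right]
    simp only [add_mul, mul_add, mul_assoc, snoc_mul_eq]
    rw [merge_split_cross_right R L (strand i 1 * N) i x]
    simp only [mul_add]
    rw [idn_mul_lay _ (by simp only [mul_assoc, Nat.add_comm 1 (x + 1)]),
      lay_mul_idn _ (by simp only [mul_assoc]), reassoc₂ a2.symm, reassoc₂ f1]
    abel

theorem merge_cross_right_thin :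
    R.lay L (Mg i 1 x) (strand i 1 * N) * R.lay L (Cr i (x + 1) i 1) N =
      R.lay (L ◂ strand i 1) (Cr i x i 1) N * (R.lay L (Cr i 1 i 1) (strand i x * N) *
        R.lay (L ◂ strand i 1) (Mg i 1 x) N) := by
  cases x with
  | zero =>
    simp only [lay_Mg_zero_right, lay_Cr_zero_left, strand_zero, snoc_one, one_mul, snoc_mul_eq,
      lay_mul_idn, idn_mul_lay, mul_assoc, zero_add]
  | succ x =>
    have hC : R.lay L (Cr i (x + 1 + 1) i 1) N =
        R.lay L (Mg i (x + 1 + 1) 1) N * R.lay L (Sp i 1 (x + 1 + 1)) N -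
          R.lay L (Sp i 1 (x + 1)) (strand i 1 * N) *
            R.lay (L ◂ strand i 1) (Mg i (x + 1) 1) N := by
      rw [merge_split_cross_right, add_sub_cancel_left]
    have a1 := merge_assoc R L N i 1 (x + 1) 1
    have a2 := merge_assoc R (L ◂ strand i 1) N i 1 x 1
    rw [show 1 + (x + 1) = x + 1 + 1 by omega] at a1
    rw [show 1 + x = x + 1 by omega] at a2
    have f1 := lay_far (Cr i 1 i 1) (Mg i x 1) L 1 N (R := R)
    simp only [snoc_mul, mul_assoc, mul_one, one_mul] at f1
    rw [hC, mul_sub, reassoc a1, mul_assoc, merge_split_thin_left,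
      reassoc (merge_split_thin_left ..)]
    simp only [add_mul, mul_add, mul_assoc, snoc_mul_eq]
    rw [reassoc (merge_split_cross_right R (L ◂ strand i 1) N i x)]
    simp only [add_mul, mul_assoc]
    rw [idn_mul_lay _ (by simp only [mul_assoc, snoc_mul_eq]),
      lay_mul_idn _ (by simp only [mul_assoc, snoc_mul_eq]),
      reassoc₂ f1.symm, a2]
    abel

/-- For thickness `x + 1`, trading the crossing for splits and merges leaves two knotholes with
factors `x + 2` and `x + 1`; their difference is one. -/
theorem cross_merge_thin :
    R.lay L (Cr i x i 1) N * R.lay L (Mg i 1 x) N = R.lay L (Mg i x 1) N := by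
  cases x with
  | zero =>
    simp only [lay_Mg_zero_right, lay_Mg_zero_left, lay_Cr_zero_left, idn_mul_idn]
  | succ x =>
    have hC : R.lay L (Cr i (x + 1) i 1) N =
        R.lay L (Mg i (x + 1) 1) N * R.lay L (Sp i 1 (x + 1)) N -
          R.lay L (Sp i 1 x) (strand i 1 * N) *
            R.lay (L ◂ strand i 1) (Mg i x 1) N := by
      rw [merge_split_cross_right, add_sub_cancel_left]
    have a1 := merge_assoc R L N i 1 x 1
    rw [show 1 + x = x + 1 by omega] at a1
    rw [hC, sub_mul, mul_assoc, mul_assoc, ← a1, knothole, reassoc (knothole ..), smul_mul_assoc,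
      mul_smul_comm, idn_mul_lay _ (by simp only [mul_assoc, Nat.add_comm 1 x]),
      lay_mul_idn _ (by simp only [Nat.add_comm 1 (x + 1)]), Nat.choose_one_right,
      Nat.choose_one_right]
    push_cast
    module

-- A split below the merge closes a knothole, whose binomial coefficient is invertible in
-- characteristic zero. Hence an identity of diagrams that start on a thick strand may be tested
-- with a merge below it.
variable {L N i x y} in
theorem merge_cancel [CharZero k] {a b : R.DiagAlg}
    (ha : R.idn (L * (strand i (x + y) * N)) * a = a)
    (hb : R.idn (L * (strand i (x + y) * N)) * b = b)
    (h : R.lay L (Mg i x y) N * a = R.lay L (Mg i x y) N * b) : a = b := by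
  have h0 : ((x + y).choose x : k) ≠ 0 :=
    Nat.cast_ne_zero.mpr (Nat.choose_pos (Nat.le_add_right x y)).ne'
  have := congrArg (R.lay L (Sp i x y) N * ·) h
  simp only [reassoc (knothole R L N i x y), smul_mul_assoc, ha, hb] at this
  exact smul_right_injective _ h0 this

variable {L N i x y} in
theorem split_cancel [CharZero k] {a b : R.DiagAlg}
    (ha : a * R.idn (L * (strand i (x + y) * N)) = a)
    (hb : b * R.idn (L * (strand i (x + y) * N)) = b)
    (h : a * R.lay L (Sp i x y) N = b * R.lay L (Sp i x y) N) : a = b := by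
  have h0 : ((x + y).choose x : k) ≠ 0 :=
    Nat.cast_ne_zero.mpr (Nat.choose_pos (Nat.le_add_right x y)).ne'
  have := congrArg (· * R.lay L (Mg i x y) N) h
  simp only [mul_assoc, knothole R L N i x y, mul_smul_comm, ha, hb] at this
  exact smul_right_injective _ h0 this

/-- Induction on `x`: `merge_cancel` exposes the leftmost thin strand, to which
`merge_cross_right_thin` applies. -/
theorem merge_cross_right_one [CharZero k] :
    R.lay L (Mg i x y) (strand i 1 * N) * R.lay L (Cr i (x + y) i 1) N =
      R.lay (L ◂ strand i x) (Cr i y i 1) N * (R.lay L (Cr i x i 1) (strand i y * N) *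
        R.lay (L ◂ strand i 1) (Mg i x y) N) := by
  induction x generalizing L with
  | zero =>
    simp only [lay_Mg_zero_left, lay_Cr_zero_left, strand_zero, snoc_one, one_mul, snoc_mul_eq,
      lay_mul_idn, idn_mul_lay, mul_assoc, zero_add, idn_mul_idn]
  | succ x ih =>
    refine merge_cancel R (L := L) (N := strand i y * (strand i 1 * N)) (i := i) (x := 1)
      (y := x) ?_ ?_ ?_
    · rw [idn_mul_lay_mul _ (by simp only [Nat.add_comm 1 x, mul_assoc])]
    · rw [idn_mul_lay_mul _ (by simp only [Nat.add_comm 1 x, mul_assoc, snoc_mul_eq])]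
    have a1 := merge_assoc R L (strand i 1 * N) i 1 x y
    have a2 := merge_assoc R (L ◂ strand i 1) N i 1 x y
    have c1 := merge_cross_right_thin R L N i (x + y)
    have c2 := merge_cross_right_thin R L (strand i y * N) i x
    have f1 := lay_far (Cr i 1 i 1) (Mg i x y) L 1 N (R := R)
    have f2 := lay_far (Mg i 1 x) (Cr i y i 1) L 1 N (R := R)
    have e1 : 1 + x = x + 1 := add_comm _ _
    have e2 : x + 1 + y = x + y + 1 := by omega
    have e3 : 1 + (x + y) = x + y + 1 := by omega
    simp only [snoc_mul, mul_assoc, mul_one, one_mul, e1, e2, e3] at a1 a2 f1 f2 ⊢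
    rw [reassoc₂ a1, c1, reassoc₂₃ (ih _), reassoc₂ f1.symm, reassoc₂ f2, reassoc₂₃ c2, a2]

theorem split_cross_right_one [CharZero k] :
    R.lay L (Cr i (x + y) i 1) N * R.lay (L ◂ strand i 1) (Sp i x y) N =
      R.lay L (Sp i x y) (strand i 1 * N) * (R.lay (L ◂ strand i x) (Cr i y i 1) N *
        R.lay L (Cr i x i 1) (strand i y * N)) := by
  induction y generalizing N with
  | zero =>
    simp only [lay_Sp_zero_right, lay_Cr_zero_left, strand_zero, snoc_one, one_mul, snoc_mul_eq,
      lay_mul_idn, idn_mul_lay, mul_assoc, add_zero, idn_mul_idn]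
  | succ y ih =>
    refine split_cancel R (L := L ◂ strand i 1 ◂ strand i x) (N := N) (i := i) (x := y)
      (y := 1) ?_ ?_ ?_
    · rw [mul_assoc, lay_mul_idn _ (by simp only [mul_assoc, snoc_mul_eq])]
    · rw [mul_assoc, mul_assoc, lay_mul_idn _ (by simp only [mul_assoc, snoc_mul_eq])]
    have a1 := split_assoc R (L ◂ strand i 1) N i x y 1
    have a2 := split_assoc R L (strand i 1 * N) i x y 1
    have c1 := split_cross_right_thin R L N i (x + y)
    have c2 := split_cross_right_thin R (L ◂ strand i x) N i y
    have f1 := lay_far (Sp i x y) (Cr i 1 i 1) L 1 N (R := R)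
    have f2 := lay_far (Cr i x i 1) (Sp i y 1) L 1 N (R := R)
    simp only [snoc_mul, mul_assoc, mul_one, one_mul, ← add_assoc] at a1 a2 f1 f2 ⊢
    rw [← a1, reassoc₂₃ c1, ih, reassoc₂ f1.symm, reassoc₂ a2, f2, reassoc₂₃ c2]

end SameColor

end AffineWeb

namespace AffineWeb

open FrobeniusGreatPair SuperPresentation

variable {k : Type u} [Field k] {A : Type v} [NonUnitalRing A] [Module k A] [IsScalarTower k A A]
  [SMulCommClass k A A] {P : FrobeniusGreatPair k A} {D : ℕ → Prop}

/-! ### One color: a thin merge past a strand of any thickness -/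

section SameColor

variable (R : SuperPresentation k (webSig P D)) [HasFinRel R] (L N : Comps P) (i : P.I)
  (x y z w t s : ℕ)

/-- The boundary case in which no part of the right strand goes to the left leg: the crossing inside
the summand is with an empty strand, and associativity suffices. -/
theorem merge_mul_mergeSplitTerm_zero :
    R.lay (L ◂ strand i (w + 1 + t)) (Mg i w 1) N *
      mergeSplitTerm R L N i (w + 1 + t) (w + 1) (w + 1 + t) t =
    mergeSplitTerm R L (strand i 1 * N) i (w + 1 + t) (w + 1) (w + t) t *
      R.lay (L ◂ strand i (w + 1)) (Mg i (w + t) 1) N := by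
  have a1 := merge_assoc R (L ◂ strand i (w + 1)) N i t w 1
  have f1 := lay_far (Sp i (w + 1) t) (Mg i w 1) L 1 N (R := R)
  simp only [snoc_mul, mul_assoc, mul_one, one_mul] at f1
  simp only [mergeSplitTerm, show w + 1 + t - (w + 1 + t) = 0 by omega,
    show w + t - t = w by omega, show w + 1 + t - t = w + 1 by omega, lay_Sp_zero_left,
    lay_Cr_zero_right, lay_Mg_zero_right, strand_zero, one_mul, snoc_one]
  rw [idn_mul_lay_mul (Sp i (w + 1) t)
      (by simp only [mul_assoc, snoc_mul_eq, Nat.add_assoc]),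
    idn_mul_lay_mul (Sp i (w + 1) t)
      (by simp only [mul_assoc, snoc_mul_eq, Nat.add_assoc]),
    idn_mul_lay_mul (Mg i t (w + 1)) (by simp only [mul_assoc, snoc_mul_eq]),
    idn_mul_lay_mul (Mg i t w) (by simp only [mul_assoc, snoc_mul_eq]),
    lay_mul_idn (Mg i t (w + 1))
      (by simp only [mul_assoc, snoc_mul_eq, show t + (w + 1) = w + 1 + t by omega]),
    lay_mul_idn (Mg i t w) (by simp only [mul_assoc, snoc_mul_eq, show t + w = w + t by omega]),
    mul_assoc, show w + t = t + w by omega, a1, reassoc₂ f1.symm]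

/-- Below the summand the merge with the thin strand meets a split, and `merge_split_one_right`
sends the thin strand to either leg; these are the two terms on the right. The hypothesis `h` is the
claim of `merge_cross_left_one_self` for the thinner crossing strand `t`. -/
theorem merge_mul_mergeSplitTerm_succ [CharZero k]
    (h : ∀ L N : Comps P, R.lay (L ◂ strand i t) (Mg i s 1) N * R.lay L (Cr i t i (s + 1)) N =
      R.lay L (Cr i t i s) (strand i 1 * N) * (R.lay (L ◂ strand i s) (Cr i t i 1) N *
        R.lay L (Mg i s 1) (strand i t * N))) :
    R.lay (L ◂ strand i (w + 1 + t)) (Mg i (s + w + 1) 1) N *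
      mergeSplitTerm R L N i (w + 1 + t) (s + w + 1 + 1) (w + 1 + t) t =
    mergeSplitTerm R L (strand i 1 * N) i (w + 1 + t) (s + w + 1 + 1) (w + t) t *
      R.lay (L ◂ strand i (s + w + 1 + 1)) (Mg i (w + t) 1) N +
    mergeSplitTerm R L (strand i 1 * N) i (w + 1 + t) (s + w + 1) (w + 1 + t) t *
      (R.lay (L ◂ strand i (s + w + 1)) (Cr i (w + 1 + t) i 1) N *
        R.lay L (Mg i (s + w + 1) 1) (strand i (w + 1 + t) * N)) := by
  simp only [mergeSplitTerm, show s + w + 1 + 1 + t - (w + 1 + t) = s + 1 by omega,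
    show w + t - t = w by omega, show w + 1 + t - t = w + 1 by omega,
    show s + w + 1 + t - (w + 1 + t) = s by omega]
  have b1 := merge_split_one_right R (L ◂ strand i (w + 1 + t)) N i s w
  rw [show s + w + 1 = s + (w + 1) by omega] at b1 ⊢
  rw [reassoc b1]
  simp only [add_mul, mul_assoc]
  congr 1
  · have a1 := merge_assoc R (L ◂ strand i (w + 1) ◂ strand i (s + 1)) N i t w 1
    have f1 := lay_far (Sp i (w + 1) t) (Mg i w 1) L (strand i (s + 1)) N (R := R)
    have f2 := lay_far (Cr i t i (s + 1)) (Mg i w 1) (L ◂ strand i (w + 1)) 1 N (R := R)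
    have f3 := lay_far (Mg i (w + 1) (s + 1)) (Mg i (w + t) 1) L 1 N (R := R)
    simp only [snoc_mul, mul_assoc, mul_one, one_mul] at f1 f2 f3
    rw [reassoc₂ f1.symm, reassoc₂ f2.symm, show s + (w + 1) + 1 = w + 1 + (s + 1) by omega, f3,
      show w + t = t + w by omega, reassoc₂ a1, show w + 1 + t = t + w + 1 by omega]
  · have a1 := merge_assoc R L (strand i (w + 1 + t) * N) i (w + 1) s 1
    have c1 := merge_cross_right_one R (L ◂ strand i (w + 1) ◂ strand i s) N i t (w + 1)
    have f1 := lay_far (Mg i (w + 1) s) (Cr i (t + (w + 1)) i 1) L 1 N (R := R)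
    have f2 := lay_far (Mg i s 1) (Mg i t (w + 1)) (L ◂ strand i (w + 1)) 1 N (R := R)
    have f3 := lay_far (Sp i (w + 1) t) (Mg i s 1) L 1 (strand i (w + 1) * N) (R := R)
    have f4 := lay_far (Sp i (w + 1) t) (Cr i (w + 1) i 1) L (strand i s) N (R := R)
    have f5 := lay_far (Cr i t i s) (Cr i (w + 1) i 1) (L ◂ strand i (w + 1)) 1 N (R := R)
    simp only [snoc_mul, mul_assoc, mul_one, one_mul] at f1 f2 f3 f4 f5
    rw [show t + (w + 1) = w + 1 + t by omega] at c1 f1 f2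
    rw [reassoc₂ f3.symm, reassoc₂₃ (h _ _), reassoc₂ f2, ← a1,
      show s + (w + 1) = w + 1 + s by omega, reassoc₂ f1, reassoc₂₃ c1, reassoc₂ f5, reassoc₂ f4]

/-- Associativity of merges, followed by a split, is expanded by merge-split on both sides. The
summand in which the whole left strand crosses gives the claim; all others involve crossings of
thinner strands and cancel by strong induction. -/
theorem merge_cross_left_one_self [CharZero k] :
    R.lay (L ◂ strand i x) (Mg i y 1) N * R.lay L (Cr i x i (y + 1)) N =
      R.lay L (Cr i x i y) (strand i 1 * N) * (R.lay (L ◂ strand i y) (Cr i x i 1) N *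
        R.lay L (Mg i y 1) (strand i x * N)) := by
  induction x using Nat.strong_induction_on generalizing y L N with
  | _ x ih =>
  rcases x with _ | x
  · simp only [lay_Cr_zero_left, strand_zero, snoc_one, one_mul, snoc_mul_eq, idn_mul_idn_mul,
      mul_assoc]
    rw [lay_mul_idn (Mg i y 1) (by simp only []),
      idn_mul_lay (Mg i y 1) (by simp only [mul_assoc])]
  have a1 := merge_assoc R L N i (x + 1) y 1
  have b1 := merge_split_one_right R L N i y x
  have e1 := merge_split R L N i (x + 1) (y + 1) (y + 1) (x + 1) (by omega)
  have e2 := merge_split R L (strand i 1 * N) i (x + 1) y (y + 1) x (by omega)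
  have e3 := merge_split R L (strand i 1 * N) i (x + 1) y y (x + 1) (by omega)
  -- These thicknesses of the split are chosen so that the top summand is exactly the crossing of `x
  -- + 1` with `y + 1`.
  have key := congrArg (· * R.lay L (Sp i (y + 1) (x + 1)) N) a1
  simp only [mul_assoc] at key
  rw [show x + 1 + y = y + x + 1 by omega, b1, e1, mul_add, reassoc e2, reassoc e3] at key
  simp only [Finset.sum_range_succ _ (x + 1), mul_add, add_mul] at key
  -- The summands below the top one match term by term; comparing `y` with `x - t` decides which
  -- guards hold.
  have hx : ∀ t ∈ Finset.range (x + 1),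
      R.lay (L ◂ strand i (x + 1)) (Mg i y 1) N *
        (if t ≤ x + 1 ∧ x + 1 ≤ y + 1 + t then
          mergeSplitTerm R L N i (x + 1) (y + 1) (x + 1) t else 0) =
      (if t ≤ x ∧ x + 1 ≤ y + 1 + t then
          mergeSplitTerm R L (strand i 1 * N) i (x + 1) (y + 1) x t else 0) *
        R.lay (L ◂ strand i (y + 1)) (Mg i x 1) N +
      (if t ≤ x + 1 ∧ x + 1 ≤ y + t then
          mergeSplitTerm R L (strand i 1 * N) i (x + 1) y (x + 1) t else 0) *
        (R.lay (L ◂ strand i y) (Cr i (x + 1) i 1) N *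
          R.lay L (Mg i y 1) (strand i (x + 1) * N)) := by
    intro t ht
    rw [Finset.mem_range] at ht
    obtain ⟨w, rfl⟩ : ∃ w, x = w + t := ⟨x - t, by omega⟩
    rw [show w + t + 1 = w + 1 + t by omega] at *
    rcases lt_trichotomy y w with h | rfl | h
    · rw [if_neg (by omega), if_neg (by omega), if_neg (by omega), mul_zero, zero_mul, zero_mul,
        add_zero]
    · rw [if_pos (by omega), if_pos (by omega), if_neg (by omega), zero_mul, add_zero,
        merge_mul_mergeSplitTerm_zero]
    · obtain ⟨s, rfl⟩ : ∃ s, y = s + w + 1 := ⟨y - w - 1, by omega⟩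
      rw [if_pos (by omega), if_pos (by omega), if_pos (by omega)]
      exact merge_mul_mergeSplitTerm_succ R L N i w t s fun L N => ih t (by omega) L N s
  rw [Finset.mul_sum, Finset.sum_congr rfl hx, Finset.sum_add_distrib, Finset.sum_mul,
    Finset.sum_mul, if_neg (by omega), if_pos (by omega), if_pos (by omega), zero_mul, add_zero,
    add_assoc, add_right_inj, add_right_inj] at key
  simpa only [mergeSplitTerm, Nat.sub_self, Nat.add_sub_cancel, lay_Sp_zero_left,
    lay_Sp_zero_right, lay_Mg_zero_left, lay_Mg_zero_right, strand_zero, snoc_one, one_mul,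
    mul_assoc, snoc_mul_eq, idn_mul_lay, idn_mul_lay_mul, lay_mul_idn,
      lay_mul_idn_mul] using key.symm

end SameColor

/-! ### Intertwining relations for arbitrary colors -/

section AnyColor

variable (R : SuperPresentation k (webSig P D)) [HasFinRel R] [CharZero k] (L N : Comps P)
  (i j : P.I) (x y z : ℕ)

theorem merge_cross_right :
    R.lay L (Mg i x y) (strand j 1 * N) * R.lay L (Cr i (x + y) j 1) N =
      R.lay (L ◂ strand i x) (Cr i y j 1) N * (R.lay L (Cr i x j 1) (strand i y * N) *
        R.lay (L ◂ strand j 1) (Mg i x y) N) := by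
  rcases eq_or_ne i j with rfl | h
  · exact merge_cross_right_one R L N i x y
  · exact merge_cross_right_of_ne R L N x y 1 h

theorem split_cross_right_thin_strand :
    R.lay L (Cr i (x + y) j 1) N * R.lay (L ◂ strand j 1) (Sp i x y) N =
      R.lay L (Sp i x y) (strand j 1 * N) * (R.lay (L ◂ strand i x) (Cr i y j 1) N *
        R.lay L (Cr i x j 1) (strand i y * N)) := by
  rcases eq_or_ne i j with rfl | h
  · exact split_cross_right_one R L N i x y
  · exact split_cross_right_of_ne R L N x y 1 h

theorem merge_cross_left :
    R.lay (L ◂ strand i x) (Mg j y 1) N * R.lay L (Cr i x j (y + 1)) N =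
      R.lay L (Cr i x j y) (strand j 1 * N) * (R.lay (L ◂ strand j y) (Cr i x j 1) N *
        R.lay L (Mg j y 1) (strand i x * N)) := by
  rcases eq_or_ne j i with rfl | h
  · exact merge_cross_left_one_self R L N j x y
  · exact merge_cross_left_of_ne R L N y 1 x h

/-- Induction on `z`: a thin strand is peeled off the right strand by `merge_cancel`, and
`merge_cross_left` takes the crossing apart. -/
theorem split_cross_right :
    R.lay L (Cr i (x + y) j z) N * R.lay (L ◂ strand j z) (Sp i x y) N =
      R.lay L (Sp i x y) (strand j z * N) * (R.lay (L ◂ strand i x) (Cr i y j z) N *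
        R.lay L (Cr i x j z) (strand i y * N)) := by
  induction z generalizing L N with
  | zero =>
    simp only [lay_Cr_zero_right, strand_zero, snoc_one, one_mul, snoc_mul_eq, idn_mul_idn]
    rw [idn_mul_lay (Sp i x y) rfl, lay_mul_idn (Sp i x y) (by simp only [mul_assoc])]
  | succ z ih =>
    refine merge_cancel R (L := L ◂ strand i (x + y)) (N := N) (i := j) (x := z) (y := 1) ?_ ?_ ?_
    · rw [idn_mul_lay_mul (Cr i (x + y) j (z + 1)) (by simp only [snoc_mul_eq, mul_assoc])]
    · rw [idn_mul_lay_mul (Sp i x y) (by simp only [snoc_mul_eq])]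
    have c1 := merge_cross_left R L N i j (x + y) z
    have c2 := merge_cross_left R (L ◂ strand i x) N i j y z
    have c3 := merge_cross_left R L (strand i y * N) i j x z
    have s1 := split_cross_right_thin_strand R (L ◂ strand j z) N i j x y
    have s2 := ih L (strand j 1 * N)
    have f1 := lay_far (Mg j z 1) (Sp i x y) L 1 N (R := R)
    have f2 := lay_far (Sp i x y) (Mg j z 1) L 1 N (R := R)
    have f3 := lay_far (Cr i x j z) (Cr i y j 1) L 1 N (R := R)
    simp only [snoc_mul, mul_assoc, mul_one, one_mul] at f1 f2 f3
    rw [reassoc₂₃ c1, f1, reassoc₂₃ s1, reassoc₂₃ s2, reassoc₂ f2.symm, reassoc₂₃ c2, c3,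
      reassoc₂ f3]

theorem cross_merge_thin_left (i : P.I) :
    R.lay L (Cr i 1 i y) N * R.lay L (Mg i y 1) N = R.lay L (Mg i 1 y) N := by
  induction y generalizing N with
  | zero => simp only [lay_Cr_zero_right, lay_Mg_zero_right, lay_Mg_zero_left, idn_mul_idn]
  | succ y ih =>
    refine merge_cancel R (L := L ◂ strand i 1) (N := N) (i := i) (x := y) (y := 1) ?_ ?_ ?_
    · rw [idn_mul_lay_mul (Cr i 1 i (y + 1)) (by simp only [snoc_mul_eq, mul_assoc])]
    · rw [idn_mul_lay (Mg i 1 (y + 1)) (by simp only [snoc_mul_eq, mul_assoc])]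
    have c1 := merge_cross_left R L N i i 1 y
    have a1 := merge_assoc R L N i y 1 1
    have a2 := merge_assoc R L N i 1 y 1
    rw [show 1 + y = y + 1 by omega] at a2
    rw [reassoc₂₃ c1, a1, reassoc (cross_merge_one_one ..), ← a1, reassoc (ih _), a2]

end AnyColor

end AffineWeb

namespace SuperPresentation

/-! ### Exchange of heights with signs -/

section SuperInterchange

variable {k : Type w} [CommRing k] {M : Type u} [Monoid M] {G : SuperSignature.{u, v} M}
  {R : SuperPresentation k G}

theorem neg_one_pow_mul_self (p q : ZMod 2) :
    ((-1 : k) ^ (p.val * q.val)) * (-1) ^ (p.val * q.val) = 1 := by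
  rw [← mul_pow, neg_one_mul, neg_neg, one_pow]

theorem lay_far_super (a b : Tile k G) (L Z N : M) {p q : ZMod 2} (ha : a.expr.HasParity p)
    (hb : b.expr.HasParity q) :
    R.lay L a (Z * (b.src * N)) * R.lay (L ◂ (a.tgt * Z)) b N =
      ((-1 : k) ^ (p.val * q.val)) •
        (R.lay (L ◂ (a.src * Z)) b N * R.lay L a (Z * (b.tgt * N))) := by
  obtain ⟨X, Y, f⟩ := a
  obtain ⟨X', Y', g⟩ := b
  dsimp only at ha hb ⊢
  have h1 : WExpr.Eqv R (((f ⊗ₑ .id Z) ⊗ₑ .id X') ≫ₑ (.id (Y * Z) ⊗ₑ g))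
      (((f ⊗ₑ .id Z) ⊗ₑ g).smul ((-1) ^ (q.val * p.val))) :=
    .trans (.interchange _ _ _ _ hb (by simpa using ha.tensor (.id Z)))
      (.smul_congr _ (.tensor_congr (.comp_id _) (.id_comp _)))
  have h2 := layE_congr h1 L N
  simp only [layE_comp, layE_smul, layE_tensor_snoc, layE_id] at h2
  simp only [layE_eq_lay, mul_assoc, snoc_mul_eq, snoc_mul, idn_mul_lay, idn_mul_lay_mul,
    lay_mul_idn, mul_comm q.val] at h2 ⊢
  exact h2

end SuperInterchange

end SuperPresentation

namespace AffineWeb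

open FrobeniusGreatPair SuperPresentation

variable {k : Type u} [Field k] {A : Type v} [NonUnitalRing A] [Module k A] [IsScalarTower k A A]
  [SMulCommClass k A A] {P : FrobeniusGreatPair k A} {D : ℕ → Prop}

/-! ### Words of thin coupons on an exploded strand -/

section Word

variable {i j : P.I} {α : Type*} {par : α → ZMod 2} {v : α → A}
  (hv : ∀ a, IsCoupon P 1 j i (par a) (v a))

/-- Split a strand into thin strands, put the coupons given by a word on them, from right to left,
and merge. -/
def word : (l : List α) → Dia P D (strand i l.length) (strand j l.length)
  | [] => WExpr.id 1
  | a :: l => split i l.length 1 ≫ₑ (word l ⊗ₑ coupon 1 j i (par a) (v a) (hv a)) ≫ₑ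
      merge j l.length 1

/-- the diagram of a word -/
abbrev Wd (l : List α) : Tile k (webSig P D) := ⟨_, _, word hv l⟩

theorem hasParity_word (l : List α) : (word hv l : Dia P D _ _).HasParity (l.map par).sum := by
  induction l with
  | nil => exact .id 1
  | cons a l ih =>
    rw [List.map_cons, List.sum_cons, add_comm]
    exact hasParity_comp (hasParity_split ..) (comp_hasParity
      (ih.tensor (hasParity_coupon_pos Nat.one_pos _ _ (hv a))) (hasParity_merge ..))

variable (R : SuperPresentation k (webSig P D)) (L N : Comps P)

theorem lay_word_nil : R.lay L (Wd hv []) N = R.idn (L * N) :=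
  (layE_eq_lay _ _ _).symm.trans ((layE_id L 1 N).trans (by rw [one_mul]))

theorem lay_word_cons (a : α) (l : List α) :
    R.lay L (Wd hv (a :: l)) N = R.lay L (Sp i l.length 1) N *
      (R.lay (L ◂ strand i l.length) (Cp 1 j i (par a) (v a) (hv a)) N *
        (R.lay L (Wd hv l) (strand j 1 * N) * R.lay L (Mg j l.length 1) N)) := by
  have h : R.lay L (Wd hv (a :: l)) N = R.layE L (word hv (a :: l)) N := (layE_eq_lay _ _ _).symm
  rw [h, word, layE_comp, layE_comp, layE_tensor_snoc, mul_assoc]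
  simp only [layE_eq_lay]
  rfl

variable [HasFinRel R]

/-- Letters are placed from right to left, so the prefix `u` occupies the right-hand strands;
coassociativity and associativity regroup them. -/
theorem lay_word_append (u w : List α) :
    R.lay L (Wd hv (u ++ w)) N = R.lay L (Sp i w.length u.length) N *
      (R.lay (L ◂ strand i w.length) (Wd hv u) N *
        (R.lay L (Wd hv w) (strand j u.length * N) * R.lay L (Mg j w.length u.length) N)) := by
  induction u generalizing N with
  | nil =>
    simp only [List.nil_append, List.length_nil, lay_Sp_zero_right, lay_Mg_zero_right,
      lay_word_nil, strand_zero, one_mul, snoc_mul_eq]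
    rw [idn_mul_idn_mul, idn_mul_lay_mul (Wd hv w) (by simp only []),
      lay_mul_idn (Wd hv w) (by simp only [])]
  | cons a u ih =>
    have a1 := split_assoc R L N i w.length u.length 1
    have a2 := merge_assoc R L N j w.length u.length 1
    have f1 := lay_far (Sp i w.length u.length) (Cp 1 j i (par a) (v a) (hv a)) L 1 N (R := R)
    have f2 := lay_far' (Wd hv w) (Mg j u.length 1) L 1 N (R := R)
    simp only [snoc_mul, mul_assoc, mul_one, one_mul] at f1 f2
    rw [List.cons_append, lay_word_cons, ih, lay_word_cons, List.length_append,
      add_comm u.length, List.length_cons]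
    simp only [mul_assoc]
    rw [reassoc₂ f1.symm, reassoc₂ a1, a2, reassoc₂ f2.symm]

/-- A crossing can be created above a thin split and absorbed by a thin merge. Sliding both coupons
through it exchanges their positions, and restoring the order of heights costs the sign. -/
theorem lay_word_swap (a b : α) (l : List α) :
    R.lay L (Wd hv (a :: b :: l)) N = ((-1 : k) ^ ((par a).val * (par b).val)) •
      R.lay L (Wd hv (b :: a :: l)) N := by
  have key : ∀ c d : α, R.lay L (Wd hv (c :: d :: l)) N =
      R.lay L (Sp i l.length (1 + 1)) N * (R.lay (L ◂ strand i l.length) (Sp i 1 1) N *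
        (R.lay (L ◂ strand i l.length ◂ strand i 1) (Cp 1 j i _ _ (hv c)) N *
          (R.lay (L ◂ strand i l.length) (Cp 1 j i _ _ (hv d)) (strand j 1 * N) *
            (R.lay (L ◂ strand i l.length) (Mg j 1 1) N *
              (R.lay L (Wd hv l) (strand j (1 + 1) * N) * R.lay L (Mg j l.length (1 + 1)) N))))) :=
                by
    intro c d
    have f1 := lay_far (Sp i l.length 1) (Cp 1 j i _ _ (hv c)) L 1 N (R := R)
    have f2 := lay_far' (Wd hv l) (Mg j 1 1) L 1 N (R := R)
    simp only [snoc_mul, mul_assoc, mul_one, one_mul] at f1 f2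
    rw [lay_word_cons, lay_word_cons, List.length_cons]
    simp only [mul_assoc]
    rw [reassoc₂ f1.symm, reassoc₂ (split_assoc R L N i l.length 1 1),
      merge_assoc R L N j l.length 1 1, reassoc₂ f2]
  have f := lay_far_super (Cp 1 j i _ _ (hv a)) (Cp 1 j i _ _ (hv b)) (L ◂ strand i l.length) 1 N
    (R := R) (hasParity_coupon_pos Nat.one_pos _ _ (hv a))
    (hasParity_coupon_pos Nat.one_pos _ _ (hv b))
  simp only [snoc_mul, mul_assoc, mul_one, one_mul] at f
  have c1 := coupon_cross_left R (L ◂ strand i l.length) N i 1 1 (hv a)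
  have c2 := coupon_cross_right R (L ◂ strand i l.length) N j 1 1 (hv b)
  rw [key, ← split_cross_one_one R (L ◂ strand i l.length) N i, mul_assoc, reassoc₂ c1.symm,
      reassoc₂ c2.symm,
    reassoc (cross_merge_one_one R (L ◂ strand i l.length) N j), reassoc f, key]
  simp only [smul_mul_assoc, mul_smul_comm, mul_assoc]

/-- Coassociativity and associativity put the two equal odd letters into one knothole of thickness
two. -/
theorem lay_word_odd (a : α) (l : List α) (ha : par a = 1) :
    R.lay L (Wd hv (a :: a :: l)) N = 0 := by
  have f1 := lay_far (Sp i l.length 1) (Cp 1 j i _ _ (hv a)) L 1 N (R := R)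
  have f2 := lay_far' (Wd hv l) (Mg j 1 1) L 1 N (R := R)
  simp only [snoc_mul, mul_assoc, mul_one, one_mul] at f1 f2
  -- The parity is a variable here because `par a` equals 1 only propositionally, and it occurs in
  -- the type of the coupon.
  have h0 : ∀ (p : ZMod 2) (hp : p = 1) (h : IsCoupon P 1 j i p (v a)) (L N : Comps P),
      R.lay L (Sp i 1 1) N * (R.lay (L ◂ strand i 1) (Cp 1 j i p (v a) h) N *
      (R.lay L (Cp 1 j i p (v a) h) (strand j 1 * N) * R.lay L (Mg j 1 1) N)) = 0 := by
    rintro p rfl h L N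
    exact odd_knothole R L N h
  have h1 := congrArg (· * (R.lay L (Wd hv l) (strand j (1 + 1) * N) *
    R.lay L (Mg j l.length (1 + 1)) N)) (h0 _ ha (hv a) (L ◂ strand i l.length) N)
  simp only [mul_assoc, zero_mul] at h1
  rw [lay_word_cons, lay_word_cons, List.length_cons]
  simp only [mul_assoc]
  rw [reassoc₂ f1.symm, reassoc₂ (split_assoc R L N i l.length 1 1),
      merge_assoc R L N j l.length 1 1, reassoc₂ f2, h1, mul_zero]

theorem lay_word_cross [CharZero k] (l : List α) (c : P.I) :
    R.lay L (Wd hv l) (strand c 1 * N) * R.lay L (Cr j l.length c 1) N =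
      R.lay L (Cr i l.length c 1) N * R.lay (L ◂ strand c 1) (Wd hv l) N := by
  induction l generalizing L N with
  | nil =>
    simp only [lay_word_nil, List.length_nil, lay_Cr_zero_left, snoc_mul_eq]
  | cons a l ih =>
    have s := split_cross_right_thin_strand R L N i c l.length 1
    have m := merge_cross_right R L N j c l.length 1
    have c1 := coupon_cross_left R (L ◂ strand i l.length) N c 1 1 (hv a)
    have f1 := lay_far (Cr i l.length c 1) (Cp 1 j i _ _ (hv a)) L 1 N (R := R)
    have f2 := lay_far' (Wd hv l) (Cr j 1 c 1) L 1 N (R := R)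
    have e1 := ih L (strand j 1 * N)
    simp only [snoc_mul, mul_assoc, mul_one, one_mul] at f1 f2 e1
    rw [lay_word_cons, lay_word_cons, List.length_cons]
    simp only [mul_assoc]
    rw [m, reassoc₂₃ s, reassoc₂ f2, reassoc₂ c1, reassoc₂ e1, reassoc₂ f1]

end Word

end AffineWeb

namespace AffineWeb

open FrobeniusGreatPair SuperPresentation

variable {k : Type u} [Field k] {A : Type v} [NonUnitalRing A] [Module k A] [IsScalarTower k A A]
  [SMulCommClass k A A] {P : FrobeniusGreatPair k A} {D : ℕ → Prop}

/-! ### Thick coupons and knots expressed by words -/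

section Knot

variable {i j : P.I} {α : Type*} {par : α → ZMod 2} {v : α → A}
  (hv : ∀ a, IsCoupon P 1 j i (par a) (v a))
  (R : SuperPresentation k (webSig P D)) (L N : Comps P)

theorem lay_word_replicate_succ (a : α) (m : ℕ) :
    R.lay L (Wd hv (List.replicate (m + 1) a)) N = R.lay L (Sp i m 1) N *
      (R.lay (L ◂ strand i m) (Cp 1 j i (par a) (v a) (hv a)) N *
        (R.lay L (Wd hv (List.replicate m a)) (strand j 1 * N) * R.lay L (Mg j m 1) N)) := by
  rw [List.replicate_succ, lay_word_cons, List.length_replicate]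

theorem lay_word_singleton (a : α) :
    R.lay L (Wd hv [a]) N = R.lay L (Cp 1 j i (par a) (v a) (hv a)) N := by
  rw [lay_word_cons, List.length_nil, lay_word_nil, lay_Sp_zero_left, lay_Mg_zero_left,
    strand_zero, snoc_one, idn_mul_idn, lay_mul_idn _ (by simp only []),
    idn_mul_lay _ (by simp only [])]

theorem lay_blow_coupon (a : α) (m : ℕ) :
    R.layE L (blow (coupon 1 j i (par a) (v a) (hv a)) m) N =
      R.lay L (Wd hv (List.replicate m a)) N := by
  induction m generalizing N with
  | zero =>
    rw [List.replicate_zero, lay_word_nil]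
    exact (layE_id L 1 N).trans (by rw [one_mul])
  | succ m ih =>
    rw [blow, layE_comp, layE_comp, layE_tensor_snoc, ih, layE_split, layE_merge, layE_coupon,
      lay_word_replicate_succ, mul_assoc]

variable [HasFinRel R]

/-- A coupon of thickness `m + 1` followed by a thin knothole is `m + 1` times itself, while moving
it onto the legs peels off a thin coupon; iteration gives the factorial. -/
theorem lay_coupon_eq_word [CharZero k] (a : α) (m : ℕ) (h : IsCoupon P m j i (par a) (v a)) :
    R.lay L (Cp m j i (par a) (v a) h) N =
      ((m.factorial : k)⁻¹) • R.lay L (Wd hv (List.replicate m a)) N := by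
  induction m generalizing N with
  | zero =>
    rw [List.replicate_zero, lay_word_nil, lay_Cp_zero, Nat.factorial_zero, Nat.cast_one, inv_one,
      one_smul]
  | succ m ih =>
    have h1 := congrArg (· * R.lay L (Mg j m 1) N) (coupon_split R L N m 1 h)
    simp only [mul_assoc, knothole, mul_smul_comm] at h1
    rw [lay_mul_idn (Cp (m + 1) j i _ _ h) (by simp only []), ih _ (h.mono (by omega)),
      Nat.choose_succ_self_right] at h1
    simp only [mul_smul_comm, smul_mul_assoc] at h1
    have h2 : ((m + 1 : ℕ) : k) ≠ 0 := Nat.cast_ne_zero.mpr (Nat.succ_ne_zero m)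
    rw [lay_word_replicate_succ, Nat.factorial_succ, Nat.cast_mul, mul_inv, mul_smul, ← h1,
      smul_smul, inv_mul_cancel₀ h2, one_smul]

open Classical in
/-- The factor between a bracket coupon and the corresponding word. -/
noncomputable def bracketCoeff (P : FrobeniusGreatPair k A) (f : A) (m : ℕ) : k :=
  if f ∈ P.𝔞 then (m.factorial : k)⁻¹ else 1

/-- A bracket with `f ∈ 𝔞` is a coupon declared even. Since `𝔞` is even, only the zero vector could
be in `𝔞` and also have odd parity; `hne` excludes it. -/
theorem lay_bracket [CharZero k] (a : α) (hne : v a ≠ 0) (m : ℕ) :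
    R.layE L (bracket j i (par a) (v a) (hv a).1 (hv a).2.1 m) N =
      bracketCoeff P (v a) m • R.lay L (Wd hv (List.replicate m a)) N := by
  unfold bracket bracketCoeff
  split_ifs with h
  · have hp : (0 : ZMod 2) = par a := by
      rcases zmod_two_cases (par a) with h0 | h0
      · rw [h0]
      · refine absurd (Submodule.disjoint_def.mp P.isCompl_parity.disjoint _ (P.𝔞_even _ h) ?_) hne
        rw [← h0]
        exact (hv a).2.1
    have : ∀ (p : ZMod 2) (hc : IsCoupon P m j i p (v a)), p = par a →
        R.layE L (coupon m j i p (v a) hc) N =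
          (m.factorial : k)⁻¹ • R.lay L (Wd hv (List.replicate m a)) N := by
      rintro p hc rfl
      rw [layE_coupon, lay_coupon_eq_word]
    exact this _ _ hp
  · rw [one_smul]
    exact lay_blow_coupon hv R L N a m

variable {n : ℕ} (c : Fin n → ℕ)

theorem length_flatMap_replicate (l : List (Fin n)) :
    (l.reverse.flatMap fun r => List.replicate (c r) r).length = (l.map c).sum := by
  rw [List.length_flatMap]
  simp [List.sum_reverse]

/-- Knots list their strands from left to right but words from right to left, hence the reversal. -/
theorem lay_knot {par : Fin n → ZMod 2} {v : Fin n → A}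
    (hv : ∀ a, IsCoupon P 1 j i (par a) (v a))
    (f : ∀ r, Dia P D (strand i (c r)) (strand j (c r))) (e : Fin n → k)
    (hf : ∀ r L N, R.layE L (f r) N = e r • R.lay L (Wd hv (List.replicate (c r) r)) N)
    (l : List (Fin n)) :
    R.layE L (knot c f l) N = (l.map e).prod •
      R.lay L (Wd hv (l.reverse.flatMap fun r => List.replicate (c r) r)) N := by
  induction l generalizing L N with
  | nil =>
    refine (layE_id L 1 N).trans ?_
    simp only [List.map_nil, List.prod_nil, one_smul, List.reverse_nil, List.flatMap_nil,
      lay_word_nil, one_mul]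
  | cons r l ih =>
    refine (layE_comp (R := R) L N (split i (c r) (l.map c).sum)
      ((f r ⊗ₑ knot c f l) ≫ₑ merge j (c r) (l.map c).sum)).trans ?_
    rw [layE_comp, layE_tensor_snoc, ih, hf, layE_split, layE_merge, List.reverse_cons,
        List.flatMap_append, List.flatMap_singleton, lay_word_append,
      length_flatMap_replicate, List.length_replicate, List.map_cons, List.prod_cons]
    simp only [smul_mul_assoc, mul_smul_comm, smul_smul, mul_assoc]

theorem lay_knotTo {par : Fin n → ZMod 2} {v : Fin n → A}
    (hv : ∀ a, IsCoupon P 1 j i (par a) (v a))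
    (f : ∀ r, Dia P D (strand i (c r)) (strand j (c r))) (e : Fin n → k)
    (hf : ∀ r L N, R.layE L (f r) N = e r • R.lay L (Wd hv (List.replicate (c r) r)) N)
    (l : List (Fin n)) (t : ℕ) (ht : (l.map c).sum = t) :
    R.layE L (knotTo c f l t) N = (l.map e).prod •
      R.lay L (Wd hv (l.reverse.flatMap fun r => List.replicate (c r) r)) N := by
  subst ht
  rw [knotTo, dif_pos rfl]
  simp only [layE_comp, layE_eqE]
  rw [lay_knot R L N c hv f e hf, smul_mul_assoc, mul_smul_comm,
    idn_mul_lay_mul _ (by simp only [length_flatMap_replicate]),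
    lay_mul_idn _ (by simp only [length_flatMap_replicate])]

end Knot

/-! ### Pairs of dual words -/

section Pairs

variable {i j : P.I} {α : Type*} {par : α → ZMod 2} {v v' : α → A}
  (hv : ∀ a, IsCoupon P 1 j i (par a) (v a)) (hv' : ∀ a, IsCoupon P 1 i j (par a) (v' a))
  (R : SuperPresentation k (webSig P D)) (L Z N : Comps P)

/-- A word on the left strand, and the mirror image of the dual word on the right strand. -/
noncomputable def wordPair (l : List α) : R.DiagAlg :=
  R.lay (L ◂ strand i l.length ◂ Z) (Wd hv' l.reverse) N *
    R.lay L (Wd hv l) (Z * (strand i l.length * N))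

/-- A coupon on the left strand and the dual coupon on the right strand. -/
noncomputable def couponPair (a : α) : R.DiagAlg :=
  R.lay (L ◂ strand i 1 ◂ Z) (Cp 1 i j (par a) (v' a) (hv' a)) N *
    R.lay L (Cp 1 j i (par a) (v a) (hv a)) (Z * (strand i 1 * N))

theorem wordPair_singleton (a : α) : wordPair hv hv' R L Z N [a] = couponPair hv hv' R L Z N a := by
  rw [wordPair, couponPair, List.reverse_singleton, lay_word_singleton, lay_word_singleton]
  rfl

variable [HasFinRel R]

/-- The first letter and its dual sit innermost. To bring both above the remaining words, each has
to exchange heights with the left word `l`, at the cost of the same sign, so the signs cancel. -/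
theorem wordPair_cons (a : α) (l : List α) :
    wordPair hv hv' R L Z N (a :: l) =
      R.lay (L ◂ strand i (l.length + 1) ◂ Z) (Sp j 1 l.length) N *
      (R.lay L (Sp i l.length 1) (Z * (strand j 1 * (strand j l.length * N))) *
      (wordPair hv hv' R L (strand i 1 * (Z * strand j 1)) N l *
      (couponPair hv hv' R (L ◂ strand j l.length) Z (strand i l.length * N) a *
      (R.lay (L ◂ strand j l.length ◂ strand j 1 ◂ Z) (Mg i 1 l.length) N *
        R.lay L (Mg j l.length 1) (Z * (strand i (l.length + 1) * N)))))) := by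
  have h1 := lay_far (Sp i l.length 1) (Mg i 1 l.length) L Z N (R := R)
  have h2 := lay_far' (Cp 1 j i _ _ (hv a)) (Mg i 1 l.length) (L ◂ strand i l.length) Z N (R := R)
  have h3 := lay_far' (Wd hv l) (Mg i 1 l.length) L (strand j 1 * Z) N (R := R)
  have h4 := lay_far (Sp i l.length 1) (Cp 1 i j _ _ (hv' a)) L Z (strand i l.length * N) (R := R)
  have h5 := lay_far (Sp i l.length 1) (Wd hv' l.reverse) L (Z * strand j 1) N (R := R)
  have h6 := lay_far_super (Wd hv l) (Cp 1 j i _ _ (hv a)) L 1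
    (Z * (strand i 1 * (strand i l.length * N))) (R := R) (hasParity_word hv l)
    (hasParity_coupon_pos Nat.one_pos _ _ (hv a))
  have h7 := lay_far_super (Wd hv l) (Cp 1 i j _ _ (hv' a)) L (strand i 1 * Z)
    (strand i l.length * N) (R := R) (hasParity_word hv l)
    (hasParity_coupon_pos Nat.one_pos _ _ (hv' a))
  simp only [snoc_mul, mul_assoc, mul_one, one_mul, add_comm 1 l.length, List.length_reverse]
    at h1 h2 h3 h4 h5 h6 h7
  rw [wordPair, List.reverse_cons, lay_word_append, lay_word_singleton, lay_word_cons]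
  simp only [wordPair, couponPair, mul_assoc, List.length_cons, List.length_reverse,
    List.length_nil, zero_add, snoc_mul]
  rw [reassoc₂ h1.symm, reassoc₂ h2.symm, reassoc₂ h3.symm, reassoc₂ h4.symm, reassoc₂ h5.symm,
    ← mul_assoc (R.lay _ (Wd hv l) _) (R.lay _ (Cp 1 i j _ _ (hv' a)) _), h7, smul_mul_assoc,
    mul_assoc, reassoc h6]
  simp only [smul_mul_assoc, mul_smul_comm, smul_smul, neg_one_pow_mul_self, one_smul, mul_assoc]

/-- A transposition of letters changes the word and its dual by the same sign. So only
multiplicities matter, and the order on the basis plays no role. -/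
theorem wordPair_perm {l l' : List α} (h : l.Perm l') :
    wordPair hv hv' R L Z N l = wordPair hv hv' R L Z N l' := by
  induction h generalizing L Z N with
  | nil => rfl
  | cons a h ih => rw [wordPair_cons, wordPair_cons, ih, h.length_eq]
  | swap a b l =>
    have h1 : ∀ L N, R.lay L (Wd hv' ((l.reverse ++ [a]) ++ [b])) N =
        ((-1 : k) ^ ((par a).val * (par b).val)) •
          R.lay L (Wd hv' ((l.reverse ++ [b]) ++ [a])) N := by
      intro L N
      rw [List.append_assoc, List.append_assoc, lay_word_append, List.singleton_append,
        lay_word_swap, lay_word_append, List.singleton_append]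
      simp only [smul_mul_assoc, mul_smul_comm, List.length_cons]
    rw [wordPair, wordPair, List.reverse_cons, List.reverse_cons, List.reverse_cons,
      List.reverse_cons, h1, lay_word_swap, mul_comm (par b).val, mul_smul_comm, smul_mul_assoc,
      smul_smul, neg_one_pow_mul_self, one_smul]
    rfl
  | trans _ _ h1 h2 => rw [h1, h2]

theorem wordPair_odd (a : α) (l : List α) (ha : par a = 1) :
    wordPair hv hv' R L Z N (a :: a :: l) = 0 := by
  rw [wordPair, lay_word_odd hv R _ _ a l ha, mul_zero]

end Pairs

end AffineWeb

namespace AffineWeb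

open FrobeniusGreatPair SuperPresentation

/-! ### Words with given multiplicities -/

section Multiplicities

variable {n : ℕ}

/-- The word with given multiplicities. -/
def wordOf (μ : Fin n → ℕ) : List (Fin n) :=
  (List.finRange n).reverse.flatMap fun r => List.replicate (μ r) r

theorem count_wordOf (μ : Fin n → ℕ) (r : Fin n) : (wordOf μ).count r = μ r := by
  have h : ∀ l : List (Fin n), l.Nodup →
      (l.flatMap fun r => List.replicate (μ r) r).count r = if r ∈ l then μ r else 0 := by
    intro l
    induction l with
    | nil => simp
    | cons a l ih =>
      intro hl
      rw [List.nodup_cons] at hl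
      rw [List.flatMap_cons, List.count_append, ih hl.2, List.count_replicate]
      by_cases h : r = a
      · subst h
        simp [hl.1]
      · simp [h, Ne.symm h]
  rw [wordOf, h _ (List.nodup_reverse.mpr (List.nodup_finRange n)), if_pos (by simp)]

theorem wordOf_add_single_perm (μ : Fin n → ℕ) (r : Fin n) :
    (wordOf (μ + Pi.single r 1)).Perm (r :: wordOf μ) := by
  rw [List.perm_iff_count]
  intro s
  rw [count_wordOf, List.count_cons, count_wordOf, Pi.add_apply]
  by_cases h : r = s
  · subst h
    simp
  · simp [h, Pi.single_apply, Ne.symm h]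

theorem length_wordOf (μ : Fin n → ℕ) : (wordOf μ).length = ∑ r, μ r := by
  rw [wordOf, length_flatMap_replicate, ← List.ofFn_eq_map, List.sum_ofFn]

theorem prod_factorial_add_single {k : Type*} [Field k] (μ : Fin n → ℕ) (r : Fin n) :
    (∏ s, ((μ + Pi.single r 1 : Fin n → ℕ) s).factorial : k) =
      ((μ r + 1 : ℕ) : k) * ∏ s, ((μ s).factorial : k) := by
  have h : ∀ s, (((μ + Pi.single r 1 : Fin n → ℕ) s).factorial : k) =
      (if s = r then ((μ r + 1 : ℕ) : k) else 1) * ((μ s).factorial : k) := by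
    intro s
    by_cases h : s = r
    · subst h
      simp [Nat.factorial_succ]
    · simp [h, Pi.single_apply]
  rw [Finset.prod_congr rfl fun s _ => h s, Finset.prod_mul_distrib, Finset.prod_ite_eq']
  simp

/-- The derivative rule for divided powers: with `ν = μ + δ_r`, the inverse product of factorials
for `μ` is `ν r` times that for `ν`, and tuples with `ν r = 0` contribute nothing. -/
theorem sum_antidiagonalTuple_succ {k M : Type*} [Field k] [CharZero k] [AddCommGroup M]
    [Module k M] (r : Fin n) (t : ℕ) (F : (Fin n → ℕ) → M) :
    ∑ μ ∈ Finset.Nat.antidiagonalTuple n t,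
        (∏ s, ((μ s).factorial : k))⁻¹ • F (μ + Pi.single r 1) =
      ∑ ν ∈ Finset.Nat.antidiagonalTuple n (t + 1),
        ((ν r : k) * (∏ s, ((ν s).factorial : k))⁻¹) • F ν := by
  refine Finset.sum_of_injOn (fun μ => μ + Pi.single r 1) (fun a _ b _ h => add_right_cancel h)
    ?_ ?_ ?_
  · intro μ hμ
    rw [Finset.mem_coe, Finset.Nat.mem_antidiagonalTuple] at hμ ⊢
    simp [Finset.sum_add_distrib, hμ]
  · intro ν hν h
    have h0 : ν r = 0 := by
      by_contra h0
      refine h ⟨ν - Pi.single r 1, ?_, ?_⟩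
      · rw [Finset.Nat.mem_antidiagonalTuple] at hν
        rw [Finset.mem_coe, Finset.Nat.mem_antidiagonalTuple]
        have h1 : ν = (ν - Pi.single r 1) + Pi.single r 1 := by
          funext s
          by_cases hs : s = r
          · subst hs
            simp only [Pi.add_apply, Pi.sub_apply, Pi.single_eq_same]
            omega
          · simp [Pi.single_apply, hs]
        rw [h1] at hν
        simp only [Pi.add_apply, Finset.sum_add_distrib, Finset.sum_pi_single',
          Finset.mem_univ, if_true] at hν
        omega
      · funext s
        by_cases hs : s = r
        · subst hs
          simp only [Pi.add_apply, Pi.sub_apply, Pi.single_eq_same]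
          omega
        · simp [Pi.single_apply, hs]
    rw [h0, Nat.cast_zero, zero_mul, zero_smul]
  · intro μ _
    have h0 : ((μ r + 1 : ℕ) : k) ≠ 0 := Nat.cast_ne_zero.mpr (Nat.succ_ne_zero _)
    rw [prod_factorial_add_single, mul_inv, ← mul_assoc, Pi.add_apply, Pi.single_eq_same,
      mul_inv_cancel₀ h0, one_mul]

end Multiplicities

variable {k : Type u} [Field k] {A : Type v} [NonUnitalRing A] [Module k A] [IsScalarTower k A A]
  [SMulCommClass k A A] {P : FrobeniusGreatPair k A} {D : ℕ → Prop}

/-! ### Thick teleporters as divided powers of thin ones -/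

section Teleporter

variable (B : P.GoodBasis) (i j : P.I)

theorem isCoupon_vec (r : Fin (B.card j i)) :
    IsCoupon P 1 j i (B.par j i r) (B.vec j i r) :=
  ⟨vec_mem_corner B j i r, B.vec_mem_parity j i r, fun h => absurd h (by omega)⟩

theorem isCoupon_dualVec (r : Fin (B.card j i)) :
    IsCoupon P 1 i j (B.par j i r) (dualVec B j i r) :=
  ⟨(dualVec_spec B j i r).1, (dualVec_spec B j i r).2.1, fun h => absurd h (by omega)⟩

/-- the teleporter -/
noncomputable abbrev Te (t : ℕ) (Z : Comps P) : Tile k (webSig P D) := ⟨_, _, teleporter B i j t Z⟩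

instance (t : ℕ) (Z : Comps P) : (Te B i j t Z : Tile k (webSig P D)).IsEven :=
  ⟨hasParity_teleporter ..⟩

variable (R : SuperPresentation k (webSig P D)) (L Z N : Comps P)

/-- The word pair of a word in the basis of `jAi`. -/
noncomputable abbrev basisPair (l : List (Fin (B.card j i))) : R.DiagAlg :=
  wordPair (isCoupon_vec B i j) (isCoupon_dualVec B i j) R L Z N l

variable [HasFinRel R] [CharZero k] (t : ℕ)

/-- The factorials in the numerator of the teleporter coefficient compensate for the inverse
factorials that appear when thick coupons from `𝔞` are exploded. -/
theorem muCoeff_mul (μ : Fin (B.card j i) → ℕ) :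
    muCoeff B j i μ * ((∏ r, bracketCoeff P (B.vec j i r) (μ r)) *
      ∏ r, bracketCoeff P (dualVec B j i r) (μ r)) = (∏ r, ((μ r).factorial : k))⁻¹ := by
  rw [muCoeff, div_mul_eq_mul_div, ← Finset.prod_mul_distrib, ← Finset.prod_mul_distrib,
    ← Finset.prod_mul_distrib, Finset.prod_congr rfl (g := fun _ => 1) fun r _ => ?_,
    Finset.prod_const_one, one_div]
  have h : ((μ r).factorial : k) ≠ 0 := Nat.cast_ne_zero.mpr (Nat.factorial_ne_zero _)
  unfold bracketCoeff
  split_ifs <;> field_simp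

theorem lay_muDia (μ : Fin (B.card j i) → ℕ) (h : ∑ r, μ r = t) :
    R.layE L (muDia B j i t μ) N = (∏ r, bracketCoeff P (B.vec j i r) (μ r)) •
      R.lay L (Wd (isCoupon_vec B i j) (wordOf μ)) N := by
  rw [muDia, lay_knotTo R L N μ (isCoupon_vec B i j) _
    (fun r => bracketCoeff P (B.vec j i r) (μ r)) (fun r L N => lay_bracket (isCoupon_vec B i j)
      R L N r (vec_ne_zero B j i r) (μ r)) _ t (by rw [← List.ofFn_eq_map, List.sum_ofFn, h]),
    ← List.ofFn_eq_map, List.prod_ofFn]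
  rfl

theorem lay_muDualDia (μ : Fin (B.card j i) → ℕ) (h : ∑ r, μ r = t) :
    R.layE L (muDualDia B j i t μ) N = (∏ r, bracketCoeff P (dualVec B j i r) (μ r)) •
      R.lay L (Wd (isCoupon_dualVec B i j) (wordOf μ).reverse) N := by
  rw [muDualDia, lay_knotTo R L N μ (isCoupon_dualVec B i j) _
    (fun r => bracketCoeff P (dualVec B j i r) (μ r)) (fun r L N => lay_bracket
      (isCoupon_dualVec B i j) R L N r (dualVec_ne_zero B j i r) (μ r)) _ t
      (by rw [List.map_reverse, List.sum_reverse, ← List.ofFn_eq_map, List.sum_ofFn, h]),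
    List.map_reverse, List.prod_reverse, ← List.ofFn_eq_map, List.prod_ofFn, wordOf,
    List.reverse_flatMap, List.reverse_reverse]
  simp only [Function.comp_def, List.reverse_replicate]

/-- Explosion of all coupons makes the coefficients uniform. The bound on odd multiplicities can
then be dropped, since a repeated odd letter, moved to the front, kills the pair. -/
theorem lay_teleporter :
    R.lay L (Te B i j t Z) N = ∑ μ ∈ Finset.Nat.antidiagonalTuple (B.card j i) t,
      (∏ r, ((μ r).factorial : k))⁻¹ • basisPair B i j R L Z N (wordOf μ) := by
  have h0 : ∀ μ : Fin (B.card j i) → ℕ, (∑ r, μ r = t) →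
      R.layE L ((muDia B j i t μ ⊗ₑ WExpr.id Z ⊗ₑ muDualDia B j i t μ).smul (muCoeff B j i μ)) N =
      (∏ r, ((μ r).factorial : k))⁻¹ • basisPair B i j R L Z N (wordOf μ) := by
    intro μ h
    have hl := length_wordOf μ
    rw [h] at hl
    rw [layE_smul, layE_tensor_snoc, layE_tensor_snoc, layE_id, lay_muDia _ _ _ _ _ _ _ _ h,
      lay_muDualDia _ _ _ _ _ _ _ _ h, ← muCoeff_mul, mul_smul, basisPair, wordPair, hl]
    simp only [smul_mul_assoc, mul_smul_comm, smul_smul, mul_assoc, snoc_mul_eq]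
    rw [idn_mul_lay (Wd (isCoupon_vec B i j) (wordOf μ)) (by simp only [hl, mul_assoc])]
  have h1 : ∀ μ : Fin (B.card j i) → ℕ, (¬ ∀ r, B.par j i r = 1 → μ r ≤ 1) →
      basisPair B i j R L Z N (wordOf μ) = 0 := by
    intro μ h
    push Not at h
    obtain ⟨r, hr, h⟩ := h
    obtain ⟨μ', rfl⟩ : ∃ μ' : Fin (B.card j i) → ℕ, μ = μ' + Pi.single r 1 + Pi.single r 1 := by
      refine ⟨fun s => if s = r then μ s - 2 else μ s, funext fun s => ?_⟩
      by_cases hs : s = r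
      · subst hs
        simp only [Pi.add_apply, if_true, Pi.single_eq_same]
        omega
      · simp [hs, Pi.single_apply]
    rw [basisPair, wordPair_perm _ _ _ _ _ _ ((wordOf_add_single_perm _ r).trans
      ((wordOf_add_single_perm μ' r).cons r)), wordPair_odd _ _ _ _ _ _ _ _ hr]
  have h2 : R.lay L (Te B i j t Z) N = R.layE L (teleporter B i j t Z) N :=
    (layE_eq_lay _ _ _).symm
  rw [h2, teleporter, layE_sum, List.map_map]
  have h3 : ∀ (l : List (Fin (B.card j i) → ℕ)), (∀ μ ∈ l, ∑ r, μ r = t) →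
      (((l.filter fun μ => decide (∀ r, B.par j i r = 1 → μ r ≤ 1)).map
        ((fun e => R.layE L e N) ∘ fun μ => (muDia B j i t μ ⊗ₑ WExpr.id Z ⊗ₑ
          muDualDia B j i t μ).smul (muCoeff B j i μ))).sum =
      (l.map fun μ => (∏ r, ((μ r).factorial : k))⁻¹ •
        basisPair B i j R L Z N (wordOf μ)).sum) := by
    intro l hl
    induction l with
    | nil => rfl
    | cons μ l ih =>
      have ih := ih fun μ h => hl μ (List.mem_cons_of_mem _ h)
      rw [List.filter_cons, List.map_cons, List.sum_cons, ← ih]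
      by_cases h : ∀ r, B.par j i r = 1 → μ r ≤ 1
      · rw [if_pos (by simpa using h), List.map_cons, List.sum_cons, Function.comp_apply,
          h0 _ (hl μ List.mem_cons_self)]
      · rw [if_neg (by simpa using h), h1 μ h, smul_zero, zero_add]
  exact h3 _ fun μ h => List.Nat.mem_antidiagonalTuple.mp h

theorem lay_teleporter_zero : R.lay L (Te B i j 0 Z) N = R.idn (L * (Z * N)) := by
  have h : wordOf (0 : Fin (B.card j i) → ℕ) = [] := by
    rw [← List.length_eq_zero_iff, length_wordOf]
    simp
  rw [lay_teleporter, Finset.Nat.antidiagonalTuple_zero_right, Finset.sum_singleton, basisPair,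
    h, wordPair]
  simp only [List.reverse_nil, lay_word_nil, List.length_nil, strand_zero, snoc_one, one_mul,
    snoc_mul_eq, idn_mul_idn, Pi.zero_apply, Nat.factorial_zero, Nat.cast_one,
    Finset.prod_const_one, inv_one, one_smul]

theorem lay_teleporter_one :
    R.lay L (Te B i j 1 Z) N =
      ∑ r, couponPair (isCoupon_vec B i j) (isCoupon_dualVec B i j) R L Z N r := by
  have h := sum_antidiagonalTuple_succ (k := k) (n := B.card j i) (t := 0)
    (F := fun μ => basisPair B i j R L Z N (wordOf μ))
  have hw : wordOf (0 : Fin (B.card j i) → ℕ) = [] := by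
    rw [← List.length_eq_zero_iff, length_wordOf]
    simp
  rw [lay_teleporter]
  -- The multiplicities add up to one, so inserting their sum as a factor changes nothing and
  -- distributes each term over the letters.
  have h1 : ∀ μ ∈ Finset.Nat.antidiagonalTuple (B.card j i) 1,
      (∏ r, ((μ r).factorial : k))⁻¹ • basisPair B i j R L Z N (wordOf μ) =
      ∑ r, ((μ r : k) * (∏ r, ((μ r).factorial : k))⁻¹) •
        basisPair B i j R L Z N (wordOf μ) := by
    intro μ hμ
    rw [Finset.Nat.mem_antidiagonalTuple] at hμ
    rw [← Finset.sum_smul, ← Finset.sum_mul, ← Nat.cast_sum, hμ, Nat.cast_one, one_mul]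
  rw [Finset.sum_congr rfl h1, Finset.sum_comm]
  refine Finset.sum_congr rfl fun r _ => ?_
  rw [← zero_add 1, ← h r, Finset.Nat.antidiagonalTuple_zero_right, Finset.sum_singleton,
    basisPair, wordPair_perm _ _ _ _ _ _ (wordOf_add_single_perm _ r), hw, wordPair_singleton]
  simp

/-- The factor `t + 1` is the sum of the multiplicities. It picks out a letter, which is moved
innermost; `sum_antidiagonalTuple_succ` then makes this letter independent of the remaining word. -/
theorem lay_teleporter_succ :
    ((t + 1 : ℕ) : k) • R.lay L (Te B i j (t + 1) Z) N =
      R.lay (L ◂ strand i (t + 1) ◂ Z) (Sp j 1 t) N *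
      (R.lay L (Sp i t 1) (Z * (strand j 1 * (strand j t * N))) *
      (R.lay L (Te B i j t (strand i 1 * (Z * strand j 1))) N *
      (R.lay (L ◂ strand j t) (Te B i j 1 Z) (strand i t * N) *
      (R.lay (L ◂ strand j t ◂ strand j 1 ◂ Z) (Mg i 1 t) N *
        R.lay L (Mg j t 1) (Z * (strand i (t + 1) * N)))))) := by
  have h1 : ∀ μ ∈ Finset.Nat.antidiagonalTuple (B.card j i) (t + 1),
      ((t + 1 : ℕ) : k) • (∏ r, ((μ r).factorial : k))⁻¹ •
        basisPair B i j R L Z N (wordOf μ) =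
      ∑ r, ((μ r : k) * (∏ r, ((μ r).factorial : k))⁻¹) •
        basisPair B i j R L Z N (wordOf μ) := by
    intro μ hμ
    rw [Finset.Nat.mem_antidiagonalTuple] at hμ
    rw [← Finset.sum_smul, ← Finset.sum_mul, ← Nat.cast_sum, hμ, mul_smul]
  rw [lay_teleporter, Finset.smul_sum, Finset.sum_congr rfl h1, Finset.sum_comm,
    lay_teleporter_one, lay_teleporter]
  simp only [Finset.mul_sum, Finset.sum_mul]
  refine Finset.sum_congr rfl fun r _ => ?_
  rw [← sum_antidiagonalTuple_succ (k := k) (n := B.card j i) (t := t)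
    (F := fun μ => basisPair B i j R L Z N (wordOf μ)) r]
  refine Finset.sum_congr rfl fun μ hμ => ?_
  rw [Finset.Nat.mem_antidiagonalTuple] at hμ
  rw [basisPair, wordPair_perm _ _ _ _ _ _ (wordOf_add_single_perm _ r), wordPair_cons,
    length_wordOf, hμ]
  simp only [smul_mul_assoc, mul_smul_comm]

end Teleporter

end AffineWeb

namespace AffineWeb

open FrobeniusGreatPair SuperPresentation

variable {k : Type u} [Field k] {A : Type v} [NonUnitalRing A] [Module k A] [IsScalarTower k A A]
  [SMulCommClass k A A] {P : FrobeniusGreatPair k A} {D : ℕ → Prop}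

/-! ### Sliding pairs of dual coupons through crossings -/

section Slides

variable {i j : P.I} {α : Type*} {par : α → ZMod 2} {v v' : α → A}
  (hv : ∀ a, IsCoupon P 1 j i (par a) (v a)) (hv' : ∀ a, IsCoupon P 1 i j (par a) (v' a))
  (R : SuperPresentation k (webSig P D)) (L Z N : Comps P)

theorem wordPair_mid (Z' : Comps P) (l : List α) (a : Tile k (webSig P D)) [a.IsEven] :
    wordPair hv hv' R L (Z * (a.src * Z')) N l *
        R.lay (L ◂ strand j l.length ◂ Z) a (Z' * (strand i l.length * N)) =
      R.lay (L ◂ strand i l.length ◂ Z) a (Z' * (strand j l.length * N)) *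
        wordPair hv hv' R L (Z * (a.tgt * Z')) N l := by
  have f1 := lay_far' (Wd hv l) a L Z (Z' * (strand i l.length * N)) (R := R)
  have f2 := lay_far a (Wd hv' l.reverse) (L ◂ strand i l.length ◂ Z) Z' N (R := R)
  simp only [snoc_mul, mul_assoc, List.length_reverse] at f1 f2
  simp only [wordPair, mul_assoc, snoc_mul]
  rw [f1, reassoc₂ f2.symm]

variable [HasFinRel R]

theorem wordPair_cross [CharZero k] (l : List α) (c : P.I) :
    R.lay (L ◂ strand i l.length ◂ Z) (Cr j l.length c 1) N *
        wordPair hv hv' R L (Z * strand c 1) N l =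
      wordPair hv hv' R L Z (strand c 1 * N) l *
        R.lay (L ◂ strand j l.length ◂ Z) (Cr i l.length c 1) N := by
  have f1 := lay_far' (Wd hv l) (Cr i l.length c 1) L Z N (R := R)
  have w := lay_word_cross hv' R (L ◂ strand i l.length ◂ Z) N l.reverse c
  simp only [snoc_mul, mul_assoc, List.length_reverse] at f1 w
  simp only [wordPair, mul_assoc, snoc_mul]
  rw [f1, reassoc₂ w]

variable (a : α) (c : P.I) (x : ℕ)

theorem couponPair_cross_left :
    R.lay L (Cr c x i 1) (Z * (strand j 1 * N)) * couponPair hv hv' R L (strand c x * Z) N a =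
      couponPair hv hv' R (L ◂ strand c x) Z N a * R.lay L (Cr c x j 1) (Z * (strand i 1 * N)) := by
  have f1 := lay_far (Cr c x i 1) (Cp 1 i j _ _ (hv' a)) L Z N (R := R)
  have w := coupon_cross_right R L (Z * (strand i 1 * N)) c 1 x (hv a)
  simp only [snoc_mul, mul_assoc] at f1
  simp only [couponPair, mul_assoc, snoc_mul]
  rw [reassoc₂ f1, w]

theorem couponPair_cross_right :
    R.lay (L ◂ strand i 1 ◂ Z) (Cr c x j 1) N * couponPair hv hv' R L Z (strand c x * N) a =
      couponPair hv hv' R L (Z * strand c x) N a * R.lay (L ◂ strand j 1 ◂ Z) (Cr c x i 1) N := by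
  have f1 := lay_far' (Cp 1 j i _ _ (hv a)) (Cr c x i 1) L Z N (R := R)
  have w := coupon_cross_right R (L ◂ strand i 1 ◂ Z) N c 1 x (hv' a)
  simp only [snoc_mul, mul_assoc] at f1
  simp only [couponPair, mul_assoc, snoc_mul]
  rw [f1, reassoc₂ w]

theorem couponPair_cross_left' :
    R.lay L (Cr i 1 c x) (Z * (strand j 1 * N)) * couponPair hv hv' R (L ◂ strand c x) Z N a =
      couponPair hv hv' R L (strand c x * Z) N a * R.lay L (Cr j 1 c x) (Z * (strand i 1 * N)) := by
  have f1 := lay_far (Cr i 1 c x) (Cp 1 i j _ _ (hv' a)) L Z N (R := R)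
  have w := coupon_cross_left R L (Z * (strand i 1 * N)) c 1 x (hv a)
  simp only [snoc_mul, mul_assoc] at f1
  simp only [couponPair, mul_assoc, snoc_mul]
  rw [reassoc₂ f1, w]

end Slides

/-! ### Sliding teleporters, and merging their ends -/

section Teleporter

variable (B : P.GoodBasis) (i j : P.I) (R : SuperPresentation k (webSig P D)) [HasFinRel R]
  [CharZero k] (L Z N : Comps P) (t : ℕ)

theorem teleporter_mid (Z' : Comps P) (a : Tile k (webSig P D)) [a.IsEven] :
    R.lay L (Te B i j t (Z * (a.src * Z'))) N *
        R.lay (L ◂ strand j t ◂ Z) a (Z' * (strand i t * N)) =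
      R.lay (L ◂ strand i t ◂ Z) a (Z' * (strand j t * N)) *
        R.lay L (Te B i j t (Z * (a.tgt * Z'))) N := by
  rw [lay_teleporter, lay_teleporter, Finset.sum_mul, Finset.mul_sum]
  refine Finset.sum_congr rfl fun μ hμ => ?_
  have h := wordPair_mid (isCoupon_vec B i j) (isCoupon_dualVec B i j) R L Z N Z' (wordOf μ) a
  rw [length_wordOf, Finset.Nat.mem_antidiagonalTuple.mp hμ] at h
  rw [smul_mul_assoc, mul_smul_comm, basisPair, h]

theorem teleporter_cross (c : P.I) :
    R.lay (L ◂ strand i t ◂ Z) (Cr j t c 1) N * R.lay L (Te B i j t (Z * strand c 1)) N =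
      R.lay L (Te B i j t Z) (strand c 1 * N) * R.lay (L ◂ strand j t ◂ Z) (Cr i t c 1) N := by
  rw [lay_teleporter, lay_teleporter, Finset.sum_mul, Finset.mul_sum]
  refine Finset.sum_congr rfl fun μ hμ => ?_
  have h := wordPair_cross (isCoupon_vec B i j) (isCoupon_dualVec B i j) R L Z N (wordOf μ) c
  rw [length_wordOf, Finset.Nat.mem_antidiagonalTuple.mp hμ] at h
  rw [smul_mul_assoc, mul_smul_comm, basisPair, h]

variable (c : P.I) (x : ℕ)

theorem teleporter_one_cross_left :
    R.lay L (Cr c x i 1) (Z * (strand j 1 * N)) * R.lay L (Te B i j 1 (strand c x * Z)) N =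
      R.lay (L ◂ strand c x) (Te B i j 1 Z) N * R.lay L (Cr c x j 1) (Z * (strand i 1 * N)) := by
  rw [lay_teleporter_one, lay_teleporter_one, Finset.sum_mul, Finset.mul_sum]
  exact Finset.sum_congr rfl fun r _ => couponPair_cross_left _ _ R L Z N r c x

theorem teleporter_one_cross_right :
    R.lay (L ◂ strand i 1 ◂ Z) (Cr c x j 1) N * R.lay L (Te B i j 1 Z) (strand c x * N) =
      R.lay L (Te B i j 1 (Z * strand c x)) N * R.lay (L ◂ strand j 1 ◂ Z) (Cr c x i 1) N := by
  rw [lay_teleporter_one, lay_teleporter_one, Finset.sum_mul, Finset.mul_sum]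
  exact Finset.sum_congr rfl fun r _ => couponPair_cross_right _ _ R L Z N r c x

theorem teleporter_one_cross_left' :
    R.lay L (Cr i 1 c x) (Z * (strand j 1 * N)) * R.lay (L ◂ strand c x) (Te B i j 1 Z) N =
      R.lay L (Te B i j 1 (strand c x * Z)) N * R.lay L (Cr j 1 c x) (Z * (strand i 1 * N)) := by
  rw [lay_teleporter_one, lay_teleporter_one, Finset.sum_mul, Finset.mul_sum]
  exact Finset.sum_congr rfl fun r _ => couponPair_cross_left' _ _ R L Z N r c x

/-- Exchanging the end points on both sides of two nested thin teleporters. -/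
theorem teleporter_one_nested_cross :
    R.lay (L ◂ strand i 1 ◂ strand i 1 ◂ Z) (Cr j 1 j 1) N *
      (R.lay L (Cr i 1 i 1) (Z * (strand j 1 * (strand j 1 * N))) *
      (R.lay L (Te B i j 1 (strand i 1 * (Z * strand j 1))) N *
        R.lay (L ◂ strand j 1) (Te B i j 1 Z) (strand i 1 * N))) =
    R.lay L (Te B i j 1 (strand i 1 * (Z * strand j 1))) N *
      (R.lay (L ◂ strand j 1) (Te B i j 1 Z) (strand i 1 * N) *
      (R.lay (L ◂ strand j 1 ◂ strand j 1 ◂ Z) (Cr i 1 i 1) N *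
        R.lay L (Cr j 1 j 1) (Z * (strand i 1 * (strand i 1 * N))))) := by
  have s1 := teleporter_one_cross_left B i j R L (Z * strand j 1) N i 1
  have s2 := teleporter_cross B i j R (L ◂ strand i 1) Z N 1 j
  have s3 := teleporter_one_cross_left' B i j R L Z (strand i 1 * N) j 1
  have s4 := teleporter_one_cross_right B i j R L (strand j 1 * Z) N i 1
  have m := teleporter_mid B i j R L 1 N 1 1 (Te B i j 1 Z)
  have f2 := lay_far (Cr j 1 j 1) (Cr i 1 i 1) L Z N (R := R)
  simp only [snoc_mul, mul_assoc, mul_one, one_mul, snoc_one] at s1 s2 s3 s4 m f2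
  rw [reassoc₂ s1, reassoc₂ s2, s3, reassoc₂ s4, f2.symm, reassoc₂ m]

/-- A thick teleporter whose right end is merged with a thin strand on its left. -/
theorem merge_teleporter_nested :
    R.lay (L ◂ strand i (t + 1) ◂ Z) (Mg j 1 t) N * R.lay L (Te B i j (t + 1) Z) N =
      R.lay L (Sp i t 1) (Z * (strand j 1 * (strand j t * N))) *
      (R.lay L (Te B i j t (strand i 1 * (Z * strand j 1))) N *
      (R.lay (L ◂ strand j t) (Te B i j 1 Z) (strand i t * N) *
      (R.lay (L ◂ strand j t ◂ strand j 1 ◂ Z) (Mg i 1 t) N *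
        R.lay L (Mg j t 1) (Z * (strand i (t + 1) * N))))) := by
  induction t generalizing Z with
  | zero =>
    simp only [lay_Mg_zero_left, lay_Mg_zero_right, lay_Sp_zero_left, lay_teleporter_zero,
      strand_zero, snoc_one, one_mul, snoc_mul_eq, mul_assoc, zero_add]
    rw [idn_mul_idn, lay_mul_idn (Te B i j 1 Z) (by simp only [mul_assoc]),
      idn_mul_lay (Te B i j 1 Z) (by simp only [mul_assoc]),
      idn_mul_lay (Te B i j 1 Z) (by simp only [mul_assoc])]
  | succ t ih =>
    have h0 : ((t + 1 + 1 : ℕ) : k) ≠ 0 := Nat.cast_ne_zero.mpr (Nat.succ_ne_zero _)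
    -- Multiplication by the new thickness makes the recursion for thick teleporters applicable.
    refine smul_right_injective _ h0 ?_
    simp only
    have rec1 := lay_teleporter_succ B i j R L (strand i 1 * (Z * strand j 1)) N t
    have ih := ih (strand i 1 * (Z * strand j 1))
    have ms := merge_split_thin_left R (L ◂ strand i (t + 1 + 1) ◂ Z) N j t
    have f1 := lay_far (Sp i (t + 1) 1) (Sp j 1 t) L (Z * strand j 1) N (R := R)
    have f2 := lay_far (Sp i t (1 + 1)) (Cr j 1 j 1) L Z (strand j t * N) (R := R)
    have f3 := lay_far (Sp i (t + 1) 1) (Mg j 1 t) L (Z * strand j 1) N (R := R)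
    have f5 := lay_far (Sp i 1 1) (Cr j 1 j 1) (L ◂ strand i t) Z (strand j t * N) (R := R)
    have f6 := lay_far (Mg j t 1) (Te B i j 1 Z) L 1 (strand i (t + 1) * N) (R := R)
    have f7 := lay_far (Te B i j 1 Z) (Mg i 1 t) (L ◂ strand j t ◂ strand j 1) 1 N (R := R)
    have f8 := lay_far (Mg j t 1) (Mg i 1 (t + 1)) L (strand j 1 * Z) N (R := R)
    have f9 := lay_far (Cr j 1 j 1) (Mg i 1 1) (L ◂ strand j t) Z (strand i t * N) (R := R)
    have f10 := lay_far (Cr j 1 j 1) (Mg i (1 + 1) t) (L ◂ strand j t) Z N (R := R)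
    have f11 := lay_far (Cr i 1 i 1) (Cr j 1 j 1) (L ◂ strand j t) Z (strand i t * N) (R := R)
    have m1 := teleporter_mid B i j R L 1 N t (Z * (strand j 1 * strand j 1))
      (Cr i 1 i 1)
    have m2 := teleporter_mid B i j R L (strand i 1 * (strand i 1 * Z)) N t 1
      (Cr j 1 j 1)
    have nest := teleporter_one_nested_cross B i j R (L ◂ strand j t) Z (strand i t * N)
    have a1 := split_assoc R L (Z * (strand j 1 * (strand j 1 * (strand j t * N)))) i t 1 1
    have a2 := merge_assoc R L (Z * (strand i (t + 1 + 1) * N)) j t 1 1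
    have a3 := merge_assoc R (L ◂ strand j t ◂ strand j 1 ◂ strand j 1 ◂ Z) N i 1 1 t
    have k1 := cross_merge_one_one R (L ◂ strand j t) 
      (Z * (strand i (t + 1 + 1) * N)) j
    have k2 := cross_merge_one_one R (L ◂ strand j t ◂ strand j 1 ◂ strand j 1 ◂ Z)
      (strand i t * N) i
    have k3 := split_cross_one_one R (L ◂ strand i t) 
      (Z * (strand j 1 * (strand j 1 * (strand j t * N)))) i
    simp only [snoc_mul, mul_assoc, mul_one, one_mul, snoc_one, add_comm 1 t,
      add_comm 1 (t + 1)] at rec1 ih ms f1 f2 f3 f5 f6 f7 f8 f9 f10 f11 m1 m2 nest a1 a2 a3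
    rw [show t + (1 + 1) = t + 1 + 1 from rfl] at f2
    rw [show 1 + 1 + t = t + 1 + 1 by omega] at f10
    have nest' := fun s => congrArg (· * s) nest
    simp only [mul_assoc] at nest'
    -- The merge meets the split from the recursion. Of the total factor `t + 2`, the identity
    -- summand accounts for one; the crossing summand has to give the other `t + 1`, which the
    -- recursion for the thinner teleporter absorbs.
    rw [← mul_smul_comm, lay_teleporter_succ B i j R L Z N (t + 1), reassoc ms, add_mul,
      Nat.cast_succ, add_smul, one_smul, add_comm (((t + 1 : ℕ) : k) • _), ← mul_smul_comm,
      ← smul_mul_assoc, rec1, idn_mul_lay_mul (Sp i (t + 1) 1) 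
        (by simp only [mul_assoc, snoc_mul_eq])]
    simp only [mul_assoc]
    rw [add_right_inj, reassoc₂ f3.symm, reassoc ih]
    simp only [mul_assoc]
    rw [reassoc₂ f6, reassoc₂ f7.symm, reassoc₂ f8, reassoc₂ f1, reassoc₂ a1, reassoc₂ a3.symm, a2,
      reassoc₂ f2.symm, reassoc₂ f5.symm, reassoc₂ m2.symm]
    -- A crossing created above the split on the `i`-side accompanies the one on the `j`-side, so
    -- that the two nested thin teleporters can be exchanged; the merges at the top absorb both
    -- crossings.
    nth_rewrite 1 [← k3]
    simp only [mul_assoc]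
    rw [reassoc₂ m1.symm, reassoc₂ f11, nest', reassoc₂ f9, reassoc₂ f10, reassoc k2, reassoc k1]

/-- A thick teleporter whose right end is merged with a thin strand on its right. -/
theorem merge_teleporter :
    R.lay (L ◂ strand i (t + 1) ◂ Z) (Mg j t 1) N * R.lay L (Te B i j (t + 1) Z) N =
      R.lay L (Sp i t 1) (Z * (strand j t * (strand j 1 * N))) *
      (R.lay L (Te B i j t (strand i 1 * Z)) (strand j 1 * N) *
      (R.lay (L ◂ strand j t) (Te B i j 1 (Z * strand i t)) N *
      (R.lay (L ◂ strand j t ◂ strand j 1 ◂ Z) (Mg i t 1) N *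
        R.lay L (Mg j t 1) (Z * (strand i (t + 1) * N))))) := by
  have f1 := lay_far (Sp i t 1) (Cr j t j 1) L Z N (R := R)
  have s1 := teleporter_cross B i j R L (strand i 1 * Z) N t j
  have s2 := teleporter_one_cross_right B i j R (L ◂ strand j t) Z N i t
  have k1 := cross_merge_thin R (L ◂ strand j t ◂ strand j 1 ◂ Z) N i t
  simp only [snoc_mul, mul_assoc] at f1 s1
  -- A merge with the thin strand on the right is a crossing followed by a merge with it on the
  -- left. The crossing moves up through both teleporters and is absorbed above.
  rw [← cross_merge_thin R (L ◂ strand i (t + 1) ◂ Z) N j t, mul_assoc, merge_teleporter_nested,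
    reassoc₂ f1.symm, reassoc₂ s1, reassoc₂ s2, reassoc k1]

end Teleporter

end AffineWeb

/-! ### Dual bases and the symmetry of the Casimir element -/

namespace FrobeniusGreatPair

variable {k : Type u} [Field k] {A : Type v} [NonUnitalRing A] [Module k A] [IsScalarTower k A A]
  [SMulCommClass k A A] {P : FrobeniusGreatPair k A} (B : P.GoodBasis) (i j : P.I)

theorem sum_tr_dualVec_mul_smul {f : A} (hf : f ∈ P.corner j i) :
    ∑ r, P.tr (dualVec B j i r * f) • B.vec j i r = f := by
  have h : f ∈ Submodule.span k (Set.range (B.vec j i)) := by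
    rw [B.span_eq]
    exact hf
  obtain ⟨c, rfl⟩ := (Submodule.mem_span_range_iff_exists_fun k).mp h
  refine Finset.sum_congr rfl fun r _ => ?_
  rw [Finset.mul_sum, map_sum, Finset.sum_eq_single r]
  · rw [mul_smul_comm, map_smul, (dualVec_spec B j i r).2.2, if_pos rfl, smul_eq_mul, mul_one]
  · intro s _ hs
    rw [mul_smul_comm, map_smul, (dualVec_spec B j i r).2.2, if_neg hs, smul_zero]
  · intro h
    exact absurd (Finset.mem_univ r) h

/-- The map `φ_tr` is injective on `A`. Because `ψ` fixes the idempotents, the pairing of `d ∈ iAj`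
with any element depends only on the component of that element in `jAi`. -/
theorem eq_zero_of_tr_mul_vec {p : ZMod 2} {d : A} (hd : d ∈ P.corner i j) (hp : d ∈ P.parity p)
    (h : ∀ s, P.tr (d * B.vec j i s) = 0) : d = 0 := by
  have hcorner : ∀ f ∈ P.corner j i, P.tr (d * f) = 0 := by
    intro f hf
    rw [← sum_tr_dualVec_mul_smul B i j hf, Finset.mul_sum, map_sum]
    refine Finset.sum_eq_zero fun s _ => ?_
    rw [mul_smul_comm, map_smul, h, smul_zero]
  have hhom : ∀ {q : ZMod 2} {g : A}, g ∈ P.parity q → P.tr (d * g) = 0 := by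
    intro q g hg
    have h1 := P.phi_mul (P.idem_even i i.2) hp hg
    rw [P.ψ_idem i i.2, ZMod.val_zero, zero_mul, zero_mul, add_zero, pow_zero, one_mul,
      hd.1, show d * (g * i) = d * (j * (g * i)) by rw [← mul_assoc d j, hd.2]] at h1
    rw [h1]
    refine hcorner _ ⟨?_, ?_⟩
    · rw [← mul_assoc, P.idem_mul_self j j.2]
    · rw [mul_assoc, mul_assoc, P.idem_mul_self i i.2]
  refine P.phi_injective (LinearMap.ext fun g => ?_)
  obtain ⟨g₀, h₀, g₁, h₁, rfl⟩ := exists_parity_add (P := P) g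
  change P.tr (d * (g₀ + g₁)) = P.tr (0 * (g₀ + g₁))
  rw [mul_add, map_add, hhom h₀, hhom h₁, zero_mul, map_zero, add_zero]

theorem tr_mul_eq_zero_of_ne {p q : ZMod 2} {f g : A} (hf : f ∈ P.parity p) (hg : g ∈ P.parity q)
    (h : p ≠ q) : P.tr (f * g) = 0 := by
  refine tr_mul_eq_zero hf hg ?_
  rcases SuperPresentation.zmod_two_cases p with rfl | rfl <;>
    rcases SuperPresentation.zmod_two_cases q with rfl | rfl
  · exact absurd rfl h
  · rfl
  · rfl
  · exact absurd rfl h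

theorem sum_tr_mul_vec_smul {p : ZMod 2} {g : A} (hg : g ∈ P.corner i j) (hp : g ∈ P.parity p) :
    ∑ s, P.tr (g * B.vec j i s) • dualVec B j i s = g := by
  refine sub_eq_zero.mp (eq_zero_of_tr_mul_vec B i j (p := p) ?_ ?_ fun s => ?_)
  · exact Submodule.sub_mem _
      (Submodule.sum_mem _ fun s _ => Submodule.smul_mem _ _ (dualVec_spec B j i s).1) hg
  · refine Submodule.sub_mem _ (Submodule.sum_mem _ fun s _ => ?_) hp
    by_cases h : p = B.par j i s
    · rw [h]
      exact Submodule.smul_mem _ _ (dualVec_spec B j i s).2.1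
    · rw [tr_mul_eq_zero_of_ne hp (B.vec_mem_parity j i s) h, zero_smul]
      exact Submodule.zero_mem _
  · rw [sub_mul, map_sub, Finset.sum_mul, map_sum, Finset.sum_eq_single s]
    · rw [smul_mul_assoc, map_smul, (dualVec_spec B j i s).2.2, if_pos rfl, smul_eq_mul, mul_one,
        sub_self]
    · intro r _ hr
      rw [smul_mul_assoc, map_smul, (dualVec_spec B j i r).2.2, if_neg hr.symm, smul_zero]
    · intro h
      exact absurd (Finset.mem_univ s) h

theorem tr_ψ_symm_mul {p q : ZMod 2} {f g : A} (hf : f ∈ P.parity p) (hg : g ∈ P.parity q)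
    (hfi : f ∈ P.corner i i) (hgi : g ∈ P.corner i i) :
    P.tr (P.ψ.symm f * g) = (-1 : k) ^ (p.val * q.val) * P.tr (g * f) := by
  -- The idempotent as third argument turns the bimodule axiom into supersymmetry of the trace form
  -- up to `ψ`.
  have h := P.phi_mul (AffineWeb.ψ_symm_mem_parity hf) hg (P.idem_even i i.2)
  rw [LinearEquiv.apply_symm_apply, ZMod.val_zero, mul_zero, add_zero, hfi.1, mul_assoc,
    hgi.2] at h
  exact h

/-- The matrices of the changes of bases between a basis and its dual, in the two tensor factors of
the Casimir element, are inverse to each other up to the twist by `ψ`. -/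
theorem sum_tr_ψ_symm_mul_tr (s u : Fin (B.card i i)) :
    ∑ r, (-1 : k) ^ ((B.par i i r).val * (B.par i i r).val) *
      (P.tr (dualVec B i i u * dualVec B i i r) * P.tr (P.ψ.symm (B.vec i i r) * B.vec i i s)) =
      if s = u then 1 else 0 := by
  rw [← (dualVec_spec B i i u).2.2 s]
  -- With equal colors the dual basis is again a basis of `iAi`, so the basis vector can be expanded
  -- in it.
  conv_rhs => rw [← sum_tr_mul_vec_smul B i i (vec_mem_corner B i i s) (B.vec_mem_parity i i s),
    Finset.mul_sum, map_sum]
  refine Finset.sum_congr rfl fun r _ => ?_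
  rw [mul_smul_comm, map_smul, smul_eq_mul, tr_ψ_symm_mul i (B.vec_mem_parity i i r)
    (B.vec_mem_parity i i s) (vec_mem_corner B i i r) (vec_mem_corner B i i s)]
  by_cases h : B.par i i s = B.par i i r
  · rw [h]
    linear_combination P.tr (dualVec B i i u * dualVec B i i r) * P.tr (B.vec i i s * B.vec i i r) *
      SuperPresentation.neg_one_pow_mul_self (k := k) (B.par i i r) (B.par i i r)
  · rw [tr_mul_eq_zero_of_ne (B.vec_mem_parity i i s) (B.vec_mem_parity i i r) h]
    ring

end FrobeniusGreatPair

namespace AffineWeb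

open FrobeniusGreatPair SuperPresentation

variable {k : Type u} [Field k] {A : Type v} [NonUnitalRing A] [Module k A] [IsScalarTower k A A]
  [SMulCommClass k A A] {P : FrobeniusGreatPair k A} {D : ℕ → Prop}

/-! ### Linearity of thin coupons -/

section Linear

variable (R : SuperPresentation k (webSig P D)) (L N : Comps P) {i j : P.I}

theorem lay_coupon_congr {p : ZMod 2} {f g : A} (h : f = g) (hf : IsCoupon P 1 j i p f)
    (hg : IsCoupon P 1 j i p g) :
    R.lay L (Cp 1 j i p f hf) N = R.lay L (Cp 1 j i p g hg) N := by
  subst h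
  rfl

variable [HasFinRel R]

theorem lay_coupon_zero {p : ZMod 2} (h : IsCoupon P 1 j i p 0) :
    R.lay L (Cp 1 j i p 0 h) N = 0 := by
  have := coupon_smul R L N 1 0 h
  rw [pow_one, zero_smul k (R.lay L _ N)] at this
  exact (lay_coupon_congr R L N (zero_smul k (0 : A)).symm _ _).trans this

theorem isCoupon_sum {ι : Type*} (s : Finset ι) (c : ι → k) {par : ι → ZMod 2} {v : ι → A}
    (hv : ∀ r, IsCoupon P 1 j i (par r) (v r)) {p : ZMod 2} (hc : ∀ r, c r ≠ 0 → par r = p) :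
    IsCoupon P 1 j i p (∑ r ∈ s, c r • v r) := by
  refine ⟨Submodule.sum_mem _ fun r _ => Submodule.smul_mem _ _ (hv r).1,
    Submodule.sum_mem _ fun r _ => ?_, fun h => absurd h (by omega)⟩
  by_cases h : c r = 0
  · rw [h, zero_smul]
    exact Submodule.zero_mem _
  · rw [← hc r h]
    exact Submodule.smul_mem _ _ (hv r).2.1

/-- Each coupon carries a declared parity; `hc` ensures that every vector with nonzero coefficient
has the parity declared for the sum. -/
theorem lay_coupon_sum {ι : Type*} (s : Finset ι) (c : ι → k) {par : ι → ZMod 2} {v : ι → A}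
    (hv : ∀ r, IsCoupon P 1 j i (par r) (v r)) {p : ZMod 2} (hc : ∀ r, c r ≠ 0 → par r = p)
    {f : A} (hf : IsCoupon P 1 j i p f) (h : ∑ r ∈ s, c r • v r = f) :
    R.lay L (Cp 1 j i p f hf) N = ∑ r ∈ s, c r • R.lay L (Cp 1 j i (par r) (v r) (hv r)) N := by
  classical
  induction s using Finset.induction_on generalizing f with
  | empty =>
    rw [Finset.sum_empty] at h ⊢
    subst h
    exact lay_coupon_zero R L N hf
  | insert a s ha ih =>
    rw [Finset.sum_insert ha] at h ⊢
    rw [← ih (isCoupon_sum s c hv hc) rfl]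
    by_cases hca : c a = 0
    · rw [hca, zero_smul, zero_add] at h
      rw [hca, zero_smul, zero_add]
      exact lay_coupon_congr R L N h.symm _ _
    · have h1 : ∀ q (hq : q = p) (hv : IsCoupon P 1 j i q (v a)),
          R.lay L (Cp 1 j i p f hf) N = c a • R.lay L (Cp 1 j i q (v a) hv) N +
            R.lay L (Cp 1 j i p _ (isCoupon_sum s c ‹_› hc)) N := by
        rintro q rfl hva
        have h2 := coupon_smul R L N 1 (c a) hva
        rw [pow_one] at h2
        rw [← h2, ← coupon_add_one]
        exact lay_coupon_congr R L N h.symm _ _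
      exact h1 _ (hc a hca) _

variable (B : P.GoodBasis) (i)

/-- Symmetry of the Casimir element: flipping its factors and applying the inverse of `ψ` to one of
them gives it back. Expand each factor in the other basis; the coefficient matrices are inverse to
each other, including the sign from exchanging heights. -/
theorem sum_coupon_ψ_symm :
    ∑ r, R.lay L (Cp 1 i i _ _ (isCoupon_dualVec B i i r)) (strand i 1 * N) *
        R.lay (L ◂ strand i 1) (Cp 1 i i _ _ (isCoupon_vec B i i r).ψ_symm) N =
      ∑ r, couponPair (isCoupon_vec B i i) (isCoupon_dualVec B i i) R L 1 N r := by
  have h1 : ∀ r, R.lay L (Cp 1 i i _ _ (isCoupon_dualVec B i i r)) (strand i 1 * N) *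
      R.lay (L ◂ strand i 1) (Cp 1 i i _ _ (isCoupon_vec B i i r).ψ_symm) N =
      ((-1 : k) ^ ((B.par i i r).val * (B.par i i r).val)) • ((∑ s,
        P.tr (P.ψ.symm (B.vec i i r) * B.vec i i s) •
          R.lay (L ◂ strand i 1) (Cp 1 i i _ _ (isCoupon_dualVec B i i s)) N) *
      (∑ u, P.tr (dualVec B i i u * dualVec B i i r) •
        R.lay L (Cp 1 i i _ _ (isCoupon_vec B i i u)) (strand i 1 * N))) := by
    intro r
    have f := lay_far_super (Cp 1 i i _ _ (isCoupon_dualVec B i i r))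
      (Cp 1 i i _ _ (isCoupon_vec B i i r).ψ_symm) L 1 N (R := R)
      (hasParity_coupon_pos Nat.one_pos _ _ _) (hasParity_coupon_pos Nat.one_pos _ _ _)
    simp only [snoc_mul, mul_assoc, mul_one, one_mul, snoc_one] at f
    rw [f, lay_coupon_sum R _ _ Finset.univ
        (fun s => P.tr (P.ψ.symm (B.vec i i r) * B.vec i i s)) (isCoupon_dualVec B i i) ?_ _
        (sum_tr_mul_vec_smul B i i (isCoupon_vec B i i r).ψ_symm.1
          (isCoupon_vec B i i r).ψ_symm.2.1),
      lay_coupon_sum R _ _ Finset.univ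
        (fun u => P.tr (dualVec B i i u * dualVec B i i r)) (isCoupon_vec B i i) ?_ _
        (sum_tr_dualVec_mul_smul B i i (isCoupon_dualVec B i i r).1)]
    · intro u hu
      by_contra hne
      exact hu (tr_mul_eq_zero_of_ne (isCoupon_dualVec B i i u).2.1
        (isCoupon_dualVec B i i r).2.1 hne)
    · intro s hs
      by_contra hne
      exact hs (tr_mul_eq_zero_of_ne (isCoupon_vec B i i r).ψ_symm.2.1
        (isCoupon_vec B i i s).2.1 (Ne.symm hne))
  rw [Finset.sum_congr rfl fun r _ => h1 r]
  simp only [Finset.sum_mul_sum, Finset.smul_sum, smul_mul_assoc, mul_smul_comm, smul_smul]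
  rw [Finset.sum_comm]
  have h2 : ∀ s, ∑ r, ∑ u, ((-1 : k) ^ ((B.par i i r).val * (B.par i i r).val) *
      (P.tr (dualVec B i i u * dualVec B i i r) * P.tr (P.ψ.symm (B.vec i i r) * B.vec i i s))) •
      (R.lay (L ◂ strand i 1) (Cp 1 i i _ _ (isCoupon_dualVec B i i s)) N *
        R.lay L (Cp 1 i i _ _ (isCoupon_vec B i i u)) (strand i 1 * N)) =
      couponPair (isCoupon_vec B i i) (isCoupon_dualVec B i i) R L 1 N s := by
    intro s
    rw [Finset.sum_comm]
    simp only [← Finset.sum_smul, sum_tr_ψ_symm_mul_tr, ite_smul, one_smul, zero_smul,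
      Finset.sum_ite_eq, Finset.mem_univ, if_true, couponPair, snoc_one, one_mul]
  exact Finset.sum_congr rfl fun s _ => h2 s

end Linear

/-- The relations of the thin dot web category hold in the category presented by `R`. -/
class HasThinRel (B : P.GoodBasis) (R : SuperPresentation k (webSig P thinDots)) : Prop where
  eqv : ∀ {X Y : Comps P} {e e' : Dia P thinDots X Y}, ThinRel P B e e' → WExpr.Eqv R e e'

/-- the thin affine dot -/
abbrev Dt (i : P.I) : Tile k (webSig P thinDots) := ⟨_, _, thinDot i⟩

theorem hasParity_thinDot (i : P.I) : (thinDot i).HasParity 0 := hasParity_dot _ _ _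

instance (i : P.I) : (Dt i : Tile k (webSig P thinDots)).IsEven := ⟨hasParity_thinDot i⟩

/-! ### Thin dots, and their explosions -/

section Dot

variable (R : SuperPresentation k (webSig P thinDots)) (L N : Comps P) (i j : P.I)

theorem coupon_dot (B : P.GoodBasis) [HasThinRel B R] {p : ZMod 2} {f : A}
    (hf : IsCoupon P 1 j i p f) :
    R.lay L (Cp 1 j i p f hf) N * R.lay L (Dt j) N =
      R.lay L (Dt i) N * R.lay L (Cp 1 j i p (P.ψ.symm f) hf.ψ_symm) N := by
  have h := layE_congr (HasThinRel.eqv (B := B) (R := R) (.coupon_dot i j p f hf)) L N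
  simp only [layE_comp, layE_coupon] at h
  simpa only [layE_eq_lay] using h

theorem dot_cross (B : P.GoodBasis) [HasThinRel B R] :
    R.lay L (Dt i) (strand j 1 * N) * R.lay L (Cr i 1 j 1) N =
      R.lay L (Cr i 1 j 1) N * R.lay (L ◂ strand j 1) (Dt i) N - R.lay L (Te B i j 1 1) N := by
  have h := layE_congr (HasThinRel.eqv (B := B) (R := R) (.dot_cross i j)) L N
  simp only [layE_comp, layE_add, layE_smul, layE_tensor_snoc, layE_str, layE_eqE, layE_cross] at h
  simp only [layE_eq_lay] at h
  rw [idn_mul_lay (Dt i) (by simp only [mul_assoc, snoc_mul_eq]),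
    lay_mul_idn (Dt i) (by simp only [snoc_mul_eq]),
    lay_mul_idn (Te B i j 1 1) (by simp only []),
    idn_mul_lay (Te B i j 1 1) (by simp only [one_mul])] at h
  rw [h, sub_eq_add_neg]
  exact congrArg _ (neg_one_smul k (R.lay L (Te B i j 1 1) N))

/-- thin dots on all strands of an explosion -/
abbrev Bl (i : P.I) (x : ℕ) : Tile k (webSig P thinDots) := ⟨_, _, blow (thinDot i) x⟩

/-- the white dot -/
abbrev Wh (i : P.I) (x : ℕ) : Tile k (webSig P thinDots) := ⟨_, _, whiteDot i x⟩

theorem hasParity_whiteDot (x : ℕ) : (whiteDot i x).HasParity 0 := by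
  have h := hasParity_blow (hasParity_thinDot i) x
  rw [smul_zero] at h
  exact .smul _ h

theorem hasParity_blow_thinDot (x : ℕ) : (blow (thinDot i) x).HasParity 0 := by
  have h := hasParity_blow (hasParity_thinDot i) x
  rwa [smul_zero] at h

instance (i : P.I) (x : ℕ) : (Wh i x : Tile k (webSig P thinDots)).IsEven :=
  ⟨hasParity_whiteDot i x⟩

instance (i : P.I) (x : ℕ) : (Bl i x : Tile k (webSig P thinDots)).IsEven :=
  ⟨hasParity_blow_thinDot i x⟩

theorem lay_whiteDot (x : ℕ) :
    R.lay L (Wh i x) N = (x.factorial : k)⁻¹ • R.lay L (Bl i x) N := by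
  have h : R.lay L (Wh i x) N = R.layE L (whiteDot i x) N := (layE_eq_lay _ _ _).symm
  rw [h, whiteDot, layE_smul, layE_eq_lay]

theorem lay_blow_zero : R.lay L (Bl i 0) N = R.idn (L * N) := by
  have h : R.lay L (Bl i 0) N = R.layE L (blow (thinDot i) 0) N := (layE_eq_lay _ _ _).symm
  exact h.trans ((layE_id L 1 N).trans (by rw [one_mul]))

theorem lay_blow_succ (x : ℕ) :
    R.lay L (Bl i (x + 1)) N = R.lay L (Sp i x 1) N * (R.lay (L ◂ strand i x) (Dt i) N *
      (R.lay L (Bl i x) (strand i 1 * N) * R.lay L (Mg i x 1) N)) := by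
  have h : R.lay L (Bl i (x + 1)) N = R.layE L (blow (thinDot i) (x + 1)) N :=
    (layE_eq_lay _ _ _).symm
  rw [h, blow, layE_comp, layE_comp, layE_tensor_snoc, mul_assoc]
  simp only [layE_eq_lay]

theorem lay_whiteDot_zero : R.lay L (Wh i 0) N = R.idn (L * N) := by
  rw [lay_whiteDot, lay_blow_zero, Nat.factorial_zero, Nat.cast_one, inv_one, one_smul]

theorem lay_whiteDot_one : R.lay L (Wh i 1) N = R.lay L (Dt i) N := by
  rw [lay_whiteDot, lay_blow_succ, lay_blow_zero, Nat.factorial_one, Nat.cast_one, inv_one,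
    one_smul, lay_Sp_zero_left, lay_Mg_zero_left, strand_zero, snoc_one, idn_mul_idn,
    lay_mul_idn (Dt i) rfl, idn_mul_lay (Dt i) rfl]

variable [HasFinRel R] [CharZero k]

/-- Conjugation by the crossing flips the ends of the teleporter. Pulling the dot down through its
coupons applies the inverse of `ψ`, and the symmetry of the Casimir element restores the original
teleporter. -/
theorem cross_teleporter_cross_dot (B : P.GoodBasis) [HasThinRel B R] :
    R.lay L (Cr i 1 i 1) N * (R.lay L (Te B i i 1 1) N * (R.lay L (Cr i 1 i 1) N *
      R.lay (L ◂ strand i 1) (Dt i) N)) =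
    R.lay (L ◂ strand i 1) (Dt i) N * R.lay L (Te B i i 1 1) N := by
  conv_rhs => rw [lay_teleporter_one, ← sum_coupon_ψ_symm]
  rw [lay_teleporter_one]
  simp only [Finset.mul_sum, Finset.sum_mul]
  refine Finset.sum_congr rfl fun r _ => ?_
  have f1 := lay_far' (Cp 1 i i _ _ (isCoupon_dualVec B i i r)) (Dt i) L 1 N (R := R)
  have c1 := coupon_cross_left R L N i 1 1 (isCoupon_vec B i i r)
  have c2 := coupon_cross_right R L N i 1 1 (isCoupon_dualVec B i i r)
  have s1 := cross_cross_one_one_self R L N i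
  have d1 := coupon_dot R (L ◂ strand i 1) N i i B (isCoupon_vec B i i r)
  simp only [snoc_mul, mul_assoc, mul_one, one_mul, snoc_one] at f1
  simp only [couponPair, snoc_one, one_mul, mul_assoc]
  rw [reassoc₂ c1, reassoc₂ c2, reassoc s1, idn_mul_lay_mul (Cp 1 i i _ _ _) (by simp only []),
    d1, reassoc₂ f1]

/-- Each of the two dots leaves a teleporter behind when it passes the crossing, with opposite
signs; by the preceding lemma these corrections cancel. -/
theorem dot_dot_cross (B : P.GoodBasis) [HasThinRel B R] :
    R.lay (L ◂ strand i 1) (Dt i) N * (R.lay L (Dt i) (strand i 1 * N) * R.lay L (Cr i 1 i 1) N) =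
      R.lay L (Cr i 1 i 1) N *
        (R.lay (L ◂ strand i 1) (Dt i) N * R.lay L (Dt i) (strand i 1 * N)) := by
  have f1 := lay_far (Dt i) (Dt i) L 1 N (R := R)
  have s1 := cross_cross_one_one_self R L N i
  have d1 := dot_cross R L N i i B
  have t1 := cross_teleporter_cross_dot R L N i B
  simp only [snoc_mul, mul_assoc, mul_one, one_mul, snoc_one] at f1
  -- How the right dot passes the crossing: `dot_cross` with a crossing added on both sides.
  have d2 : R.lay (L ◂ strand i 1) (Dt i) N * R.lay L (Cr i 1 i 1) N =
      R.lay L (Cr i 1 i 1) N * R.lay L (Dt i) (strand i 1 * N) +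
        R.lay L (Cr i 1 i 1) N * (R.lay L (Te B i i 1 1) N * R.lay L (Cr i 1 i 1) N) := by
    have h := congrArg (fun z => R.lay L (Cr i 1 i 1) N * (z * R.lay L (Cr i 1 i 1) N)) d1
    simp only [mul_assoc, sub_mul, mul_sub] at h
    rw [s1, reassoc s1, lay_mul_idn (Dt i) (by simp only []),
      idn_mul_lay_mul (Dt i) (by simp only [snoc_mul_eq])] at h
    rw [h, sub_add_cancel]
  rw [d1, mul_sub, ← mul_assoc, d2, add_mul, mul_assoc, mul_assoc, mul_assoc, t1,
    add_sub_cancel_right, f1]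

variable (x y : ℕ)

/-- The last merge of the explosion meets the split. The identity summand gives one copy; in the
crossing summand the crossing moves down past the dots by `dot_dot_cross`, is absorbed by the
splits, and induction supplies the remaining copies. -/
theorem blow_split_thin (B : P.GoodBasis) [HasThinRel B R] :
    R.lay L (Bl i (x + 1)) N * R.lay L (Sp i x 1) N = ((x + 1 : ℕ) : k) •
      (R.lay L (Sp i x 1) N * (R.lay (L ◂ strand i x) (Dt i) N *
        R.lay L (Bl i x) (strand i 1 * N))) := by
  induction x generalizing N with
  | zero =>
    rw [lay_blow_succ, lay_blow_zero]
    simp only [lay_Sp_zero_left, lay_Mg_zero_left, strand_zero, snoc_one, zero_add, Nat.cast_one,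
      one_smul, idn_mul_idn, mul_assoc]
  | succ x ih =>
    have hc : ((x + 1 + 1 : ℕ) : k) = 1 + ((x + 1 : ℕ) : k) := by push_cast; ring
    have ih := ih (strand i 1 * N)
    have a1 := split_assoc R L N i x 1 1
    have k1 := split_cross_one_one R (L ◂ strand i x) N i
    have d1 := dot_dot_cross R (L ◂ strand i x) N i B
    have f1 := lay_far (Bl i x) (Cr i 1 i 1) L 1 N (R := R)
    have f2 := lay_far (Sp i x 1) (Dt i) L 1 N (R := R)
    have f3 := lay_far (Mg i x 1) (Dt i) L 1 N (R := R)
    simp only [snoc_mul, mul_assoc, mul_one, one_mul, snoc_one] at f1 f2 f3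
    rw [lay_blow_succ]
    simp only [mul_assoc]
    rw [merge_split_thin_right]
    simp only [mul_add]
    rw [lay_mul_idn (Bl i (x + 1)) (by simp only []), reassoc ih, smul_mul_assoc, hc, add_smul,
      one_smul, add_right_inj]
    simp only [mul_smul_comm, mul_assoc]
    rw [reassoc₂ f1, reassoc₂ f2.symm, reassoc₃ d1, reassoc₂ a1, reassoc k1, ← reassoc₂ a1,
      reassoc₂ f2, ← lay_blow_succ]

theorem merge_blow_thin (B : P.GoodBasis) [HasThinRel B R] :
    R.lay L (Mg i x 1) N * R.lay L (Bl i (x + 1)) N = ((x + 1 : ℕ) : k) •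
      (R.lay (L ◂ strand i x) (Dt i) N * (R.lay L (Bl i x) (strand i 1 * N) *
        R.lay L (Mg i x 1) N)) := by
  induction x generalizing N with
  | zero =>
    rw [lay_blow_succ, lay_blow_zero]
    simp only [lay_Sp_zero_left, lay_Mg_zero_left, strand_zero, snoc_one, zero_add, Nat.cast_one,
      one_smul, idn_mul_idn, mul_assoc, idn_mul_idn_mul]
    rw [lay_mul_idn (Dt i) rfl, idn_mul_lay (Dt i) rfl]
  | succ x ih =>
    have hc : ((x + 1 + 1 : ℕ) : k) = 1 + ((x + 1 : ℕ) : k) := by push_cast; ring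
    have ih := ih (strand i 1 * N)
    have a1 := merge_assoc R L N i x 1 1
    have k1 := cross_merge_one_one R (L ◂ strand i x) N i
    have d1 := dot_dot_cross R (L ◂ strand i x) N i B
    have f1 := lay_far (Bl i x) (Cr i 1 i 1) L 1 N (R := R)
    have f2 := lay_far (Sp i x 1) (Dt i) L 1 N (R := R)
    have f3 := lay_far (Mg i x 1) (Dt i) L 1 N (R := R)
    simp only [snoc_mul, mul_assoc, mul_one, one_mul, snoc_one] at f1 f2 f3
    rw [lay_blow_succ, ← mul_assoc, merge_split_thin_right, add_mul, mul_assoc, mul_assoc,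
      idn_mul_lay_mul (Dt i) (by simp only [snoc_mul_eq]), reassoc₂ f3]
    rw [← mul_assoc (R.lay L (Mg i x 1) _) (R.lay L (Bl i (x + 1)) _), ih, smul_mul_assoc,
      hc, add_smul, one_smul, add_right_inj]
    simp only [mul_smul_comm, mul_assoc]
    rw [← reassoc₃ d1, reassoc₂ f1.symm, a1, reassoc k1, ← a1, reassoc₂ f2,
        lay_blow_succ R L (strand i 1 * N) i x]
    simp only [mul_assoc]

end Dot

end AffineWeb

namespace AffineWeb

open FrobeniusGreatPair SuperPresentation

variable {k : Type u} [Field k] {A : Type v} [NonUnitalRing A] [Module k A] [IsScalarTower k A A]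
  [SMulCommClass k A A] {P : FrobeniusGreatPair k A}

/-! ### White dots with splits, merges and coupons -/

section WhiteDot

variable (R : SuperPresentation k (webSig P thinDots)) (L N : Comps P) (i j : P.I) (x y : ℕ)
  [HasFinRel R] [CharZero k]

theorem whiteDot_split_thin (B : P.GoodBasis) [HasThinRel B R] :
    R.lay L (Wh i (x + 1)) N * R.lay L (Sp i x 1) N =
      R.lay L (Sp i x 1) N * (R.lay (L ◂ strand i x) (Dt i) N *
        R.lay L (Wh i x) (strand i 1 * N)) := by
  have h : ((x + 1 : ℕ) : k) ≠ 0 := Nat.cast_ne_zero.mpr (Nat.succ_ne_zero _)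
  rw [lay_whiteDot, lay_whiteDot, smul_mul_assoc, blow_split_thin R L N i x B, smul_smul,
    Nat.factorial_succ, Nat.cast_mul, mul_inv_rev, inv_mul_cancel_right₀ h]
  simp only [mul_smul_comm]

theorem merge_whiteDot_thin (B : P.GoodBasis) [HasThinRel B R] :
    R.lay L (Mg i x 1) N * R.lay L (Wh i (x + 1)) N =
      R.lay (L ◂ strand i x) (Dt i) N * (R.lay L (Wh i x) (strand i 1 * N) *
        R.lay L (Mg i x 1) N) := by
  have h : ((x + 1 : ℕ) : k) ≠ 0 := Nat.cast_ne_zero.mpr (Nat.succ_ne_zero _)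
  rw [lay_whiteDot, lay_whiteDot, mul_smul_comm, merge_blow_thin R L N i x B, smul_smul,
    Nat.factorial_succ, Nat.cast_mul, mul_inv_rev, inv_mul_cancel_right₀ h]
  simp only [mul_smul_comm, smul_mul_assoc]

/-- `split_cancel` allows a thin strand to be split off the right leg; the rest is the thin case and
coassociativity. -/
theorem whiteDot_split (B : P.GoodBasis) [HasThinRel B R] :
    R.lay L (Wh i (x + y)) N * R.lay L (Sp i x y) N =
      R.lay L (Sp i x y) N * (R.lay (L ◂ strand i x) (Wh i y) N *
        R.lay L (Wh i x) (strand i y * N)) := by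
  induction y generalizing N with
  | zero =>
    simp only [lay_Sp_zero_right, lay_whiteDot_zero, strand_zero, one_mul, add_zero, snoc_mul_eq]
    rw [lay_mul_idn (Wh i x) rfl, idn_mul_idn_mul, idn_mul_lay (Wh i x) rfl]
  | succ y ih =>
    refine split_cancel R (L := L ◂ strand i x) (N := N) (i := i) (x := y) (y := 1) ?_ ?_ ?_
    · rw [mul_assoc, lay_mul_idn (Sp i x (y + 1)) (by simp only [mul_assoc, snoc_mul_eq])]
    · rw [mul_assoc, mul_assoc, lay_mul_idn (Wh i x) (by simp only [mul_assoc, snoc_mul_eq])]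
    have a1 := split_assoc R L N i x y 1
    have w1 := whiteDot_split_thin R L N i (x + y) B
    have w2 := whiteDot_split_thin R (L ◂ strand i x) N i y B
    have f1 := lay_far (Sp i x y) (Dt i) L 1 N (R := R)
    have f2 := lay_far (Wh i x) (Sp i y 1) L 1 N (R := R)
    simp only [snoc_mul, mul_assoc, mul_one, one_mul] at f1 f2 ⊢
    rw [← a1, show x + (y + 1) = x + y + 1 by omega, reassoc₂₃ w1, ih, reassoc₂ f1.symm,
      reassoc₂ a1, f2, reassoc₂₃ w2]

theorem merge_whiteDot (B : P.GoodBasis) [HasThinRel B R] :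
    R.lay L (Mg i x y) N * R.lay L (Wh i (x + y)) N =
      R.lay (L ◂ strand i x) (Wh i y) N * (R.lay L (Wh i x) (strand i y * N) *
        R.lay L (Mg i x y) N) := by
  induction y generalizing N with
  | zero =>
    simp only [lay_Mg_zero_right, lay_whiteDot_zero, strand_zero, one_mul, add_zero, snoc_mul_eq]
    rw [lay_mul_idn (Wh i x) rfl, idn_mul_lay (Wh i x) rfl]
  | succ y ih =>
    refine merge_cancel R (L := L ◂ strand i x) (N := N) (i := i) (x := y) (y := 1) ?_ ?_ ?_
    · rw [idn_mul_lay_mul (Mg i x (y + 1)) (by simp only [mul_assoc, snoc_mul_eq])]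
    · rw [idn_mul_lay_mul (Wh i (y + 1)) (by simp only [mul_assoc, snoc_mul_eq])]
    have a1 := merge_assoc R L N i x y 1
    have w1 := merge_whiteDot_thin R L N i (x + y) B
    have w2 := merge_whiteDot_thin R (L ◂ strand i x) N i y B
    have f1 := lay_far (Mg i x y) (Dt i) L 1 N (R := R)
    have f2 := lay_far (Wh i x) (Mg i y 1) L 1 N (R := R)
    simp only [snoc_mul, mul_assoc, mul_one, one_mul] at f1 f2 ⊢
    rw [← reassoc₂ a1, show x + (y + 1) = x + y + 1 by omega, w1, reassoc₂ f1, reassoc₂₃ (ih _),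
      reassoc₂₃ w2, reassoc₂ f2.symm, ← a1]

theorem coupon_whiteDot (B : P.GoodBasis) [HasThinRel B R] {p : ZMod 2} {f : A}
    (hf : IsCoupon P x j i p f) :
    R.lay L (Cp x j i p f hf) N * R.lay L (Wh j x) N =
      R.lay L (Wh i x) N * R.lay L (Cp x j i p (P.ψ.symm f) hf.ψ_symm) N := by
  induction x generalizing N with
  | zero =>
    rw [lay_Cp_zero, lay_Cp_zero, lay_whiteDot_zero, lay_whiteDot_zero]
  | succ x ih =>
    refine split_cancel R (L := L) (N := N) (i := j) (x := x) (y := 1) ?_ ?_ ?_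
    · rw [mul_assoc, lay_mul_idn (Wh j (x + 1)) rfl]
    · rw [mul_assoc, lay_mul_idn (Cp (x + 1) j i _ _ _) rfl]
    have c1 := coupon_split R L N x 1 hf
    have c2 := coupon_split R L N x 1 hf.ψ_symm
    have w1 := whiteDot_split_thin R L N j x B
    have w2 := whiteDot_split_thin R L N i x B
    have d1 := coupon_dot R (L ◂ strand i x) N i j B (hf.mono (z' := 1) (by omega))
    have d2 := coupon_dot R (L ◂ strand j x) N i j B (hf.mono (z' := 1) (by omega))
    have f1 := lay_far' (Cp x j i p f (hf.mono (by omega))) (Dt j) L 1 N (R := R)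
    have f2 := lay_far (Wh i x) (Cp 1 j i p _ (hf.ψ_symm.mono (z' := 1) (by omega))) L 1 N (R := R)
    simp only [snoc_mul, mul_assoc, mul_one, one_mul] at f1 f2 ⊢
    rw [w1, reassoc₂₃ c1, reassoc₂ f1, ih, reassoc₂ d1, c2, reassoc₂₃ w2, reassoc₂ f2]

end WhiteDot

end AffineWeb

namespace AffineWeb

open FrobeniusGreatPair SuperPresentation

variable {k : Type u} [Field k] {A : Type v} [NonUnitalRing A] [Module k A] [IsScalarTower k A A]
  [SMulCommClass k A A] {P : FrobeniusGreatPair k A}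

/-! ### A white dot crossing a thin strand -/

section WhiteDotCross

variable (R : SuperPresentation k (webSig P thinDots)) (L N : Comps P) (i j : P.I) (x y : ℕ)
  [HasFinRel R] [CharZero k]

/-- Induction on `x` with a merge below. The peeled-off thin dot and the remaining white dot each
leave one teleporter term behind. On the other side, the same two terms arise when the merge meets
the split and merge-split produces an identity and a crossing summand. -/
theorem whiteDot_cross_thin (B : P.GoodBasis) [HasThinRel B R] :
    R.lay L (Wh i (x + 1)) (strand j 1 * N) * R.lay L (Cr i (x + 1) j 1) N =
      R.lay L (Cr i (x + 1) j 1) N * R.lay (L ◂ strand j 1) (Wh i (x + 1)) N -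
      R.lay L (Sp i 1 x) (strand j 1 * N) * (R.lay L (Te B i j 1 (strand i x)) N *
        (R.lay (L ◂ strand j 1) (Wh i x) (strand i 1 * N) *
          R.lay (L ◂ strand j 1) (Mg i x 1) N)) := by
  induction x generalizing L with
  | zero =>
    simp only [zero_add, lay_whiteDot_one, lay_Sp_zero_right, lay_Mg_zero_left, lay_whiteDot_zero,
      strand_zero]
    rw [dot_cross R L N i j B, idn_mul_lay_mul (Te B i j 1 1) (by simp only [mul_assoc, one_mul]),
      idn_mul_idn, lay_mul_idn (Te B i j 1 1) (by simp only [mul_assoc, one_mul, snoc_mul_eq])]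
  | succ x ih =>
    have e : 1 + (x + 1) = x + 1 + 1 := by omega
    have e' : 1 + x = x + 1 := by omega
    refine merge_cancel R (L := L) (N := strand j 1 * N) (i := i) (x := 1) (y := x + 1) ?_ ?_ ?_
    · rw [e, idn_mul_lay_mul (Wh i (x + 1 + 1)) rfl]
    · rw [e, mul_sub, idn_mul_lay_mul (Cr i (x + 1 + 1) j 1)
        (show _ = L * ((strand i (x + 1 + 1) * strand j 1) * N) by rw [mul_assoc]),
        idn_mul_lay_mul (Sp i 1 (x + 1)) (by rw [← e])]
    have w1 := merge_whiteDot R L (strand j 1 * N) i 1 (x + 1) B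
    have w2 := merge_whiteDot R (L ◂ strand j 1) N i 1 (x + 1) B
    have w3 := merge_whiteDot R (L ◂ strand j 1) (strand i 1 * N) i 1 x B
    have c1 := merge_cross_right R L N i j 1 (x + 1)
    have f1 := lay_far (Dt i) (Cr i (x + 1) j 1) L 1 N (R := R)
    have f2 := lay_far (Cr i 1 j 1) (Wh i (x + 1)) L 1 N (R := R)
    have f3 := lay_far (Cr i 1 j 1) (Mg i x 1) L 1 N (R := R)
    have f4 := lay_far (Cr i 1 j 1) (Wh i x) L 1 (strand i 1 * N) (R := R)
    have f5 := lay_far (Dt i) (Mg i x 1) (L ◂ strand j 1) 1 N (R := R)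
    have d1 := dot_cross R L (strand i (x + 1) * N) i j B
    have t1 := teleporter_one_cross_right B i j R L 1 N i (x + 1)
    have t2 := teleporter_mid B i j R L 1 N 1 1 (Wh i (x + 1))
    have t3 := teleporter_mid B i j R L 1 N 1 1 (Mg i 1 x)
    have t4 := teleporter_one_cross_left B i j R L (strand i x) N i 1
    have m1 := merge_split_thin_left R L (strand j 1 * N) i x
    have m2 := merge_assoc R (L ◂ strand j 1) N i 1 x 1
    have x1 := cross_merge_thin R (L ◂ strand j 1) N i (x + 1)
    have h := ih (L ◂ strand i 1)
    simp only [snoc_mul, mul_assoc, mul_one, one_mul, e, e', lay_whiteDot_one, snoc_one] at *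
    -- The thin strand's own dot is moved through its crossing here; the induction hypothesis is
    -- used afterwards for the white dot that remains.
    have p1 : R.lay L (Mg i 1 (x + 1)) (strand j 1 * N) * (R.lay L (Wh i (x + 1 + 1))
        (strand j 1 * N) * R.lay L (Cr i (x + 1 + 1) j 1) N) =
        R.lay (L ◂ strand i 1) (Wh i (x + 1)) (strand j 1 * N) *
          (R.lay (L ◂ strand i 1) (Cr i (x + 1) j 1) N *
          (R.lay L (Cr i 1 j 1) (strand i (x + 1) * N) *
          (R.lay (L ◂ strand j 1) (Dt i) (strand i (x + 1) * N) *
            R.lay (L ◂ strand j 1) (Mg i 1 (x + 1)) N))) -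
        R.lay L (Te B i j 1 (strand i (x + 1))) N *
          (R.lay (L ◂ strand j 1) (Wh i (x + 1)) (strand i 1 * N) *
            R.lay (L ◂ strand j 1) (Mg i (x + 1) 1) N) := by
      rw [reassoc₂₃ w1, c1, reassoc₂ f1, ← mul_assoc (R.lay L (Dt i) _), d1, sub_mul, mul_sub,
        mul_sub, reassoc₂ t1, x1, reassoc₂ t2.symm]
      simp only [mul_assoc]
    rw [p1, reassoc h, sub_mul]
    simp only [mul_assoc]
    rw [reassoc₂ f2.symm, ← w2, ← reassoc₂₃ c1, mul_sub, reassoc m1, add_mul,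
      idn_mul_lay_mul (Te B i j 1 (strand i (x + 1))) (by simp only [mul_assoc])]
    simp only [mul_assoc]
    rw [reassoc₂ t3.symm, reassoc₂₃ w3, m2, reassoc₂ t4, reassoc₂ f5, reassoc₂ f4, reassoc₂ f3]
    abel

end WhiteDotCross

end AffineWeb

namespace AffineWeb

open FrobeniusGreatPair SuperPresentation

variable {k : Type u} [Field k] {A : Type v} [NonUnitalRing A] [Module k A] [IsScalarTower k A A]
  [SMulCommClass k A A] {P : FrobeniusGreatPair k A}

/-! ### Summands of the dot-crossing relation next to a thin strand -/

section WhiteDotCross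

variable (B : P.GoodBasis) (R : SuperPresentation k (webSig P thinDots)) (L N : Comps P) (i j : P.I)

/-- The part above the split of the `j`-strand of a summand of the dot-crossing relation. -/
noncomputable def whiteDotCrossTail (x a b t : ℕ) : R.DiagAlg :=
  R.lay L (Sp i t a) (strand j b * (strand j t * N)) *
    (R.lay L (Te B i j t (strand i a * strand j b)) N *
    (R.lay (L ◂ strand j t) (Cr i a j b) (strand i t * N) *
    (R.lay (L ◂ strand j t ◂ strand j b) (Wh i a) (strand i t * N) *
    (R.lay (L ◂ strand j t ◂ strand j b) (Mg i a t) N *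
      R.lay L (Mg j t b) (strand i x * N)))))

/-- The thicknesses `a` and `b` stand for `x - t` and `y - t`; as independent parameters they keep
truncated subtraction out of the computations. -/
noncomputable def whiteDotCrossTerm (x a b t : ℕ) : R.DiagAlg :=
  R.lay (L ◂ strand i x) (Sp j b t) N * whiteDotCrossTail B R L N i j x a b t

variable {x y a b t : ℕ} [HasFinRel R] [CharZero k]

/-- The right-hand sides here and in the next two lemmas, with thicknesses suitably shifted, have
the same surroundings. They differ in whether the white dot lies below the crossing with the thin
strand, lies above it, or is part of the teleporter correction; these are the three terms of
`whiteDot_cross_thin`. -/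
theorem whiteDotCrossTerm_mul (hx : a + t = x) (hy : t + b = y) :
    whiteDotCrossTerm B R L (strand j 1 * N) i j x a b t *
      (R.lay (L ◂ strand j y) (Cr i x j 1) N * R.lay L (Mg j y 1) (strand i x * N)) =
    R.lay (L ◂ strand i x) (Sp j b t) (strand j 1 * N) *
    (R.lay L (Sp i t a) (strand j b * (strand j t * (strand j 1 * N))) *
    (R.lay L (Te B i j t (strand i a * strand j b)) (strand j 1 * N) *
    (R.lay (L ◂ strand j t) (Cr i a j b) (strand i t * (strand j 1 * N)) *
    (R.lay (L ◂ strand j t ◂ strand j b ◂ strand i a) (Cr i t j 1) N *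
    (R.lay (L ◂ strand j t ◂ strand j b) (Wh i a) (strand j 1 * (strand i t * N)) *
    (R.lay (L ◂ strand j t ◂ strand j b) (Cr i a j 1) (strand i t * N) *
    (R.lay (L ◂ strand j t ◂ strand j b ◂ strand j 1) (Mg i a t) N *
    (R.lay (L ◂ strand j t) (Mg j b 1) (strand i x * N) *
      R.lay L (Mg j t (b + 1)) (strand i x * N))))))))) := by
  have f1 := lay_far (Mg j t b) (Cr i x j 1) L 1 N (R := R)
  have m1 := merge_assoc R L (strand i x * N) j t b 1
  have c1 := merge_cross_right R (L ◂ strand j t ◂ strand j b) N i j a t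
  have f2 := lay_far (Wh i a) (Cr i t j 1) (L ◂ strand j t ◂ strand j b) 1 N (R := R)
  simp only [snoc_mul, mul_assoc, mul_one, one_mul, snoc_one, hx, hy] at *
  simp only [whiteDotCrossTerm, whiteDotCrossTail, mul_assoc]
  rw [reassoc₂ f1, m1, reassoc₂₃ c1, reassoc₂ f2]

theorem split_cross_mul_whiteDotCrossTail (hx : t + a = x) (hx' : a + t = x) :
    R.lay (L ◂ strand i x) (Sp j b t) (strand j 1 * N) *
    (R.lay (L ◂ strand i x ◂ strand j b) (Cr j t j 1) N *
    (R.lay (L ◂ strand i x) (Mg j b 1) (strand j t * N) *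
      whiteDotCrossTail B R L N i j x a (b + 1) t)) =
    R.lay (L ◂ strand i x) (Sp j b t) (strand j 1 * N) *
    (R.lay L (Sp i t a) (strand j b * (strand j t * (strand j 1 * N))) *
    (R.lay L (Te B i j t (strand i a * strand j b)) (strand j 1 * N) *
    (R.lay (L ◂ strand j t) (Cr i a j b) (strand i t * (strand j 1 * N)) *
    (R.lay (L ◂ strand j t ◂ strand j b ◂ strand i a) (Cr i t j 1) N *
    (R.lay (L ◂ strand j t ◂ strand j b) (Cr i a j 1) (strand i t * N) *
    (R.lay (L ◂ strand j t ◂ strand j b ◂ strand j 1) (Wh i a) (strand i t * N) *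
    (R.lay (L ◂ strand j t ◂ strand j b ◂ strand j 1) (Mg i a t) N *
    (R.lay (L ◂ strand j t) (Mg j b 1) (strand i x * N) *
      R.lay L (Mg j t (b + 1)) (strand i x * N))))))))) := by
  have f1 := lay_far (Sp i t a) (Mg j b 1) L 1 (strand j t * N) (R := R)
  have t1 := teleporter_mid B i j R L (strand i a) N t 1 (Mg j b 1)
  have c1 := merge_cross_left R (L ◂ strand j t) (strand i t * N) i j a b
  have f2 := lay_far (Mg j b 1) (Wh i a) (L ◂ strand j t) 1 (strand i t * N) (R := R)
  have f3 := lay_far (Mg j b 1) (Mg i a t) (L ◂ strand j t) 1 N (R := R)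
  have f4 := lay_far (Sp i t a) (Cr j t j 1) L (strand j b) N (R := R)
  have t2 := teleporter_cross B i j R L (strand i a * strand j b) N t j
  have f5 := lay_far (Cr i a j b) (Cr i t j 1) (L ◂ strand j t) 1 N (R := R)
  simp only [snoc_mul, mul_assoc, mul_one, one_mul, snoc_one, hx, hx'] at *
  simp only [whiteDotCrossTail, mul_assoc]
  rw [reassoc₂ f1.symm, reassoc₂ t1.symm, reassoc₂₃ c1, reassoc₂ f2, reassoc₂ f3,
    reassoc₂ f4.symm, reassoc₂ t2, reassoc₂ f5.symm]

/-- By `merge_teleporter` the teleporter of thickness `t + 1` opens into one of thickness `t` and a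
thin one. The thin one is then moved through the crossings until it takes the place of the
correction term for the white dot. -/
theorem split_merge_mul_whiteDotCrossTail (hx : a + t + 1 = x) :
    R.lay (L ◂ strand i x) (Sp j b t) (strand j 1 * N) *
    (R.lay (L ◂ strand i x ◂ strand j b) (Mg j t 1) N *
      whiteDotCrossTail B R L N i j x a b (t + 1)) =
    R.lay (L ◂ strand i x) (Sp j b t) (strand j 1 * N) *
    (R.lay L (Sp i t (a + 1)) (strand j b * (strand j t * (strand j 1 * N))) *
    (R.lay L (Te B i j t (strand i (a + 1) * strand j b)) (strand j 1 * N) *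
    (R.lay (L ◂ strand j t) (Cr i (a + 1) j b) (strand i t * (strand j 1 * N)) *
    (R.lay (L ◂ strand j t ◂ strand j b ◂ strand i (a + 1)) (Cr i t j 1) N *
    (R.lay (L ◂ strand j t ◂ strand j b) (Sp i 1 a) (strand j 1 * (strand i t * N)) *
    (R.lay (L ◂ strand j t ◂ strand j b) (Te B i j 1 (strand i a)) (strand i t * N) *
    (R.lay (L ◂ strand j t ◂ strand j b ◂ strand j 1) (Wh i a) (strand i 1 * (strand i t * N)) *
    (R.lay (L ◂ strand j t ◂ strand j b ◂ strand j 1) (Mg i a 1) (strand i t * N) *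
    (R.lay (L ◂ strand j t ◂ strand j b ◂ strand j 1) (Mg i (a + 1) t) N *
    (R.lay (L ◂ strand j t) (Mg j b 1) (strand i x * N) *
      R.lay L (Mg j t (b + 1)) (strand i x * N))))))))))) := by
  have h1 : 1 + a = a + 1 := by omega
  have h2 : 1 + t = t + 1 := by omega
  have h3 : 1 + b = b + 1 := by omega
  have h4 : t + 1 + a = x := by omega
  have h5 : a + (t + 1) = x := by omega
  have h6 : t + (a + 1) = x := by omega
  have h7 : a + 1 + t = x := by omega
  have h8 : t + (1 + a) = x := by omega
  have h9 : a + (1 + t) = x := by omega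
  have f1 := lay_far (Sp i (t + 1) a) (Mg j t 1) L (strand j b) N (R := R)
  have t1 := merge_teleporter B i j R L (strand i a * strand j b) N t
  have s1 := split_assoc R L (strand j b * (strand j t * (strand j 1 * N))) i t 1 a
  have f2 := lay_far (Mg j t 1) (Cr i a j b) L 1 (strand i (t + 1) * N) (R := R)
  have f3 := lay_far (Mg j t 1) (Wh i a) L (strand j b) (strand i (t + 1) * N) (R := R)
  have f4 := lay_far (Mg j t 1) (Mg i a (t + 1)) L (strand j b) N (R := R)
  have m1 := merge_assoc R L (strand i x * N) j t 1 b
  have f5 := lay_far (Cr i a j b) (Mg i t 1) (L ◂ strand j t ◂ strand j 1) 1 N (R := R)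
  have f6 := lay_far (Wh i a) (Mg i t 1) (L ◂ strand j t ◂ strand j 1 ◂ strand j b) 1 N (R := R)
  have f7 := lay_far (Sp i 1 a) (Cr i t j 1) (L ◂ strand j t ◂ strand j b) 1 N (R := R)
  have c1 := split_cross_right R (L ◂ strand j t) (strand i t * (strand j 1 * N)) i j 1 a b
  have t2 := teleporter_mid B i j R L 1 (strand j 1 * N) t (strand j b) (Sp i 1 a)
  have t3 := teleporter_one_cross_right B i j R (L ◂ strand j t ◂ strand j b) (strand i a) N i t
  have t4 := teleporter_one_cross_left' B i j R (L ◂ strand j t) (strand i a * strand i t) N j b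
  have t5 := teleporter_mid B i j R (L ◂ strand j t) 1 N 1 (strand i t) (Cr i a j b)
  have m2 := merge_assoc R (L ◂ strand j t ◂ strand j b ◂ strand j 1) N i a 1 t
  have f8 := lay_far (Wh i a) (Cr i t i 1) (L ◂ strand j t ◂ strand j b ◂ strand j 1) 1 N (R := R)
  have x1 := cross_merge_thin R (L ◂ strand j t ◂ strand j b ◂ strand j 1 ◂ strand i a) N i t
  have g1 := lay_far (Cr j 1 j b) (Wh i a) (L ◂ strand j t) 1 (strand i t * (strand i 1 * N))
    (R := R)
  have g2 := lay_far (Cr j 1 j b) (Mg i t 1) (L ◂ strand j t) (strand i a) N (R := R)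
  have g3 := lay_far (Cr j 1 j b) (Mg i a (t + 1)) (L ◂ strand j t) 1 N (R := R)
  have x2 := cross_merge_thin_left R (L ◂ strand j t) (strand i x * N) b j
  simp only [snoc_mul, mul_assoc, mul_one, one_mul, snoc_one, hx, h1, h2, h3, h4, h5, h6, h7, h8,
      h9] at *
  simp only [whiteDotCrossTail, mul_assoc]
  rw [reassoc₂ f1.symm, reassoc t1]
  simp only [mul_assoc]
  rw [reassoc₂ s1, reassoc₂ f2, reassoc₂ f3, reassoc₂ f4, m1, reassoc₂ f5.symm, reassoc₂ f6.symm,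
    reassoc₂ f7.symm, reassoc₂₃ c1, reassoc₂ t2, reassoc₂ t3, reassoc₂ t4, reassoc₂ t5.symm,
    reassoc₂ m2, reassoc₂ f8.symm, reassoc x1, reassoc₂ g1, reassoc₂ g2, reassoc₂ g3, reassoc x2]

end WhiteDotCross

end AffineWeb

namespace AffineWeb

open FrobeniusGreatPair SuperPresentation

variable {k : Type u} [Field k] {A : Type v} [NonUnitalRing A] [Module k A] [IsScalarTower k A A]
  [SMulCommClass k A A] {P : FrobeniusGreatPair k A}

/-! ### The dot-crossing relation for white dots -/

section WhiteDotCross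

variable (B : P.GoodBasis) (R : SuperPresentation k (webSig P thinDots)) (L N : Comps P) (i j : P.I)

/-- One of the two families of diagrams that arise when a merge of the `j`-strand meets a summand
of the dot-crossing relation: the thin strand crosses the split-off strand. -/
noncomputable def crossingPart (x a b t : ℕ) : R.DiagAlg :=
  R.lay (L ◂ strand i x) (Sp j b t) (strand j 1 * N) *
    (R.lay (L ◂ strand i x ◂ strand j b) (Cr j t j 1) N *
    (R.lay (L ◂ strand i x) (Mg j b 1) (strand j t * N) *
      whiteDotCrossTail B R L N i j x a (b + 1) t))

/-- The other family: the thin strand merges with the split-off strand. -/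
noncomputable def mergingPart (x a b t : ℕ) : R.DiagAlg :=
  R.lay (L ◂ strand i x) (Sp j b t) (strand j 1 * N) *
    (R.lay (L ◂ strand i x ◂ strand j b) (Mg j t 1) N *
      whiteDotCrossTail B R L N i j x a b (t + 1))

variable [HasFinRel R] [CharZero k]

theorem merge_mul_whiteDotCrossTerm_zero (x y : ℕ) :
    R.lay (L ◂ strand i x) (Mg j y 1) N * whiteDotCrossTerm B R L N i j x x (y + 1) 0 =
      crossingPart B R L N i j x x y 0 := by
  have h : R.idn (L ◂ strand i x * (strand j (y + 1) * N)) *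
      whiteDotCrossTail B R L N i j x x (y + 1) 0 =
        whiteDotCrossTail B R L N i j x x (y + 1) 0 := by
    rw [whiteDotCrossTail, idn_mul_lay_mul (Sp i 0 x)
      (by simp only [snoc_mul_eq, strand_zero, one_mul, zero_add])]
  rw [whiteDotCrossTerm, crossingPart, lay_Sp_zero_right, lay_Sp_zero_right, lay_Cr_zero_left, h,
    strand_zero, one_mul,
    idn_mul_lay_mul (Mg j y 1) (by simp only [snoc_mul_eq, mul_assoc]),
    idn_mul_lay_mul (Mg j y 1) (by simp only [snoc_mul_eq, mul_assoc])]

theorem merge_mul_whiteDotCrossTerm_full (x a w : ℕ) :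
    R.lay (L ◂ strand i x) (Mg j w 1) N * whiteDotCrossTerm B R L N i j x a 0 (w + 1) =
      mergingPart B R L N i j x a 0 w := by
  rw [whiteDotCrossTerm, mergingPart, lay_Sp_zero_left, lay_Sp_zero_left, strand_zero, snoc_one,
    idn_mul_lay_mul (Mg j w 1) (by simp only [mul_assoc]),
    lay_mul_idn_mul (Mg j w 1) (by simp only [mul_assoc])]

/-- The merge meets the split of the `j`-strand, and merge-split sends the thin strand to either
leg. The two preceding lemmas are the boundary cases, in which one leg is empty and one family is
absent. -/
theorem merge_mul_whiteDotCrossTerm (x a b w : ℕ) :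
    R.lay (L ◂ strand i x) (Mg j (b + w + 1) 1) N *
        whiteDotCrossTerm B R L N i j x a (b + 1) (w + 1) =
      mergingPart B R L N i j x a (b + 1) w + crossingPart B R L N i j x a b (w + 1) := by
  rw [whiteDotCrossTerm, ← mul_assoc, merge_split_one_right, mergingPart, crossingPart, add_mul]
  simp only [mul_assoc]

variable {x y a b t : ℕ}

theorem whiteDotCrossTerm_mul_of_zero (hy : x + b = y) :
    whiteDotCrossTerm B R L (strand j 1 * N) i j x 0 b x *
      (R.lay (L ◂ strand j y) (Cr i x j 1) N * R.lay L (Mg j y 1) (strand i x * N)) =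
    crossingPart B R L N i j x 0 b x := by
  rw [whiteDotCrossTerm_mul B R L N i j (by omega) hy, crossingPart,
    split_cross_mul_whiteDotCrossTail B R L N i j (by omega) (by omega)]
  simp only [lay_Cr_zero_left, lay_whiteDot_zero, strand_zero, one_mul, snoc_mul_eq, mul_assoc]

/-- Lifting the white dot past the thin strand gives the crossing family; the correction is a member
of the merging family, where the teleporter is thicker by one. -/
theorem whiteDotCrossTerm_mul_of_succ [HasThinRel B R] (hx : a + t + 1 = x) (hy : t + b = y) :
    whiteDotCrossTerm B R L (strand j 1 * N) i j x (a + 1) b t *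
      (R.lay (L ◂ strand j y) (Cr i x j 1) N * R.lay L (Mg j y 1) (strand i x * N)) =
    crossingPart B R L N i j x (a + 1) b t - mergingPart B R L N i j x a b t := by
  rw [whiteDotCrossTerm_mul B R L N i j (by omega) hy, crossingPart,
    split_cross_mul_whiteDotCrossTail B R L N i j (by omega) (by omega), mergingPart,
    split_merge_mul_whiteDotCrossTail B R L N i j hx,
    reassoc (whiteDot_cross_thin R (L ◂ strand j t ◂ strand j b) (strand i t * N) i j a B)]
  simp only [sub_mul, mul_sub, mul_assoc]

/-- Induction on `y`, tested below with a merge of a thin `j`-strand. Both sides become the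
alternating sum of the crossing parts minus that of the merging parts: on the left the latter are
corrections from lifting the dot, on the right they come from merge-split with the index shifted by
one, which changes the sign. -/
theorem whiteDot_cross [HasThinRel B R] :
    R.lay L (Wh i x) (strand j y * N) * R.lay L (Cr i x j y) N =
      ∑ t ∈ Finset.range (x + 1), if t ≤ y then
        (-1 : k) ^ t • whiteDotCrossTerm B R L N i j x (x - t) (y - t) t else 0 := by
  induction y generalizing N with
  | zero =>
    rw [Finset.sum_range_succ', Finset.sum_eq_zero fun t _ => if_neg (by omega)]
    simp only [whiteDotCrossTerm, whiteDotCrossTail, lay_Cr_zero_right, lay_Sp_zero_left,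
      lay_Mg_zero_left, lay_Mg_zero_right, lay_teleporter_zero, strand_zero, one_mul, mul_one,
      zero_add, le_refl, if_true, pow_zero, one_smul, Nat.sub_zero, snoc_one, idn_mul_idn_mul]
    rw [lay_mul_idn (Wh i x) rfl, snoc_mul_eq]
    simp only [idn_mul_idn_mul, idn_mul_idn]
    rw [lay_mul_idn (Wh i x) rfl, idn_mul_lay (Wh i x) rfl]
  | succ y ih =>
    refine merge_cancel R (L := L ◂ strand i x) (N := N) (i := j) (x := y) (y := 1) ?_ ?_ ?_
    · rw [idn_mul_lay_mul (Wh i x) (by simp only [snoc_mul_eq])]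
    · rw [Finset.mul_sum]
      refine Finset.sum_congr rfl fun t _ => ?_
      split_ifs with h
      · have e : y + 1 = y + 1 - t + t := by omega
        rw [mul_smul_comm, whiteDotCrossTerm,
          idn_mul_lay_mul (Sp j (y + 1 - t) t) (by simp only [← e])]
      · rw [mul_zero]
    set p1 : ℕ → R.DiagAlg := fun t => if t ≤ y then
      (-1 : k) ^ t • mergingPart B R L N i j x (x - t - 1) (y - t) t else 0 with hp1
    set p2 : ℕ → R.DiagAlg := fun t => if t ≤ y then
      (-1 : k) ^ t • crossingPart B R L N i j x (x - t) (y - t) t else 0 with hp2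
    have f1 := lay_far' (Wh i x) (Mg j y 1) L 1 N (R := R)
    simp only [mul_one, one_mul] at f1
    have hl : R.lay (L ◂ strand i x) (Mg j y 1) N *
        (R.lay L (Wh i x) (strand j (y + 1) * N) * R.lay L (Cr i x j (y + 1)) N) =
        ∑ t ∈ Finset.range (x + 1), p2 t - ∑ t ∈ Finset.range x, p1 t := by
      rw [reassoc₂ f1.symm, merge_cross_left R L N i j x y, mul_assoc,
        reassoc (ih (strand j 1 * N)), Finset.sum_mul, Finset.sum_range_succ,
        Finset.sum_range_succ, add_sub_right_comm, ← Finset.sum_sub_distrib]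
      congr 1
      · refine Finset.sum_congr rfl fun t ht => ?_
        have ht := Finset.mem_range.mp ht
        simp only [hp1, hp2]
        split_ifs with h
        · obtain ⟨a, rfl⟩ : ∃ a, x = a + t + 1 := ⟨x - t - 1, by omega⟩
          rw [show a + t + 1 - t = a + 1 by omega, show a + 1 - 1 = a by omega, smul_mul_assoc,
            whiteDotCrossTerm_mul_of_succ B R L N i j rfl (by omega), smul_sub]
        · rw [zero_mul, sub_zero]
      -- In the last summand, `t = x`, no white dot remains, so lifting it leaves no correction.
      · simp only [hp2]
        split_ifs with h
        · rw [Nat.sub_self, smul_mul_assoc, whiteDotCrossTerm_mul_of_zero B R L N i j (by omega)]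
        · rw [zero_mul]
    -- The summand for `t + 1` contains the merging part for `t` and the crossing part for `t + 1`;
    -- the summand for 0 has only a crossing part and is kept apart.
    rw [hl, Finset.sum_range_succ', Finset.mul_sum, Finset.sum_range_succ', add_sub_right_comm,
      ← Finset.sum_sub_distrib]
    congr 1
    · refine Finset.sum_congr rfl fun t ht => ?_
      simp only [hp1, hp2]
      -- For `t = y` the whole `j`-strand is teleported and there is no crossing part; for larger
      -- `t` everything vanishes.
      rcases lt_trichotomy t y with h | rfl | h
      · obtain ⟨b, rfl⟩ : ∃ b, y = b + t + 1 := ⟨y - t - 1, by omega⟩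
        rw [if_pos (by omega), if_pos (by omega), if_pos (by omega), Nat.sub_sub x t 1,
          show b + t + 1 - (t + 1) = b by omega, show b + t + 1 - t = b + 1 by omega,
          show b + t + 1 + 1 - (t + 1) = b + 1 by omega, mul_smul_comm,
          merge_mul_whiteDotCrossTerm, pow_succ]
        module
      · rw [if_neg (by omega), if_pos le_rfl, if_pos le_rfl, Nat.sub_sub x t 1, Nat.sub_self,
          Nat.sub_self, mul_smul_comm, merge_mul_whiteDotCrossTerm_full, pow_succ]
        module
      · rw [if_neg (by omega), if_neg (by omega), if_neg (by omega), mul_zero, sub_zero]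
    · simp only [hp2]
      rw [if_pos (Nat.zero_le _), if_pos (Nat.zero_le _), mul_smul_comm, Nat.sub_zero, Nat.sub_zero,
        Nat.sub_zero, merge_mul_whiteDotCrossTerm_zero]

end WhiteDotCross

end AffineWeb

namespace AffineWeb

open FrobeniusGreatPair SuperPresentation

variable {k : Type u} [Field k] {A : Type v} [NonUnitalRing A] [Module k A] [IsScalarTower k A A]
  [SMulCommClass k A A] {P : FrobeniusGreatPair k A}

/-! ### Substitutions that change only the dots -/

section DotMap

variable {D D' : ℕ → Prop}

/-- The substitution that fixes all generators except the dots, and sends the dots to the given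
diagrams. -/
def dotMap (d : ∀ (i : P.I) (z : ℕ+), D z → Dia P D' (strand i z) (strand i z)) :
    ∀ g : (webSig P D).Gen, WExpr k (webSig P D') ((webSig P D).src g) ((webSig P D).tgt g)
  | .split i x y => WExpr.gen (G := webSig P D') (.split i x y)
  | .merge i x y => WExpr.gen (G := webSig P D') (.merge i x y)
  | .cross i j x y => WExpr.gen (G := webSig P D') (.cross i j x y)
  | .coupon z j i p f hf => WExpr.gen (G := webSig P D') (.coupon z j i p f hf)
  | .dot i z hz => d i z hz

variable {d : ∀ (i : P.I) (z : ℕ+), D z → Dia P D' (strand i z) (strand i z)}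

theorem hasParity_dotMap (hd : ∀ i z hz, (d i z hz).HasParity 0) (g : (webSig P D).Gen) :
    (dotMap d g).HasParity ((webSig P D).par g) := by
  cases g with
  | split i x y => exact .gen (G := webSig P D') (.split i x y)
  | merge i x y => exact .gen (G := webSig P D') (.merge i x y)
  | cross i j x y => exact .gen (G := webSig P D') (.cross i j x y)
  | coupon z j i p f hf => exact .gen (G := webSig P D') (.coupon z j i p f hf)
  | dot i z hz => exact hd i z hz

theorem bind_split (i : P.I) (x y : ℕ) : (split i x y).bind (dotMap d) = split i x y := by
  rcases x with _ | x
  · exact bind_eqE _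
  rcases y with _ | y
  · exact bind_eqE (mul_one (strand i (x + 1))).symm
  · rfl

theorem bind_merge (i : P.I) (x y : ℕ) : (merge i x y).bind (dotMap d) = merge i x y := by
  rcases x with _ | x
  · exact bind_eqE _
  rcases y with _ | y
  · exact bind_eqE (mul_one (strand i (x + 1)))
  · rfl

theorem bind_cross (i j : P.I) (x y : ℕ) : (cross i x j y).bind (dotMap d) = cross i x j y := by
  rcases x with _ | x
  · exact bind_eqE _
  rcases y with _ | y
  · exact bind_eqE
      ((mul_one _).trans (one_mul _).symm : strand i (x + 1) * 1 = 1 * strand i (x + 1))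
  · rfl

theorem bind_coupon (i j : P.I) (z : ℕ) (p : ZMod 2) (f : A) (hf : IsCoupon P z j i p f) :
    (coupon z j i p f hf).bind (dotMap d) = coupon z j i p f hf := by
  rcases z with _ | z
  · exact bind_eqE (rfl : strand i 0 = strand j 0)
  · rfl

theorem bind_str (i : P.I) (x : ℕ) : (str i x).bind (dotMap d) = str i x := rfl

theorem bind_splitN (i : P.I) (x y n : ℕ) (h : x + y = n) :
    (splitN i x y n h).bind (dotMap d) = splitN i x y n h := by
  simp only [splitN, WExpr.bind, bind_split, bind_eqE]

theorem bind_mergeN (i : P.I) (x y n : ℕ) (h : x + y = n) :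
    (mergeN i x y n h).bind (dotMap d) = mergeN i x y n h := by
  simp only [mergeN, WExpr.bind, bind_merge, bind_eqE]

theorem bind_asc (X Y Z : Comps P) : (asc X Y Z).bind (dotMap d) = asc X Y Z := bind_eqE _

theorem bind_asc' (X Y Z : Comps P) : (asc' X Y Z).bind (dotMap d) = asc' X Y Z := bind_eqE _

theorem bind_blow {i j : P.I} (f : Dia P D (strand i 1) (strand j 1)) (x : ℕ) :
    (blow f x).bind (dotMap d) = blow (f.bind (dotMap d)) x := by
  induction x with
  | zero => rfl
  | succ x ih => simp only [blow, WExpr.bind, bind_split, bind_merge, ih]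

theorem bind_knot {i j : P.I} {n : ℕ} (c : Fin n → ℕ)
    (f : ∀ r, Dia P D (strand i (c r)) (strand j (c r))) (l : List (Fin n)) :
    (knot c f l).bind (dotMap d) = knot c (fun r => (f r).bind (dotMap d)) l := by
  induction l with
  | nil => rfl
  | cons r l ih =>
    exact congrArg₂ WExpr.comp (bind_split ..)
      (congrArg₂ WExpr.comp (congrArg (WExpr.tensor _) ih) (bind_merge ..))

theorem bind_knotTo {i j : P.I} {n : ℕ} (c : Fin n → ℕ)
    (f : ∀ r, Dia P D (strand i (c r)) (strand j (c r))) (l : List (Fin n)) (t : ℕ) :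
    (knotTo c f l t).bind (dotMap d) = knotTo c (fun r => (f r).bind (dotMap d)) l t := by
  unfold knotTo
  split_ifs
  · simp only [WExpr.bind, bind_eqE, bind_knot]
  · rfl

theorem bind_bracket (j i : P.I) (p : ZMod 2) (f : A) (hc : f ∈ P.corner j i)
    (hp : f ∈ P.parity p) (z : ℕ) :
    (bracket j i p f hc hp z).bind (dotMap d) = bracket j i p f hc hp z := by
  unfold bracket
  split_ifs
  · exact bind_coupon ..
  · exact (bind_blow ..).trans (congrArg (blow · z) (bind_coupon ..))

theorem bind_teleporter (B : P.GoodBasis) (i j : P.I) (t : ℕ) (Z : Comps P) :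
    (teleporter B i j t Z).bind (dotMap d) = teleporter B i j t Z := by
  simp only [teleporter, bind_sum, List.map_map]
  congr 1
  refine List.map_congr_left fun μ _ => ?_
  simp only [Function.comp_apply, WExpr.bind, muDia, muDualDia, bind_knotTo, bind_bracket]

theorem bind_msTerm (i : P.I) (x y z w t : ℕ) :
    (msTerm i x y z w t).bind (dotMap d) = msTerm i x y z w t := by
  unfold msTerm
  split_ifs
  · simp only [WExpr.bind, bind_splitN, bind_mergeN, bind_eqE, bind_str, bind_cross]
  · rfl

/-- These relations contain no dots, so each is carried to the same relation over the other
signature. -/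
theorem finRel_bind {X Y : Comps P} {e e' : Dia P D X Y} (h : FinRel P D e e') :
    FinRel P D' (e.bind (dotMap d)) (e'.bind (dotMap d)) := by
  induction h with
  | merge_split i x y z w h =>
    simp only [WExpr.bind, bind_merge, bind_splitN, bind_sum, List.map_map, Function.comp_def,
      bind_msTerm]
    exact .merge_split i x y z w h
  | coupon_add i j x p f g hf hg =>
    simp only [WExpr.bind, bind_coupon, bind_splitN, bind_mergeN, bind_sum, List.map_map,
      Function.comp_def]
    exact .coupon_add i j x p f g hf hg
  | _ =>
    simp only [WExpr.bind, bind_split, bind_merge, bind_cross, bind_coupon, bind_str, bind_asc,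
      bind_asc', bind_eqE]
    first
      | apply FinRel.split_assoc
      | apply FinRel.merge_assoc
      | apply FinRel.knothole
      | (apply FinRel.cross_cross; assumption)
      | (apply FinRel.braid <;> assumption)
      | (apply FinRel.split_cross_right; assumption)
      | (apply FinRel.split_cross_left; assumption)
      | (apply FinRel.merge_cross_left; assumption)
      | (apply FinRel.merge_cross_right; assumption)
      | apply FinRel.coupon_id
      | apply FinRel.coupon_smul
      | apply FinRel.coupon_comp
      | apply FinRel.odd_knothole
      | apply FinRel.coupon_split
      | apply FinRel.merge_coupon
      | apply FinRel.coupon_cross_left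
      | apply FinRel.coupon_cross_right

end DotMap

instance (B : P.GoodBasis) : HasFinRel (affPresentation P B) := ⟨fun h => .rel (AffRel.fin h)⟩

instance (B : P.GoodBasis) : HasFinRel (thinPresentation P B) := ⟨fun h => .rel (ThinRel.fin h)⟩

instance (B : P.GoodBasis) : HasThinRel B (thinPresentation P B) := ⟨fun h => .rel h⟩

/-- The dots on thin strands, seen as affine dots. -/
def thinToAff (i : P.I) (z : ℕ+) (_ : thinDots z) : Dia P allDots (strand i z) (strand i z) :=
  affDot i z

def affToThin (i : P.I) (z : ℕ+) (_ : allDots z) : Dia P thinDots (strand i z) (strand i z) :=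
  whiteDot i z

theorem bind_thinDot (i : P.I) : (thinDot i).bind (dotMap thinToAff) = affDot i 1 := rfl

theorem bind_affDot_succ (i : P.I) (x : ℕ) :
    (affDot i (x + 1)).bind (dotMap affToThin) = whiteDot i (x + 1) := rfl

theorem bind_affDot_zero (i : P.I) :
    (affDot i 0).bind (dotMap affToThin) = WExpr.id _ := rfl

theorem hasParity_thinToAff (i : P.I) (z : ℕ+) (hz : thinDots z) :
    (thinToAff i z hz).HasParity 0 := hasParity_dot _ _ _

theorem hasParity_affToThin (i : P.I) (z : ℕ+) (hz : allDots z) :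
    (affToThin i z hz).HasParity 0 := hasParity_whiteDot _ _

end AffineWeb

namespace AffineWeb

open FrobeniusGreatPair SuperPresentation

variable {k : Type u} [Field k] {A : Type v} [NonUnitalRing A] [Module k A] [IsScalarTower k A A]
  [SMulCommClass k A A] {P : FrobeniusGreatPair k A}

/-! ### White dots satisfy the affine relations -/

section AffToThin

variable (B : P.GoodBasis) (R : SuperPresentation k (webSig P thinDots)) (L N : Comps P) (i j : P.I)

/-- For `x = 0` the substitution gives the bare identity, while the white dot is formally a scalar
multiple of it; the two agree only as operators. -/
theorem layE_bind_affDot (x : ℕ) :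
    R.layE L ((affDot i x).bind (dotMap affToThin)) N = R.lay L (Wh i x) N := by
  rcases x with _ | x
  · rw [bind_affDot_zero, lay_whiteDot_zero, layE_id, strand_zero, one_mul]
  · rw [bind_affDot_succ, layE_eq_lay]

variable [HasFinRel R] [CharZero k]

theorem layE_bind_dotCrossTerm {D : ℕ → Prop} (hD : ∀ z, D z)
    {d : ∀ (i : P.I) (z : ℕ+), D z → Dia P thinDots (strand i z) (strand i z)}
    (hd : ∀ L N i x, R.layE L ((dot i x (hD x)).bind (dotMap d)) N = R.lay L (Wh i x) N)
    {x y t : ℕ} (hx : t ≤ x) (hy : t ≤ y) :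
    R.layE L ((dotCrossTerm B hD i x j y t).bind (dotMap d)) N =
      whiteDotCrossTerm B R L N i j x (x - t) (y - t) t := by
  have e1 : t + (x - t) = x := by omega
  have e2 : x - t + t = x := by omega
  have e3 : t + (y - t) = y := by omega
  have e4 : y - t + t = y := by omega
  have ht : ∀ Z N, R.layE L (teleporter B i j t Z) N = R.lay L (Te B i j t Z) N :=
    fun _ _ => layE_eq_lay ..
  rw [dotCrossTerm, dif_pos ⟨hx, hy⟩, whiteDotCrossTerm, whiteDotCrossTail]
  simp only [WExpr.bind, bind_splitN, bind_mergeN, bind_eqE, bind_str, bind_cross, bind_teleporter,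
    hd, layE_comp, layE_tensor_snoc, layE_eqE, layE_str, layE_splitN, layE_mergeN, layE_cross,
    ht, mul_assoc, snoc_mul_eq, snoc_mul, e1, e2, e3, e4, idn_mul_lay,
    lay_mul_idn, idn_mul_lay_mul, lay_mul_idn_mul]

theorem layE_bind_dotCrossTerm_of_lt {D : ℕ → Prop} (hD : ∀ z, D z)
    {d : ∀ (i : P.I) (z : ℕ+), D z → Dia P thinDots (strand i z) (strand i z)}
    {x y t : ℕ} (hy : y < t) :
    R.layE L ((dotCrossTerm B hD i x j y t).bind (dotMap d)) N = 0 := by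
  rw [dotCrossTerm, dif_neg fun h => absurd h.2 (by omega), WExpr.bind, layE_zero]

theorem affRel_bind [HasThinRel B R] {X Y : Comps P} {e e' : Dia P allDots X Y}
    (h : AffRel P B e e') :
    WExpr.Eqv R (e.bind (dotMap affToThin)) (e'.bind (dotMap affToThin)) := by
  suffices h : ∀ L N, R.layE L (e.bind (dotMap affToThin)) N =
      R.layE L (e'.bind (dotMap affToThin)) N from eqv_of_layE (h 1 1)
  intro L N
  induction h with
  | fin h => exact layE_congr (HasFinRel.eqv (finRel_bind h)) L N
  | coupon_dot i j x p f hf =>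
    simp only [WExpr.bind, bind_coupon, layE_comp, layE_coupon, layE_bind_affDot]
    exact coupon_whiteDot R L N i j x B hf
  | dot_split i x y =>
    simp only [WExpr.bind, bind_split, layE_comp, layE_tensor_snoc, layE_split, layE_bind_affDot]
    exact whiteDot_split R L N i x y B
  | merge_dot i x y =>
    simp only [WExpr.bind, bind_merge, layE_comp, layE_tensor_snoc, layE_merge, layE_bind_affDot,
      mul_assoc]
    exact merge_whiteDot R L N i x y B
  | dot_cross i j x y =>
    simp only [WExpr.bind, bind_cross, bind_str, layE_comp, layE_tensor_snoc, layE_cross, layE_str,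
      layE_bind_affDot, bind_sum, layE_sum, List.map_map]
    rw [idn_mul_lay (Wh i x) (by simp only [snoc_mul_eq]), whiteDot_cross B R L N i j,
      Finset.sum_range, ← List.sum_ofFn, List.ofFn_eq_map, ← List.map_coe_finRange_eq_range,
      List.map_map]
    refine congrArg List.sum (List.map_congr_left fun t _ => ?_)
    simp only [Function.comp_apply, WExpr.bind, layE_smul]
    split_ifs with h
    · exact congrArg _ (layE_bind_dotCrossTerm B R L N i j (fun _ => trivial)
        (fun L N i x => layE_bind_affDot R L N i x) (Nat.lt_succ_iff.mp t.2) h).symm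
    · exact ((congrArg _ (layE_bind_dotCrossTerm_of_lt B R L N i j (fun _ => trivial)
        (not_le.mp h))).trans (smul_zero _)).symm

end AffToThin

/-! ### Thin relations as the case of thickness one -/

section Dot

variable {D : ℕ → Prop} (B : P.GoodBasis) (R : SuperPresentation k (webSig P D)) (L N : Comps P)
  (i j : P.I) (hD : ∀ z, D z)

/-- A dot, over a signature that has dots of all thicknesses. -/
abbrev Do (i : P.I) (x : ℕ) : Tile k (webSig P D) := ⟨_, _, dot i x (hD x)⟩

theorem lay_dot_zero : R.lay L (Do hD i 0) N = R.idn (L * N) := by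
  have h : dot i 0 (hD 0) = (WExpr.id (strand i 0) : Dia P D _ _) := rfl
  rw [← layE_eq_lay, h, layE_id, strand_zero, one_mul]

theorem layE_dotCrossTerm {x y t : ℕ} (hx : t ≤ x) (hy : t ≤ y) :
    R.layE L (dotCrossTerm B hD i x j y t) N =
      R.lay (L ◂ strand i x) (Sp j (y - t) t) N *
      (R.lay L (Sp i t (x - t)) (strand j (y - t) * (strand j t * N)) *
      (R.lay L (Te B i j t (strand i (x - t) * strand j (y - t))) N *
      (R.lay (L ◂ strand j t) (Cr i (x - t) j (y - t)) (strand i t * N) *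
      (R.lay (L ◂ strand j t ◂ strand j (y - t)) (Do hD i (x - t)) (strand i t * N) *
      (R.lay (L ◂ strand j t ◂ strand j (y - t)) (Mg i (x - t) t) N *
        R.lay L (Mg j t (y - t)) (strand i x * N)))))) := by
  have e1 : t + (x - t) = x := by omega
  have e2 : x - t + t = x := by omega
  have e3 : t + (y - t) = y := by omega
  have e4 : y - t + t = y := by omega
  have ht : ∀ Z N, R.layE L (teleporter B i j t Z) N = R.lay L (Te B i j t Z) N :=
    fun _ _ => layE_eq_lay ..
  have hd : ∀ x h L N, R.layE L (dot i x h) N = R.lay L (Do hD i x) N :=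
    fun _ _ _ _ => layE_eq_lay ..
  rw [dotCrossTerm, dif_pos ⟨hx, hy⟩]
  simp only [layE_comp, layE_tensor_snoc, layE_eqE, layE_str, layE_splitN, layE_mergeN, layE_cross,
    hd, ht, mul_assoc, snoc_mul_eq, snoc_mul, e1, e2, e3, e4, idn_mul_lay,
    lay_mul_idn, idn_mul_lay_mul, lay_mul_idn_mul]

theorem layE_dotCrossTerm_one_one_zero [HasFinRel R] [CharZero k] :
    R.layE L (dotCrossTerm B hD i 1 j 1 0) N =
      R.lay L (Cr i 1 j 1) N * R.lay (L ◂ strand j 1) (Do hD i 1) N := by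
  rw [layE_dotCrossTerm B R L N i j hD (by omega) (by omega)]
  simp only [Nat.sub_zero, lay_Sp_zero_left, lay_Sp_zero_right, lay_Mg_zero_left, lay_Mg_zero_right,
    lay_teleporter_zero, strand_zero, one_mul, snoc_one, snoc_mul_eq, mul_assoc, idn_mul_idn,
    idn_mul_idn_mul]
  rw [lay_mul_idn (Do hD i 1) (by simp only [snoc_mul_eq]),
    idn_mul_lay_mul (Cr i 1 j 1) (by simp only [mul_assoc])]

theorem layE_dotCrossTerm_one_one_one [CharZero k] :
    R.layE L (dotCrossTerm B hD i 1 j 1 1) N = R.lay L (Te B i j 1 1) N := by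
  rw [layE_dotCrossTerm B R L N i j hD le_rfl le_rfl]
  simp only [Nat.sub_self, lay_Sp_zero_left, lay_Sp_zero_right, lay_Mg_zero_left, lay_Mg_zero_right,
    lay_Cr_zero_left, lay_dot_zero, strand_zero, one_mul, mul_one, snoc_one, snoc_mul_eq, mul_assoc,
    idn_mul_idn, idn_mul_idn_mul]
  rw [idn_mul_lay_mul (Te B i j 1 1) (by simp only [one_mul, mul_assoc]),
    lay_mul_idn (Te B i j 1 1) (by simp only [one_mul, mul_assoc])]

/-- For two thin strands the summand `t = 0` is the crossing with the dot above it, and `t = 1` is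
the teleporter alone, all other strands being empty. -/
theorem layE_sum_dotCrossTerm_one_one [HasFinRel R] [CharZero k] :
    R.layE L (WExpr.sum ((List.range (1 + 1)).map fun t =>
      (dotCrossTerm B hD i 1 j 1 t).smul ((-1) ^ t))) N =
    R.lay L (Cr i 1 j 1) N * R.lay (L ◂ strand j 1) (Do hD i 1) N +
      (-1 : k) • R.lay L (Te B i j 1 1) N := by
  simp only [layE_sum, List.map_map, List.range_succ, List.range_zero, List.map_append,
    List.map_cons, List.map_nil, List.nil_append, List.sum_append, List.sum_cons, List.sum_nil,
    Function.comp_apply, layE_smul, pow_zero, pow_one, one_smul, add_zero, zero_add,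
    layE_dotCrossTerm_one_one_zero, layE_dotCrossTerm_one_one_one]

end Dot

theorem allDots_apply (z : ℕ) : allDots z := trivial

theorem thinRel_bind [CharZero k] (B : P.GoodBasis) {X Y : Comps P} {e e' : Dia P thinDots X Y}
    (h : ThinRel P B e e') :
    WExpr.Eqv (affPresentation P B) (e.bind (dotMap thinToAff)) (e'.bind (dotMap thinToAff)) := by
  induction h with
  | fin h => exact HasFinRel.eqv (finRel_bind h)
  | coupon_dot i j p f hf =>
    simp only [WExpr.bind, bind_coupon, bind_thinDot]
    exact .rel (AffRel.coupon_dot (B := B) i j 1 p f hf)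
  | dot_cross i j =>
    simp only [WExpr.bind, bind_cross, bind_str, bind_teleporter, bind_eqE, bind_thinDot]
    refine .trans (.rel (AffRel.dot_cross (B := B) i j 1 1)) (eqv_of_layE ?_)
    refine (layE_sum_dotCrossTerm_one_one B (affPresentation P B) 1 1 i j allDots_apply).trans ?_
    have ht : ∀ L N, (affPresentation P B).layE L (teleporter B i j 1 1) N =
      (affPresentation P B).lay L (Te B i j 1 1) N := fun _ _ => layE_eq_lay ..
    have hd : ∀ L N, (affPresentation P B).layE L (affDot i 1) N =
      (affPresentation P B).lay L (Do allDots_apply i 1) N := fun _ _ => layE_eq_lay ..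
    simp only [layE_smul, layE_add, layE_comp, layE_eqE, layE_tensor_snoc, layE_str,
      layE_cross, ht, hd]
    rw [lay_mul_idn (Te B i j 1 1) (by simp only [one_mul, mul_assoc]),
      idn_mul_lay (Te B i j 1 1) (by simp only [one_mul, mul_assoc]),
      lay_mul_idn (Do allDots_apply i 1) (by simp only [snoc_mul_eq])]

/-! ### The substitutions are mutually inverse on generators -/

section Inverse

variable (B : P.GoodBasis)

/-- Affine dots on the two legs of a split can be gathered into one dot below it. What remains at
each step is a thin knothole, with factor `x + 1`. -/
theorem layE_blow_affDot (L N : Comps P) (i : P.I) (x : ℕ) :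
    (affPresentation P B).layE L (blow (affDot i 1) x) N =
      (x.factorial : k) • (affPresentation P B).layE L (affDot i x) N := by
  induction x generalizing L N with
  | zero =>
    rw [Nat.factorial_zero, Nat.cast_one, one_smul]
    rfl
  | succ x ih =>
    have h := layE_congr (WExpr.Eqv.rel (R := affPresentation P B) (AffRel.dot_split i x 1)) L N
    rw [layE_comp, layE_comp, layE_tensor_snoc] at h
    have hk := knothole (affPresentation P B) L N i x 1
    have ha : (affPresentation P B).layE L (affDot i (x + 1)) N =
      (affPresentation P B).lay L (Do allDots_apply i (x + 1)) N := layE_eq_lay ..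
    rw [blow, layE_comp, layE_comp, layE_tensor_snoc, ih]
    simp only [smul_mul_assoc, mul_smul_comm]
    rw [← mul_assoc, ← h, mul_assoc, layE_split, layE_merge, hk, mul_smul_comm, smul_smul, ha,
      lay_mul_idn (Do allDots_apply i (x + 1)) rfl, Nat.choose_succ_self_right,
      Nat.factorial_succ, Nat.cast_mul, mul_comm]

theorem dotMap_thinToAff_bind [CharZero k] (g : (webSig P allDots).Gen) :
    WExpr.Eqv (affPresentation P B) ((dotMap affToThin g).bind (dotMap thinToAff)) (.gen g) := by
  cases g with
  | split i x y => exact .refl _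
  | merge i x y => exact .refl _
  | cross i j x y => exact .refl _
  | coupon z j i p f hf => exact .refl _
  | dot i z hz =>
    obtain ⟨z, hz'⟩ := z
    obtain ⟨x, rfl⟩ : ∃ x, z = x + 1 := ⟨z - 1, by omega⟩
    refine eqv_of_layE (e := (whiteDot i (x + 1)).bind (dotMap thinToAff))
      (e' := affDot i (x + 1)) ?_
    rw [whiteDot, WExpr.bind, bind_blow, bind_thinDot, layE_smul, layE_blow_affDot, smul_smul,
      inv_mul_cancel₀ (Nat.cast_ne_zero.mpr (Nat.factorial_ne_zero _)), one_smul]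

theorem dotMap_affToThin_bind [CharZero k] (g : (webSig P thinDots).Gen) :
    WExpr.Eqv (thinPresentation P B) ((dotMap thinToAff g).bind (dotMap affToThin)) (.gen g) := by
  cases g with
  | split i x y => exact .refl _
  | merge i x y => exact .refl _
  | cross i j x y => exact .refl _
  | coupon z j i p f hf => exact .refl _
  | dot i z hz =>
    obtain ⟨z, hz'⟩ := z
    obtain rfl : z = 1 := hz
    refine eqv_of_layE (e := whiteDot i 1) (e' := thinDot i) ?_
    exact (layE_eq_lay ..).trans ((lay_whiteDot_one (thinPresentation P B) 1 1 i).trans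
      (layE_eq_lay ..).symm)

end Inverse

end AffineWeb

/-! ### Existence and uniqueness of the two functors -/

namespace AffineWeb

open FrobeniusGreatPair SuperPresentation

variable {k : Type u} [Field k] [CharZero k] {A : Type v} [NonUnitalRing A] [Module k A]
  [IsScalarTower k A A] [SMulCommClass k A A] {P : FrobeniusGreatPair k A}

theorem functorSends_of_bind {D D' : ℕ → Prop} {d : ∀ (i : P.I) (z : ℕ+), D z →
    Dia P D' (strand i z) (strand i z)} {R : SuperPresentation k (webSig P D)}
    {R' : SuperPresentation k (webSig P D')} (hφ : ∀ g, (dotMap d g).HasParity ((webSig P D).par g))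
    (hR : ∀ {X Y : Comps P} {e e' : Dia P D X Y}, R.rel e e' →
      WExpr.Eqv R' (e.bind (dotMap d)) (e'.bind (dotMap d)))
    {X Y : Comps P} (e : Dia P D X Y) (e' : Dia P D' X Y)
    (h : WExpr.Eqv R' (e.bind (dotMap d)) e') :
    FunctorSends (bindFunctor hφ hR).toFunctor (R.homMk e) (R'.homMk e') :=
  ⟨rfl, rfl, ((eqv_iff_homMk (R := R')).mp h).trans (eq_eqToHom_comp (C := R'.Obj) _ rfl rfl)⟩

/-- The functor from the thin dot web category to the affine web category. -/
def thinToAffFunctor (B : P.GoodBasis) : StrictMonoidalSuperfunctor k (WebThin P B) (WebAff P B) :=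
  bindFunctor (R := thinPresentation P B) (R' := affPresentation P B)
    (hasParity_dotMap hasParity_thinToAff) (thinRel_bind B)

/-- The functor from the affine web category to the thin dot web category that sends affine dots
to white dots. -/
def affToThinFunctor (B : P.GoodBasis) : StrictMonoidalSuperfunctor k (WebAff P B) (WebThin P B) :=
  bindFunctor (R := affPresentation P B) (R' := thinPresentation P B)
    (hasParity_dotMap hasParity_affToThin) (affRel_bind B (thinPresentation P B))

theorem isMateFunctor_thinToAffFunctor (B : P.GoodBasis) :
    IsMateFunctor B (thinToAffFunctor B) where
  obj _ := rfl
  split i x y := functorSends_of_bind _ (thinRel_bind B) _ _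
    (bind_split (d := thinToAff) i x y ▸ .refl _)
  merge i x y := functorSends_of_bind _ (thinRel_bind B) _ _
    (bind_merge (d := thinToAff) i x y ▸ .refl _)
  cross i j x y := functorSends_of_bind _ (thinRel_bind B) _ _
    (bind_cross (d := thinToAff) i j x y ▸ .refl _)
  coupon i j x p f hf :=
    functorSends_of_bind _ (thinRel_bind B) _ _
      (bind_coupon (d := thinToAff) i j x p f hf ▸ .refl _)
  dot i := functorSends_of_bind _ (thinRel_bind B) _ _ (.refl _)

theorem isWhiteDotFunctor_affToThinFunctor (B : P.GoodBasis) :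
    IsWhiteDotFunctor B (affToThinFunctor B) where
  obj _ := rfl
  split i x y := functorSends_of_bind _ (affRel_bind B (thinPresentation P B)) _ _
    (bind_split (d := affToThin) i x y ▸ .refl _)
  merge i x y := functorSends_of_bind _ (affRel_bind B (thinPresentation P B)) _ _
    (bind_merge (d := affToThin) i x y ▸ .refl _)
  cross i j x y := functorSends_of_bind _ (affRel_bind B (thinPresentation P B)) _ _
    (bind_cross (d := affToThin) i j x y ▸ .refl _)
  coupon i j x p f hf :=
    functorSends_of_bind _ (affRel_bind B (thinPresentation P B)) _ _
      (bind_coupon (d := affToThin) i j x p f hf ▸ .refl _)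
  dot i x := functorSends_of_bind _ (affRel_bind B (thinPresentation P B)) _ _ (eqv_of_layE (by
    rw [layE_bind_affDot]
    exact (layE_eq_lay ..).symm))

/-- Generators have positive thicknesses, whereas the conditions on the functors are stated for
natural numbers with strands of thickness zero deleted; for successors the two agree by definition.
-/
theorem functorSends_dotMap {D D' : ℕ → Prop} {d : ∀ (i : P.I) (z : ℕ+), D z →
    Dia P D' (strand i z) (strand i z)} {R : SuperPresentation k (webSig P D)}
    {R' : SuperPresentation k (webSig P D')} {F : R.Obj ⥤ R'.Obj}
    (hs : ∀ i x y, FunctorSends F (R.homMk (split i x y)) (R'.homMk (split i x y)))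
    (hm : ∀ i x y, FunctorSends F (R.homMk (merge i x y)) (R'.homMk (merge i x y)))
    (hc : ∀ i j x y, FunctorSends F (R.homMk (cross i x j y)) (R'.homMk (cross i x j y)))
    (hf : ∀ i j x p f hf, FunctorSends F (R.homMk (coupon x j i p f hf))
      (R'.homMk (coupon x j i p f hf)))
    (hd : ∀ i (z : ℕ+) (hz : D z), FunctorSends F
      (R.homMk (.gen (G := webSig P D) (.dot i z hz))) (R'.homMk (d i z hz)))
    (g : (webSig P D).Gen) : FunctorSends F (R.homMk (.gen g)) (R'.homMk (dotMap d g)) := by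
  rcases g with ⟨i, ⟨x, hx⟩, ⟨y, hy⟩⟩ | ⟨i, ⟨x, hx⟩, ⟨y, hy⟩⟩ | ⟨i, j, ⟨x, hx⟩, ⟨y, hy⟩⟩ |
    ⟨⟨z, hz⟩, j, i, p, f, h⟩ | ⟨i, z, hz⟩
  · obtain ⟨x, rfl⟩ := Nat.exists_eq_succ_of_ne_zero hx.ne'
    obtain ⟨y, rfl⟩ := Nat.exists_eq_succ_of_ne_zero hy.ne'
    exact hs i (x + 1) (y + 1)
  · obtain ⟨x, rfl⟩ := Nat.exists_eq_succ_of_ne_zero hx.ne'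
    obtain ⟨y, rfl⟩ := Nat.exists_eq_succ_of_ne_zero hy.ne'
    exact hm i (x + 1) (y + 1)
  · obtain ⟨x, rfl⟩ := Nat.exists_eq_succ_of_ne_zero hx.ne'
    obtain ⟨y, rfl⟩ := Nat.exists_eq_succ_of_ne_zero hy.ne'
    exact hc i j (x + 1) (y + 1)
  · obtain ⟨z, rfl⟩ := Nat.exists_eq_succ_of_ne_zero hz.ne'
    exact hf i j (z + 1) p f h
  · exact hd i z hz

theorem eq_thinToAffFunctor (B : P.GoodBasis)
    (F : StrictMonoidalSuperfunctor k (WebThin P B) (WebAff P B)) (hF : IsMateFunctor B F) :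
    F = thinToAffFunctor B := by
  refine eq_bindFunctor (R := thinPresentation P B) (R' := affPresentation P B)
    (hasParity_dotMap hasParity_thinToAff) (thinRel_bind B) F hF.obj
    (functorSends_dotMap hF.split hF.merge hF.cross hF.coupon ?_)
  rintro i ⟨z, _⟩ hz
  obtain rfl : z = 1 := hz
  exact hF.dot i

theorem eq_affToThinFunctor (B : P.GoodBasis)
    (F : StrictMonoidalSuperfunctor k (WebAff P B) (WebThin P B)) (hF : IsWhiteDotFunctor B F) :
    F = affToThinFunctor B := by
  refine eq_bindFunctor (R := affPresentation P B) (R' := thinPresentation P B)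
    (hasParity_dotMap hasParity_affToThin) (affRel_bind B (thinPresentation P B)) F hF.obj
    (functorSends_dotMap hF.split hF.merge hF.cross hF.coupon ?_)
  rintro i ⟨z, hz'⟩ -
  obtain ⟨z, rfl⟩ := Nat.exists_eq_succ_of_ne_zero hz'.ne'
  exact hF.dot i (z + 1)

theorem affToThinFunctor_thinToAffFunctor (B : P.GoodBasis) :
    (thinToAffFunctor B).toFunctor ⋙ (affToThinFunctor B).toFunctor = 𝟭 (WebThin P B) :=
  bindFunctor_comp_eq_id (hasParity_dotMap hasParity_thinToAff) (thinRel_bind B)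
    (hasParity_dotMap hasParity_affToThin) (affRel_bind B (thinPresentation P B))
    (dotMap_affToThin_bind B)

theorem thinToAffFunctor_affToThinFunctor (B : P.GoodBasis) :
    (affToThinFunctor B).toFunctor ⋙ (thinToAffFunctor B).toFunctor = 𝟭 (WebAff P B) :=
  bindFunctor_comp_eq_id (hasParity_dotMap hasParity_affToThin)
    (affRel_bind B (thinPresentation P B)) (hasParity_dotMap hasParity_thinToAff) (thinRel_bind B)
    (dotMap_thinToAff_bind B)

end AffineWeb

theorem corollaryT {k : Type u} {A : Type v} [Field k] [CharZero k] [NonUnitalRing A] [Module k A]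
    [IsScalarTower k A A] [SMulCommClass k A A] (P : FrobeniusGreatPair k A) (B : P.GoodBasis) :
    ∃ (ι : StrictMonoidalSuperfunctor k (AffineWeb.WebThin P B) (AffineWeb.WebAff P B))
      (κ : StrictMonoidalSuperfunctor k (AffineWeb.WebAff P B) (AffineWeb.WebThin P B)),
      AffineWeb.IsMateFunctor B ι ∧
      (∀ ι' : StrictMonoidalSuperfunctor k (AffineWeb.WebThin P B) (AffineWeb.WebAff P B),
        AffineWeb.IsMateFunctor B ι' → ι' = ι) ∧
      AffineWeb.IsWhiteDotFunctor B κ ∧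
      (∀ κ' : StrictMonoidalSuperfunctor k (AffineWeb.WebAff P B) (AffineWeb.WebThin P B),
        AffineWeb.IsWhiteDotFunctor B κ' → κ' = κ) ∧
      ι.toFunctor ⋙ κ.toFunctor = 𝟭 (AffineWeb.WebThin P B) ∧
      κ.toFunctor ⋙ ι.toFunctor = 𝟭 (AffineWeb.WebAff P B) :=
  ⟨AffineWeb.thinToAffFunctor B, AffineWeb.affToThinFunctor B,
    AffineWeb.isMateFunctor_thinToAffFunctor B, AffineWeb.eq_thinToAffFunctor B,
    AffineWeb.isWhiteDotFunctor_affToThinFunctor B, AffineWeb.eq_affToThinFunctor B,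
    AffineWeb.affToThinFunctor_thinToAffFunctor B, AffineWeb.thinToAffFunctor_affToThinFunctor B⟩
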